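/- **Setting.** For $x\in\mathbb R^3$ let $x^\times\in\mathbb R^{3\times3}$ be the skew-symmetric matrix with $x^\times y=x\times y$; for $A=[a_{ij}]\in\mathbb R^{3\times 3}$ let $\psi(A)=\frac12[a_{32}-a_{23},\,a_{13}-a_{31},\,a_{21}-a_{12}]^\top$; for $R\in SO(3)$ let $|R|_I=\sqrt{\mathrm{tr}(I_3-R)/4}$. Let $p_1,\dots,p_N\in\mathbb R^3$ be landmarks, at least three of which are non-collinear, let $k_i>0$ with $\sum_i k_i=1$, and put $p_c=\sum_i k_ip_i$, $M=\sum_i k_i(p_i-p_c)(p_i-p_c)^\top$, $\bar M=\frac12(\mathrm{tr}(M)I_3-M)$ and $\varsigma_M=\lambda_{\min}(\bar M)/\lambda_{\max}(\bar M)$. Let $g\in\mathbb R^3$, $0<T_m\le T_M<\infty$, and let $\omega:[0,\infty)\to\mathbb R^3$, $V_t\in\mathbb R^{6\times6}$, $Q_t\in\mathbb R^{3\times3}$ ($t\ge0$) be such that $\omega$ and $V_t$ are continuous and bounded, $Q_t$ is bounded, and $V_t,Q_t$ are (symmetric and) uniformly positive definite. For an attitude trajectory $R(t)\in SO(3)$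 with $\dot R=R\,\omega^\times$, a symmetric positive definite $P_0\in\mathbb R^{6\times6}$ and a gain $k_R>0$, consider the hybrid system with state $x_2=(\tilde R,\eta,\mathsf x,\tau)\in SO(3)\times\mathbb R^3\times\mathbb R^6\times[0,T_M]$, together with the matrix $P\in\mathbb R^{6\times 6}$: $$\text{for }\tau\in[0,T_M]:\quad \dot{\tilde R}=\tilde R(-\eta)^\times,\quad \dot\eta=0,\quad \dot{\mathsf x}=A_t\mathsf x+\bar\delta_g,\quad \dot\tau=-1,\quad \dot P=A_tP+PA_t^\top+V_t,$$ $$\text{for }\tau=0:\quad \tilde R^+=\tilde R,\quad \eta^+=k_R\psi(M\tilde R),\quad \mathsf x^+=(I-KC)\mathsf x,\quad \tau^+\in[T_m,T_M],\quad P^+=P-PC^\top(CPC^\top+Q_t)^{-1}CP,$$ where $$A_t=\begin{bmatrix}-\omega(t)^\times&I_3\\0&-\omega(t)^\times\end{bmatrix},\quad C=[I_3\ \ 0],\quad K=PC^\top(CPC^\top+Q_t)^{-1},\quad \bar\delta_g=\begin{bmatrix}0\\(R-\hat R)^\top g\end{bmatrix},\quad \hat R=\tilde R^\top R,$$ and $P(0,0)=P_0$.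 Solutions are hybrid arcs starting at time $t=0$, and $t$ in the coefficients is the ordinary time of the hybrid time $(t,j)$. Let $\mathcal A=\{(\tilde R,\eta,\mathsf x,\tau): \tilde R=I_3,\ \eta=0,\ \mathsf x=0,\ \tau\in[0,T_M]\}$, and let $|x_2|_{\mathcal A}$ be the infimum over $(\bar R,\bar\eta,\bar{\mathsf x},\bar\tau)\in\mathcal A$ of $\big(|\tilde R\bar R^\top|_I^2+\|\eta-\bar\eta\|^2+\|\mathsf x-\bar{\mathsf x}\|^2+|\tau-\bar\tau|^2\big)^{1/2}$. **Theorem.** For every $0<\epsilon<1$ there exist $\eta^*>0$ and $k_R^*>0$ such that for every $0<k_R<k_R^*$, every attitude trajectory $R$ as above and every symmetric positive definite $P_0$, the set $\mathcal A$ is exponentially stable for all initial conditions with $|\tilde R(0,0)|_I\le\epsilon\sqrt{\varsigma_M}$, $\|\eta(0,0)\|\le\eta^*$, $\mathsf x(0,0)\in\mathbb R^6$, $\tau(0,0)\in[0,T_M]$: there exist $\kappa,\lambda,\mu>0$ such that every maximal solution which has $|x_2(0,0)|_{\mathcal A}<\mu$, or whose initial condition satisfies these restrictions, is complete and satisfies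 $$|x_2(t,j)|_{\mathcal A}\le\kappa\,e^{-\lambda(t+j)}\,|x_2(0,0)|_{\mathcal A}\qquad\text{for all }(t,j)\in\mathrm{dom}\,x_2 .$$ -/

import Mathlib

open Set MeasureTheory
open scoped Matrix

/- Matrices carry the Frobenius norm. -/
attribute [local instance] Matrix.frobeniusNormedAddCommGroup Matrix.frobeniusNormedSpace

noncomputable section

namespace HybridObserver

/-! ### Hybrid systems with a time-varying flow map and jump map -/

/-- A compact hybrid time domain: a finite union of `[t_j, t_{j+1}] × {j}`, `j < J`, with
`0 = t_0 ≤ t_1 ≤ ⋯`. -/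
def IsCompactHybridTimeDomain (E : Set (ℝ × ℕ)) : Prop :=
  ∃ (J : ℕ) (s : ℕ → ℝ), s 0 = 0 ∧ Monotone s ∧
    E = {q : ℝ × ℕ | q.2 < J ∧ q.1 ∈ Icc (s q.2) (s (q.2 + 1))}

/-- A hybrid time domain: a subset of `ℝ≥0 × ℕ` containing `(0, 0)` all of whose truncations
`E ∩ ([0, T] × {0, …, J})`, `(T, J) ∈ E`, are compact hybrid time domains. Equivalently, a finite or
infinite union of intervals `[t_j, t_{j+1}] × {j}`, the last of which (if there is a last one) may
have the form `[t_j, T)` with `T ≤ ∞`. -/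
def IsHybridTimeDomain (E : Set (ℝ × ℕ)) : Prop :=
  ((0 : ℝ), 0) ∈ E ∧ (∀ q ∈ E, 0 ≤ q.1) ∧
    ∀ q ∈ E, IsCompactHybridTimeDomain (E ∩ Icc ((0 : ℝ), 0) q)

/-- A hybrid system `ẋ = F(t, x)`, `x ∈ flowSet`; `x⁺ ∈ G(t, x)`, `x ∈ jumpSet`. -/
structure HybridSystem (X : Type*) where
  flowSet : Set X
  jumpSet : Set X
  flowMap : ℝ → X → X
  jumpMap : ℝ → X → Set X

variable {X : Type*} [NormedAddCommGroup X] [NormedSpace ℝ X]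

/-- `φ`, restricted to the hybrid time domain `E`, is a solution (started at time `0`): a hybrid arc
that flows in the flow set according to the flow map and jumps from the jump set according to the
jump map. The values of `φ` outside `E` are irrelevant. -/
structure HybridSystem.IsSolution (H : HybridSystem X) (E : Set (ℝ × ℕ)) (φ : ℝ → ℕ → X) :
    Prop where
  domain : IsHybridTimeDomain E
  init_mem : φ 0 0 ∈ closure H.flowSet ∪ H.jumpSet
  locally_abs_cont : ∀ (j : ℕ) (a b : ℝ), a ≤ b → (a, j) ∈ E → (b, j) ∈ E →
    AbsolutelyContinuousOnInterval (fun t => φ t j) a b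
  flow_mem : ∀ (j : ℕ), ∀ t ∈ interior {t : ℝ | (t, j) ∈ E}, φ t j ∈ H.flowSet
  flow : ∀ (j : ℕ), ∀ᵐ t : ℝ, t ∈ interior {t : ℝ | (t, j) ∈ E} →
    HasDerivAt (fun t => φ t j) (H.flowMap t (φ t j)) t
  jump : ∀ (t : ℝ) (j : ℕ), (t, j) ∈ E → (t, j + 1) ∈ E →
    φ t j ∈ H.jumpSet ∧ φ t (j + 1) ∈ H.jumpMap t (φ t j)

/-- A maximal solution: a solution that is not the restriction of a solution with a strictly larger
domain. -/
def HybridSystem.IsMaximalSolution (H : HybridSystem X) (E : Set (ℝ × ℕ)) (φ : ℝ → ℕ → X) : Prop :=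
  H.IsSolution E φ ∧
    ∀ (E' : Set (ℝ × ℕ)) (φ' : ℝ → ℕ → X), H.IsSolution E' φ' → E ⊆ E' →
      (∀ q ∈ E, φ' q.1 q.2 = φ q.1 q.2) → E' = E

/-- A solution with domain `E` is complete if `E` is unbounded. -/
def IsCompleteDomain (E : Set (ℝ × ℕ)) : Prop :=
  ∀ b : ℝ, ∃ q ∈ E, b ≤ q.1 + q.2

/-- Exponential stability of the set from which `dist` measures the distance, for the solutions
started in `S₀`: there are `κ, lam, μ > 0` such that every maximal solution which starts in `S₀`,
and either starts at distance less than `μ` or starts in `region`, is complete and satisfies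
`dist (φ (t, j)) ≤ κ exp (- lam (t + j)) dist (φ (0, 0))`. -/
def HybridSystem.ExpStable (H : HybridSystem X) (dist : X → ℝ) (S₀ region : Set X) : Prop :=
  ∃ κ > 0, ∃ lam > 0, ∃ μ > 0, ∀ (E : Set (ℝ × ℕ)) (φ : ℝ → ℕ → X),
    H.IsMaximalSolution E φ → φ 0 0 ∈ S₀ → (dist (φ 0 0) < μ ∨ φ 0 0 ∈ region) →
      IsCompleteDomain E ∧
        ∀ q ∈ E, dist (φ q.1 q.2) ≤ κ * Real.exp (-lam * (q.1 + q.2)) * dist (φ 0 0)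

/-! ### Vectors, matrices, rotations -/

/-- `ℝ³` with the Euclidean norm. -/
abbrev E3 : Type := EuclideanSpace ℝ (Fin 3)

/-- `ℝ⁶ = ℝ³ ⊕ ℝ³` with the Euclidean norm. -/
abbrev E6 : Type := EuclideanSpace ℝ (Fin 3 ⊕ Fin 3)

abbrev Mat3 : Type := Matrix (Fin 3) (Fin 3) ℝ

abbrev Mat6 : Type := Matrix (Fin 3 ⊕ Fin 3) (Fin 3 ⊕ Fin 3) ℝ

/-- The rotation group. -/
def SO3 : Set Mat3 := {R | R * Rᵀ = 1 ∧ Rᵀ * R = 1 ∧ R.det = 1}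

/-- The skew-symmetric matrix `x^×` of the cross product `y ↦ x × y`. -/
def skew (x : E3) : Mat3 :=
  !![0, -x 2, x 1;
     x 2, 0, -x 0;
     -x 1, x 0, 0]

/-- `ψ(A)`, the vector of the skew-symmetric part of `A`. -/
def psi (A : Mat3) : E3 :=
  !₂[(A 2 1 - A 1 2) / 2, (A 0 2 - A 2 0) / 2, (A 1 0 - A 0 1) / 2]

/-- The normalized distance `|R|_I` of a rotation to the identity, `|R|_I² = tr (I - R) / 4`. -/
def attNorm (R : Mat3) : ℝ := Real.sqrt ((1 - R).trace / 4)

/-- `S_t ≥ c I` for all `t ≥ 0` and some `c > 0` (the `S_t` being symmetric). -/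
def UniformlyPosDef {n : Type*} [Fintype n] [DecidableEq n] (S : ℝ → Matrix n n ℝ) : Prop :=
  ∃ c > 0, ∀ t ≥ 0, (S t - c • (1 : Matrix n n ℝ)).PosSemidef

/-- Boundedness on `[0, ∞)`. -/
def BoundedOnNonneg (f : ℝ → X) : Prop := ∃ b : ℝ, ∀ t ≥ 0, ‖f t‖ ≤ b

/-! ### Landmarks -/

section Landmarks

variable {N : ℕ} (p : Fin N → E3) (k : Fin N → ℝ)

/-- The weighted center of the landmarks. -/
def landmarkCenter : E3 := ∑ i, k i • p i

/-- `M = ∑ k_i (p_i - p_c) (p_i - p_c)ᵀ`. -/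
def landmarkMatrix : Mat3 :=
  ∑ i, k i • Matrix.vecMulVec (p i - landmarkCenter p k).ofLp (p i - landmarkCenter p k).ofLp

end Landmarks

/-- `M̄ = (tr(M) I - M) / 2`. -/
def barMatrix (M : Mat3) : Mat3 := (1 / 2 : ℝ) • (M.trace • (1 : Mat3) - M)

/-- The ratio of the smallest and the largest eigenvalue of `M̄`. -/
def eigRatio (M : Mat3) : ℝ :=
  sInf (spectrum ℝ (barMatrix M)) / sSup (spectrum ℝ (barMatrix M))

/-! ### The closed-loop system -/

/-- The error state `(R̃, η, x, τ)`. -/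
abbrev ErrState : Type := Mat3 × E3 × E6 × ℝ

/-- The error state together with the solution `P` of the Riccati equation. -/
abbrev ExtState : Type := ErrState × Mat6

/-- `A_t = [-ω^×, I; 0, -ω^×]`. -/
def matA (w : E3) : Mat6 := Matrix.fromBlocks (-skew w) 1 0 (-skew w)

/-- `C = [I, 0]`. -/
def matC : Matrix (Fin 3) (Fin 3 ⊕ Fin 3) ℝ := Matrix.fromCols 1 0

/-- The gain `K = P Cᵀ (C P Cᵀ + Q)⁻¹`. -/
def gain (P : Mat6) (Q : Mat3) : Matrix (Fin 3 ⊕ Fin 3) (Fin 3) ℝ :=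
  P * matCᵀ * (matC * P * matCᵀ + Q)⁻¹

/-- The gravity perturbation `[0, gᵀ (R - R̂)]ᵀ`, with the attitude estimate `R̂ = R̃ᵀ R`. -/
def gravTerm (g : E3) (R Rt : Mat3) : E6 :=
  WithLp.toLp 2 (Sum.elim 0 ((R - Rtᵀ * R)ᵀ *ᵥ g.ofLp))

/-- The set `SO(3) × ℝ³ × ℝ⁶ × [0, T_M]` of error states. -/
def errSpace (TM : ℝ) : Set ErrState := {x | x.1 ∈ SO3 ∧ x.2.2.2 ∈ Icc 0 TM}

/-- The closed-loop hybrid system in the variables `((R̃, η, x, τ), P)`, with weight matrix `M`,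
gravity `g`, gain `k_R`, sampling bounds `T_m, T_M`, angular velocity `ω`, attitude `R` and Riccati
weights `V, Q`. -/
def closedLoop (M : Mat3) (g : E3) (kR Tm TM : ℝ) (ω : ℝ → E3) (R : ℝ → Mat3)
    (V : ℝ → Mat6) (Q : ℝ → Mat3) : HybridSystem ExtState where
  flowSet := {ξ | ξ.1 ∈ errSpace TM}
  jumpSet := {ξ | ξ.1 ∈ errSpace TM ∧ ξ.1.2.2.2 = 0}
  flowMap := fun t ⟨⟨Rt, η, x, _⟩, P⟩ =>
    ((Rt * skew (-η),
      0,
      WithLp.toLp 2 (matA (ω t) *ᵥ x.ofLp) + gravTerm g (R t) Rt,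
      -1),
      matA (ω t) * P + P * (matA (ω t))ᵀ + V t)
  jumpMap := fun t ⟨⟨Rt, _, x, _⟩, P⟩ =>
    {ξ' | ∃ ν ∈ Icc Tm TM, ξ' =
      ((Rt,
        kR • psi (M * Rt),
        WithLp.toLp 2 ((1 - gain P (Q t) * matC) *ᵥ x.ofLp),
        ν),
        P - P * matCᵀ * (matC * P * matCᵀ + Q t)⁻¹ * matC * P)}

/-- The target set `{R̃ = I, η = 0, x = 0}`. -/
def targetSet (TM : ℝ) : Set ErrState :=
  {x | x ∈ errSpace TM ∧ x.1 = 1 ∧ ‖x.2.1‖ = 0 ∧ ‖x.2.2.1‖ = 0}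

/-- The distance between two error states. -/
def errDist (x y : ErrState) : ℝ :=
  Real.sqrt (attNorm (x.1 * y.1ᵀ) ^ 2 + ‖x.2.1 - y.2.1‖ ^ 2 + ‖x.2.2.1 - y.2.2.1‖ ^ 2
    + ‖x.2.2.2 - y.2.2.2‖ ^ 2)

/-- The distance of (the error part of) a state to the target set. -/
def distTarget (TM : ℝ) (ξ : ExtState) : ℝ := sInf (errDist ξ.1 '' targetSet TM)

end HybridObserver

end

open HybridObserver

noncomputable section

namespace HybridObserver

/-! ### Calculus on compact intervals -/

section Calculus

variable {E F G : Type*} [NormedAddCommGroup E] [NormedSpace ℝ E] [NormedAddCommGroup F]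
  [NormedSpace ℝ F] [NormedAddCommGroup G] [NormedSpace ℝ G]

/-! The closed loop is a cascade. The pair (R̃, η) evolves without reference to x and P, while x is
the error of a Kalman filter driven by a gravity term of norm at most √8 ‖g‖ |R̃|_I. It therefore
suffices that the attitude part decays geometrically in the number of jumps, and that the filter
turns a geometrically decaying input into a geometrically decaying error. The timer keeps every
interval of flow no longer than T_M, so t ≤ (j + 1) T_M, and geometric decay in j is exponential
decay in t + j.

Attitude (`AttitudeBounds.exists_attitude_le`). If (s, q) is a unit quaternion of R̃, then |R̃|_I =
‖q‖, the potential U = tr(M(I - R̃)) is 4 qᵀM̄q, and ‖ψ(MR̃)‖² = 4(|M̄q|² - (qᵀM̄q)²) ≥ U(λ_min -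
U/4), with λ_min that of M̄. Since U' = -2 ψ(MR̃)·η, the correction η = k_R ψ(MR̃), held constant
between jumps, makes U decrease at least at the rate k_R ‖ψ‖² if the gain is small. On a sublevel
set U ≤ 4ε'²λ_min with ε' < 1 this contracts U by a fixed factor per full interval. The radius ε√ς_M
places the initial attitude in such a set, and η* keeps it there during the first interval, when η
is still arbitrary.

Filter (`KalmanRun.exists_error_le`). The Lyapunov function is xᵀP⁻¹x, treated without inverses as
the supremum over ζ of the dual energy 2ζ·x - ζ·Pζ. Jumps do not increase it, by the variational
formula P⁺(ζ) = min over l of P(ζ - Cᵀl) + Q(l). Up to the forcing, flow contracts it because V ≥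
v_m I, once P is bounded above. That bound is observability: two jumps at least T_m apart bound P
independently of its past (`RiccatiData.quad_two_jumps_le`). A lower bound of P is needed only at
time 0.

Completeness (`isCompleteDomain_of_isMaximalSolution`). The flow equations are solvable on every
compact interval, so a solution with bounded domain could flow until its timer expires and then jump
once more. -/

lemma absolutelyContinuousOnInterval_of_hasDerivWithinAt {f f' : ℝ → E} {a b : ℝ} (hab : a ≤ b)
    (hf : ∀ t ∈ Icc a b, HasDerivWithinAt f (f' t) (Icc a b) t)
    (hf' : ContinuousOn f' (Icc a b)) : AbsolutelyContinuousOnInterval f a b := by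
  obtain ⟨C, hC⟩ := isCompact_Icc.exists_bound_of_continuousOn hf'
  have hC0 : 0 ≤ C := (norm_nonneg _).trans (hC a (left_mem_Icc.2 hab))
  have : LipschitzOnWith ⟨C, hC0⟩ f (Icc a b) :=
    (convex_Icc a b).lipschitzOnWith_of_nnnorm_hasDerivWithin_le hf fun t ht => hC t ht
  rw [← uIcc_of_le hab] at this
  exact this.absolutelyContinuousOnInterval

/-- An absolutely continuous function whose derivative agrees almost everywhere with a continuous
function is continuously differentiable. -/
lemma hasDerivWithinAt_of_absolutelyContinuous [CompleteSpace E] {f f' : ℝ → E} {a b : ℝ}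
    (hab : a ≤ b)
    (hf : AbsolutelyContinuousOnInterval f a b) (hf' : ContinuousOn f' (Icc a b))
    (hd : ∀ᵐ t : ℝ, t ∈ Ioo a b → HasDerivAt f (f' t) t) :
    ∀ t ∈ Icc a b, HasDerivWithinAt f (f' t) (Icc a b) t := by
  set h : ℝ → E := IccExtend hab ((Icc a b).domRestrict f') with hh
  have hcont : Continuous h := (continuousOn_iff_continuous_domRestrict.1 hf').Icc_extend'
  have hval : ∀ t ∈ Icc a b, h t = f' t := fun t ht => by
    rw [hh, IccExtend_of_mem hab _ ht]; rfl
  set g : ℝ → E := fun t => ∫ s in a..t, h s with hg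
  have hgd : ∀ t, HasDerivAt g (h t) t := fun t =>
    intervalIntegral.integral_hasDerivAt_right (hcont.intervalIntegrable _ _)
      (hcont.stronglyMeasurableAtFilter _ _) hcont.continuousAt
  have hgac : AbsolutelyContinuousOnInterval g a b :=
    absolutelyContinuousOnInterval_of_hasDerivWithinAt hab
      (fun t _ => (hgd t).hasDerivWithinAt) hcont.continuousOn
  -- The difference from the primitive of f' has derivative zero almost everywhere; the endpoints,
  -- where nothing is assumed, form a null set. Absolute continuity makes the difference constant.
  obtain ⟨C, hC⟩ := (hf.sub hgac).const_of_ae_hasDerivAt_zero (by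
    have h1 : ∀ᵐ t : ℝ, t ≠ a := by simp [ae_iff, measure_singleton]
    have h2 : ∀ᵐ t : ℝ, t ≠ b := by simp [ae_iff, measure_singleton]
    filter_upwards [hd, h1, h2] with t ht hta htb htt
    rw [uIcc_of_le hab] at htt
    have := (ht ⟨lt_of_le_of_ne htt.1 (Ne.symm hta), lt_of_le_of_ne htt.2 htb⟩).sub (hgd t)
    rwa [hval t htt, sub_self] at this)
  rw [uIcc_of_le hab] at hC
  intro t ht
  have h1 : HasDerivWithinAt (fun s => g s + C) (f' t) (Icc a b) t := by
    rw [← hval t ht]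
    exact ((hgd t).add_const C).hasDerivWithinAt
  refine h1.congr (fun s hs => ?_) ?_
  · rw [← hC s hs]; simp
  · rw [← hC t ht]; simp

lemma sub_le_of_hasDerivWithinAt_le {f f' : ℝ → ℝ} {a b K : ℝ} (hab : a ≤ b)
    (hf : ∀ t ∈ Icc a b, HasDerivWithinAt f (f' t) (Icc a b) t)
    (hK : ∀ t ∈ Icc a b, f' t ≤ K) : f b - f a ≤ K * (b - a) := by
  have hint : ∀ t ∈ interior (Icc a b), HasDerivAt f (f' t) t := fun t ht =>
    (hf t (interior_subset ht)).hasDerivAt (mem_interior_iff_mem_nhds.1 ht)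
  exact (convex_Icc a b).image_sub_le_mul_sub_of_deriv_le
    (fun t ht => (hf t ht).continuousWithinAt)
    (fun t ht => (hint t ht).differentiableAt.differentiableWithinAt)
    (fun t ht => by rw [(hint t ht).deriv]; exact hK t (interior_subset ht))
    a (left_mem_Icc.2 hab) b (right_mem_Icc.2 hab) hab

lemma eq_of_hasDerivWithinAt_zero {f : ℝ → E} {a b : ℝ}
    (hf : ∀ t ∈ Icc a b, HasDerivWithinAt f 0 (Icc a b) t) :
    ∀ t ∈ Icc a b, f t = f a := by
  intro t ht
  have := (convex_Icc a b).norm_image_sub_le_of_norm_hasDerivWithin_le (C := 0) hf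
    (fun t _ => by simp) (left_mem_Icc.2 (ht.1.trans ht.2)) ht
  rw [zero_mul] at this
  exact sub_eq_zero.1 (norm_le_zero_iff.1 this)

lemma hasDerivWithinAt_bilinear [FiniteDimensional ℝ E] [FiniteDimensional ℝ F]
    (B : E →ₗ[ℝ] F →ₗ[ℝ] G) {u : ℝ → E} {v : ℝ → F} {u' : E} {v' : F} {s : Set ℝ} {t : ℝ}
    (hu : HasDerivWithinAt u u' s t) (hv : HasDerivWithinAt v v' s t) :
    HasDerivWithinAt (fun t => B (u t) (v t)) (B u' (v t) + B (u t) v') s t := by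
  have := B.toContinuousBilinearMap.hasDerivWithinAt_of_bilinear hu hv
  simpa [add_comm] using this

lemma hasDerivWithinAt_linear [FiniteDimensional ℝ E] (L : E →ₗ[ℝ] F) {u : ℝ → E} {u' : E}
    {s : Set ℝ} {t : ℝ} (hu : HasDerivWithinAt u u' s t) :
    HasDerivWithinAt (fun t => L (u t)) (L u') s t :=
  (LinearMap.toContinuousLinearMap L).hasFDerivAt.comp_hasDerivWithinAt t hu

lemma continuousOn_bilinear [FiniteDimensional ℝ E] [FiniteDimensional ℝ F]
    (B : E →ₗ[ℝ] F →ₗ[ℝ] G) {u : ℝ → E} {v : ℝ → F} {s : Set ℝ}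
    (hu : ContinuousOn u s) (hv : ContinuousOn v s) :
    ContinuousOn (fun t => B (u t) (v t)) s :=
  B.toContinuousBilinearMap.continuous₂.comp_continuousOn (hu.prodMk hv)

lemma continuousOn_linear [FiniteDimensional ℝ E] (L : E →ₗ[ℝ] F) {u : ℝ → E} {s : Set ℝ}
    (hu : ContinuousOn u s) : ContinuousOn (fun t => L (u t)) s :=
  (LinearMap.toContinuousLinearMap L).continuous.comp_continuousOn hu

end Calculus

/-! ### Product rules for matrices and vectors -/

section MatrixCalculus

variable {l m n : Type*} [Fintype l] [Fintype m] [Fintype n] {s : Set ℝ} {t : ℝ}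

lemma hasDerivWithinAt_matrix_mul {u : ℝ → Matrix l m ℝ} {v : ℝ → Matrix m n ℝ}
    {u' : Matrix l m ℝ} {v' : Matrix m n ℝ}
    (hu : HasDerivWithinAt u u' s t) (hv : HasDerivWithinAt v v' s t) :
    HasDerivWithinAt (fun t => u t * v t) (u' * v t + u t * v') s t :=
  hasDerivWithinAt_bilinear (LinearMap.mk₂ ℝ (fun (A : Matrix l m ℝ) (B : Matrix m n ℝ) => A * B)
    Matrix.add_mul Matrix.smul_mul Matrix.mul_add fun c A B => Matrix.mul_smul A c B) hu hv

lemma continuousOn_matrix_mul {u : ℝ → Matrix l m ℝ} {v : ℝ → Matrix m n ℝ}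
    (hu : ContinuousOn u s) (hv : ContinuousOn v s) : ContinuousOn (fun t => u t * v t) s :=
  continuousOn_bilinear (LinearMap.mk₂ ℝ (fun (A : Matrix l m ℝ) (B : Matrix m n ℝ) => A * B)
    Matrix.add_mul Matrix.smul_mul Matrix.mul_add fun c A B => Matrix.mul_smul A c B) hu hv

lemma hasDerivWithinAt_matrix_transpose {u : ℝ → Matrix l m ℝ} {u' : Matrix l m ℝ}
    (hu : HasDerivWithinAt u u' s t) : HasDerivWithinAt (fun t => (u t)ᵀ) u'ᵀ s t :=
  hasDerivWithinAt_linear (Matrix.transposeLinearEquiv l m ℝ ℝ).toLinearMap hu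

lemma continuousOn_matrix_transpose {u : ℝ → Matrix l m ℝ}
    (hu : ContinuousOn u s) : ContinuousOn (fun t => (u t)ᵀ) s :=
  continuousOn_linear (Matrix.transposeLinearEquiv l m ℝ ℝ).toLinearMap hu

lemma hasDerivWithinAt_mulVec {u : ℝ → Matrix l m ℝ} {v : ℝ → EuclideanSpace ℝ m}
    {u' : Matrix l m ℝ} {v' : EuclideanSpace ℝ m}
    (hu : HasDerivWithinAt u u' s t) (hv : HasDerivWithinAt v v' s t) :
    HasDerivWithinAt (fun t => (WithLp.toLp 2 (u t *ᵥ (v t).ofLp) : EuclideanSpace ℝ l))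
      (WithLp.toLp 2 (u' *ᵥ (v t).ofLp) + WithLp.toLp 2 (u t *ᵥ v'.ofLp)) s t :=
  hasDerivWithinAt_bilinear (LinearMap.mk₂ ℝ
    (fun (A : Matrix l m ℝ) (v : EuclideanSpace ℝ m) =>
      (WithLp.toLp 2 (A *ᵥ v.ofLp) : EuclideanSpace ℝ l))
    (fun A B v => by simp [Matrix.add_mulVec]) (fun c A v => by simp [Matrix.smul_mulVec])
    (fun A v w => by simp [Matrix.mulVec_add]) (fun c A v => by simp [Matrix.mulVec_smul])) hu hv

lemma continuousOn_mulVec {u : ℝ → Matrix l m ℝ} {v : ℝ → EuclideanSpace ℝ m}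
    (hu : ContinuousOn u s) (hv : ContinuousOn v s) :
    ContinuousOn (fun t => (WithLp.toLp 2 (u t *ᵥ (v t).ofLp) : EuclideanSpace ℝ l)) s :=
  continuousOn_bilinear (LinearMap.mk₂ ℝ
    (fun (A : Matrix l m ℝ) (v : EuclideanSpace ℝ m) =>
      (WithLp.toLp 2 (A *ᵥ v.ofLp) : EuclideanSpace ℝ l))
    (fun A B v => by simp [Matrix.add_mulVec]) (fun c A v => by simp [Matrix.smul_mulVec])
    (fun A v w => by simp [Matrix.mulVec_add]) (fun c A v => by simp [Matrix.mulVec_smul])) hu hv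

end MatrixCalculus

/-! ### Rotations and unit quaternions -/

/-- Any row with positive diagonal entry, suitably scaled, serves as v; the trace condition provides
such a pivot. -/
lemma exists_vec_of_rank_one (K : Fin 4 → Fin 4 → ℝ)
    (hK : ∀ p i j, K p i * K p j = K p p * K i j) (htr : ∑ p, K p p = 4) :
    ∃ v : Fin 4 → ℝ, ∀ i j, v i * v j = K i j / 4 := by
  obtain ⟨p, hp⟩ : ∃ p, 0 < K p p := by
    by_contra! h
    have := Finset.sum_nonpos fun p (_ : p ∈ Finset.univ) => h p
    linarith
  refine ⟨fun i => K p i / (2 * √(K p p)), fun i j => ?_⟩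
  have h1 : √(K p p) * √(K p p) = K p p := Real.mul_self_sqrt hp.le
  have h2 : √(K p p) ≠ 0 := (Real.sqrt_pos.2 hp).ne'
  calc K p i / (2 * √(K p p)) * (K p j / (2 * √(K p p)))
      = K p i * K p j / (4 * (√(K p p) * √(K p p))) := by field_simp; ring
    _ = K i j / 4 := by rw [h1, hK]; field_simp

/-- Four times the rank-one matrix of the products of the coordinates of a unit quaternion of
`R`. -/
def quaternionMatrix (R : Mat3) : Matrix (Fin 4) (Fin 4) ℝ :=
  !![1 + R 0 0 + R 1 1 + R 2 2, R 2 1 - R 1 2, R 0 2 - R 2 0, R 1 0 - R 0 1;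
    R 2 1 - R 1 2, 1 + R 0 0 - R 1 1 - R 2 2, R 0 1 + R 1 0, R 0 2 + R 2 0;
    R 0 2 - R 2 0, R 0 1 + R 1 0, 1 - R 0 0 + R 1 1 - R 2 2, R 1 2 + R 2 1;
    R 1 0 - R 0 1, R 0 2 + R 2 0, R 1 2 + R 2 1, 1 - R 0 0 - R 1 1 + R 2 2]

/-- Besides RRᵀ = RᵀR = 1, the cofactor identities adj R = Rᵀ are used; they are where det R = 1
enters. All required relations are polynomial consequences of these. -/
lemma quaternionMatrix_mul {R : Mat3} (hR : R ∈ SO3) (p i j : Fin 4) :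
    quaternionMatrix R p i * quaternionMatrix R p j
      = quaternionMatrix R p p * quaternionMatrix R i j := by
  obtain ⟨h1, h2, h3⟩ := hR
  have h4 : R.adjugate = Rᵀ := by
    have : Rᵀ * (R * R.adjugate) = Rᵀ := by rw [Matrix.mul_adjugate, h3]; simp
    rw [← this, ← Matrix.mul_assoc, h2, Matrix.one_mul]
  rw [Matrix.adjugate_fin_three] at h4
  have h1' := fun i j => congrFun (congrFun h1 i) j
  have h2' := fun i j => congrFun (congrFun h2 i) j
  have h4' := fun i j => congrFun (congrFun h4 i) j
  clear h1 h2 h4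
  simp [Fin.forall_fin_succ, Matrix.mul_apply, Fin.sum_univ_three] at h1' h2' h4'
  obtain ⟨⟨a1, a2, a3⟩, ⟨a4, a5, a6⟩, a7, a8, a9⟩ := h1'
  obtain ⟨⟨b1, b2, b3⟩, ⟨b4, b5, b6⟩, b7, b8, b9⟩ := h2'
  obtain ⟨⟨d1, d2, d3⟩, ⟨d4, d5, d6⟩, d7, d8, d9⟩ := h4'
  revert p i j
  unfold quaternionMatrix
  clear a4 a7 a8 b4 b7 b8 h3
  generalize R 0 0 = r00 at *
  generalize R 0 1 = r01 at *
  generalize R 0 2 = r02 at *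
  generalize R 1 0 = r10 at *
  generalize R 1 1 = r11 at *
  generalize R 1 2 = r12 at *
  generalize R 2 0 = r20 at *
  generalize R 2 1 = r21 at *
  generalize R 2 2 = r22 at *
  simp [Fin.forall_fin_succ]
  and_intros
  all_goals grind

/-- The rotation given by the unit quaternion `(s, q)`. -/
def quaternionRotation (s : ℝ) (q : E3) : Mat3 :=
  !![1 - 2 * (q 1 ^ 2 + q 2 ^ 2), 2 * (q 0 * q 1 - s * q 2), 2 * (q 0 * q 2 + s * q 1);
    2 * (q 0 * q 1 + s * q 2), 1 - 2 * (q 0 ^ 2 + q 2 ^ 2), 2 * (q 1 * q 2 - s * q 0);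
    2 * (q 0 * q 2 - s * q 1), 2 * (q 1 * q 2 + s * q 0), 1 - 2 * (q 0 ^ 2 + q 1 ^ 2)]

lemma exists_quaternion {R : Mat3} (hR : R ∈ SO3) :
    ∃ (s : ℝ) (q : E3), s ^ 2 + q 0 ^ 2 + q 1 ^ 2 + q 2 ^ 2 = 1 ∧ R = quaternionRotation s q := by
  obtain ⟨v, hv⟩ := exists_vec_of_rank_one (quaternionMatrix R) (quaternionMatrix_mul hR) (by
    simp [quaternionMatrix, Fin.sum_univ_four]; ring)
  simp [quaternionMatrix, Fin.forall_fin_succ] at hv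
  obtain ⟨⟨a1, a2, a3, a4⟩, ⟨b1, b2, b3, b4⟩, ⟨c1, c2, c3, c4⟩, d1, d2, d3, d4⟩ := hv
  refine ⟨v 0, !₂[v 1, v 2, v 3], ?_, ?_⟩
  · simp
    linear_combination a1 + b2 + c3 + d4
  · ext i j
    fin_cases i <;> fin_cases j <;> simp [quaternionRotation] <;> linarith

lemma attNorm_quaternionRotation (s : ℝ) (q : E3) : attNorm (quaternionRotation s q) = ‖q‖ := by
  rw [attNorm, EuclideanSpace.norm_eq]
  congr 1
  simp [quaternionRotation, Matrix.trace, Fin.sum_univ_three]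
  ring

/-- The potential `tr (M (I - R))`. -/
def potential (M R : Mat3) : ℝ := (M * (1 - R)).trace

lemma potential_quaternionRotation {M : Mat3} (hM : Mᵀ = M) (s : ℝ) (q : E3) :
    potential M (quaternionRotation s q) = 4 * (q.ofLp ⬝ᵥ (barMatrix M *ᵥ q.ofLp)) := by
  have h := fun i j => congrFun (congrFun hM i) j
  simp only [Matrix.transpose_apply] at h
  have h1 := h 0 1
  have h2 := h 0 2
  have h3 := h 1 2
  simp [potential, barMatrix, quaternionRotation, Matrix.trace, Fin.sum_univ_three, Matrix.mul_apply,
    Matrix.mulVec, dotProduct, Matrix.one_apply, h1, h2, h3]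
  ring

lemma psi_mul_quaternionRotation {M : Mat3} (hM : Mᵀ = M) (s : ℝ) (q : E3) :
    let u := barMatrix M *ᵥ q.ofLp
    psi (M * quaternionRotation s q) =
      !₂[2 * (s * u 0 - (q 1 * u 2 - q 2 * u 1)), 2 * (s * u 1 - (q 2 * u 0 - q 0 * u 2)),
        2 * (s * u 2 - (q 0 * u 1 - q 1 * u 0))] := by
  have h := fun i j => congrFun (congrFun hM i) j
  simp only [Matrix.transpose_apply] at h
  have h1 := h 0 1
  have h2 := h 0 2
  have h3 := h 1 2
  ext i
  fin_cases i <;>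
  simp [psi, barMatrix, quaternionRotation, Matrix.trace, Fin.sum_univ_three, Matrix.mul_apply,
    Matrix.mulVec, dotProduct, Matrix.one_apply, h1, h2, h3] <;> ring

/-- With u = M̄q one has ψ = 2(su - q × u). The two terms are orthogonal, and Lagrange's identity
for |q × u|² together with s² + |q|² = 1 gives the formula. -/
lemma norm_psi_quaternionRotation {M : Mat3} (hM : Mᵀ = M) {s : ℝ} {q : E3}
    (hs : s ^ 2 + q 0 ^ 2 + q 1 ^ 2 + q 2 ^ 2 = 1) :
    ‖psi (M * quaternionRotation s q)‖ ^ 2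
      = 4 * ((barMatrix M *ᵥ q.ofLp) ⬝ᵥ (barMatrix M *ᵥ q.ofLp)
        - (q.ofLp ⬝ᵥ (barMatrix M *ᵥ q.ofLp)) ^ 2) := by
  rw [psi_mul_quaternionRotation hM, EuclideanSpace.real_norm_sq_eq]
  generalize barMatrix M *ᵥ q.ofLp = u
  simp [dotProduct, Fin.sum_univ_three]
  linear_combination 4 * (u 0 ^ 2 + u 1 ^ 2 + u 2 ^ 2) * hs

/-! ### Frobenius norms of rotations; the maps `skew` and `psi` -/

lemma frobenius_norm_sq {m n : Type*} [Fintype m] [Fintype n] (A : Matrix m n ℝ) :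
    ‖A‖ ^ 2 = ∑ i, ∑ j, A i j ^ 2 := by
  rw [Matrix.frobenius_norm_def, ← Real.sqrt_eq_rpow, Real.sq_sqrt (by positivity)]
  simp

lemma frobenius_norm_sq_eq_trace {m n : Type*} [Fintype m] [Fintype n] (A : Matrix m n ℝ) :
    ‖A‖ ^ 2 = (Aᵀ * A).trace := by
  rw [frobenius_norm_sq, Finset.sum_comm]
  simp [Matrix.trace, Matrix.mul_apply, sq]

lemma attNorm_eq {R : Mat3} (hR : R ∈ SO3) : attNorm R = √(‖1 - R‖ ^ 2 / 8) := by
  rw [attNorm, frobenius_norm_sq_eq_trace]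
  congr 1
  have : (1 - R)ᵀ * (1 - R) = 1 - R - Rᵀ + Rᵀ * R := by
    simp [Matrix.sub_mul, Matrix.mul_sub]; abel
  rw [this, hR.2.1]
  simp [Matrix.trace_sub, Matrix.trace_add]
  ring

lemma norm_one_sub_sq {R : Mat3} (hR : R ∈ SO3) : ‖1 - R‖ ^ 2 = 8 * attNorm R ^ 2 := by
  rw [attNorm_eq hR, Real.sq_sqrt (by positivity)]; ring

lemma isClosed_SO3 : IsClosed SO3 := by
  have h1 : Continuous fun R : Mat3 => R * Rᵀ := by fun_prop
  have h2 : Continuous fun R : Mat3 => Rᵀ * R := by fun_prop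
  have h3 : Continuous fun R : Mat3 => R.det := by fun_prop
  exact (isClosed_singleton.preimage h1).inter
    ((isClosed_singleton.preimage h2).inter (isClosed_singleton.preimage h3))

lemma norm_mul_of_mem_SO3 {R : Mat3} (hR : R ∈ SO3) (A : Mat3) : ‖R * A‖ = ‖A‖ := by
  rw [← sq_eq_sq₀ (norm_nonneg _) (norm_nonneg _), frobenius_norm_sq_eq_trace,
    frobenius_norm_sq_eq_trace, Matrix.transpose_mul, Matrix.mul_assoc, ← Matrix.mul_assoc Rᵀ,
    hR.2.1, Matrix.one_mul]

lemma norm_skew_sq (x : E3) : ‖skew x‖ ^ 2 = 2 * ‖x‖ ^ 2 := by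
  rw [frobenius_norm_sq, EuclideanSpace.real_norm_sq_eq]
  simp [skew, Fin.sum_univ_three]
  ring

lemma norm_skew_le (x : E3) : ‖skew x‖ ≤ 2 * ‖x‖ := by
  refine abs_le_of_sq_le_sq' ?_ (by positivity) |>.2
  rw [norm_skew_sq]; nlinarith [sq_nonneg ‖x‖]

/-- Only the skew-symmetric part of A pairs with x^×, which is how ψ arises as the gradient of the
potential. -/
lemma trace_mul_skew (A : Mat3) (x : E3) :
    (A * skew x).trace = -2 * (psi A).ofLp ⬝ᵥ x.ofLp := by
  simp [skew, psi, Matrix.trace, Matrix.mul_apply, dotProduct, Fin.sum_univ_three]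
  ring

lemma norm_psi_le (A : Mat3) : ‖psi A‖ ≤ ‖A‖ := by
  refine abs_le_of_sq_le_sq' ?_ (by positivity) |>.2
  rw [frobenius_norm_sq, EuclideanSpace.real_norm_sq_eq]
  simp [psi, Fin.sum_univ_three]
  nlinarith [sq_nonneg (A 0 1 + A 1 0), sq_nonneg (A 0 2 + A 2 0), sq_nonneg (A 1 2 + A 2 1),
    sq_nonneg (A 0 0), sq_nonneg (A 1 1), sq_nonneg (A 2 2), sq_nonneg (A 0 1), sq_nonneg (A 1 0),
    sq_nonneg (A 0 2), sq_nonneg (A 2 0), sq_nonneg (A 1 2), sq_nonneg (A 2 1)]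

lemma psi_sub (A B : Mat3) : psi (A - B) = psi A - psi B := by
  ext i
  fin_cases i <;> simp [psi] <;> ring

lemma skew_neg (x : E3) : skew (-x) = -skew x := by
  ext i j
  fin_cases i <;> fin_cases j <;> simp [skew]

lemma skew_transpose (x : E3) : (skew x)ᵀ = -skew x := by
  ext i j
  fin_cases i <;> fin_cases j <;> simp [skew]

/-! ### Quadratic forms of symmetric matrices -/

section Spectral

variable {n : Type*} [Fintype n] [DecidableEq n] {B : Matrix n n ℝ}

lemma dotProduct_self_nonneg_real {n : Type*} [Fintype n] (v : n → ℝ) : 0 ≤ v ⬝ᵥ v :=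
  Finset.sum_nonneg fun i _ => mul_self_nonneg (v i)

lemma norm_sq_eq_dotProduct {n : Type*} [Fintype n] (v : EuclideanSpace ℝ n) :
    ‖v‖ ^ 2 = v.ofLp ⬝ᵥ v.ofLp := by
  rw [EuclideanSpace.real_norm_sq_eq]; simp [dotProduct, sq]

lemma spectrum_finite (hB : B.IsHermitian) : (spectrum ℝ B).Finite := by
  rw [hB.spectrum_real_eq_range_eigenvalues]; exact Set.finite_range _

lemma spectrum_nonempty [Nonempty n] (hB : B.IsHermitian) : (spectrum ℝ B).Nonempty := by
  rw [hB.spectrum_real_eq_range_eigenvalues]; exact Set.range_nonempty _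

/-- B - aI is Hermitian and its spectrum is that of B translated by -a, hence nonnegative. -/
lemma sInf_spectrum_mul_le (hB : B.IsHermitian) (v : n → ℝ) :
    sInf (spectrum ℝ B) * (v ⬝ᵥ v) ≤ v ⬝ᵥ (B *ᵥ v) := by
  set a := sInf (spectrum ℝ B) with ha
  have hH : (B - algebraMap ℝ _ a).IsHermitian := by
    rw [Matrix.algebraMap_eq_diagonal]
    exact hB.sub (Matrix.isHermitian_diagonal _)
  have hP : (B - algebraMap ℝ _ a).PosSemidef := by
    rw [hH.posSemidef_iff_eigenvalues_nonneg]
    intro i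
    have h1 := hH.eigenvalues_mem_spectrum_real i
    rw [← spectrum.sub_singleton_eq] at h1
    obtain ⟨x, hx, y, rfl, hxy⟩ := h1
    have := csInf_le (spectrum_finite hB).bddBelow hx
    simp only [Pi.zero_apply]
    linarith
  have := hP.dotProduct_mulVec_nonneg v
  simp [Matrix.sub_mulVec, Algebra.algebraMap_eq_smul_one, Matrix.smul_mulVec] at this
  linarith

lemma le_sSup_spectrum_mul (hB : B.IsHermitian) (v : n → ℝ) :
    v ⬝ᵥ (B *ᵥ v) ≤ sSup (spectrum ℝ B) * (v ⬝ᵥ v) := by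
  set a := sSup (spectrum ℝ B) with ha
  have hH : (algebraMap ℝ _ a - B).IsHermitian := by
    rw [Matrix.algebraMap_eq_diagonal]
    exact (Matrix.isHermitian_diagonal _).sub hB
  have hP : (algebraMap ℝ _ a - B).PosSemidef := by
    rw [hH.posSemidef_iff_eigenvalues_nonneg]
    intro i
    have h1 := hH.eigenvalues_mem_spectrum_real i
    rw [← spectrum.singleton_sub_eq] at h1
    obtain ⟨x, rfl, y, hy, hxy⟩ := h1
    have := le_csSup (spectrum_finite hB).bddAbove hy
    simp only [Pi.zero_apply]
    linarith
  have := hP.dotProduct_mulVec_nonneg v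
  simp [Matrix.sub_mulVec, Algebra.algebraMap_eq_smul_one, Matrix.smul_mulVec] at this
  linarith

lemma sInf_spectrum_pos [Nonempty n] (hB : B.PosDef) : 0 < sInf (spectrum ℝ B) := by
  have h := (spectrum_nonempty hB.1).csInf_mem (spectrum_finite hB.1)
  rw [hB.1.spectrum_real_eq_range_eigenvalues] at h ⊢
  obtain ⟨i, hi⟩ := h
  rw [← hi]
  exact hB.eigenvalues_pos i

lemma sInf_spectrum_le_sSup [Nonempty n] (hB : B.IsHermitian) : sInf (spectrum ℝ B) ≤ sSup (spectrum ℝ B) :=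
  csInf_le_csSup (spectrum_nonempty hB) (spectrum_finite hB).bddBelow (spectrum_finite hB).bddAbove

lemma dotProduct_sq_le {n : Type*} [Fintype n] (v w : n → ℝ) :
    (v ⬝ᵥ w) ^ 2 ≤ (v ⬝ᵥ v) * (w ⬝ᵥ w) := by
  have := Finset.sum_mul_sq_le_sq_mul_sq Finset.univ v w
  simpa [dotProduct, sq] using this

/-- If `B ≥ a I` with `a ≥ 0`, then `B² ≥ a B`. -/
lemma mul_dotProduct_mulVec_le {n : Type*} [Fintype n] {B : Matrix n n ℝ} {a : ℝ} (ha : 0 ≤ a)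
    {v : n → ℝ} (h : a * (v ⬝ᵥ v) ≤ v ⬝ᵥ (B *ᵥ v)) :
    a * (v ⬝ᵥ (B *ᵥ v)) ≤ (B *ᵥ v) ⬝ᵥ (B *ᵥ v) := by
  have h1 := dotProduct_sq_le v (B *ᵥ v)
  have h2 := dotProduct_self_nonneg_real v
  have h3 := dotProduct_self_nonneg_real (B *ᵥ v)
  set x := v ⬝ᵥ v
  set y := v ⬝ᵥ (B *ᵥ v)
  set z := (B *ᵥ v) ⬝ᵥ (B *ᵥ v)
  rcases (mul_nonneg ha h2).trans h |>.eq_or_lt with h0 | h0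
  · rw [← h0]; simpa using h3
  -- Cauchy–Schwarz gives y² ≤ xz, and ax ≤ y by hypothesis; the positive factor y is then
  -- cancelled.
  · have hx : a * y * y ≤ z * y := by
      calc a * y * y = a * y ^ 2 := by ring
        _ ≤ a * (x * z) := by gcongr
        _ = (a * x) * z := by ring
        _ ≤ y * z := by gcongr
        _ = z * y := by ring
    exact le_of_mul_le_mul_right hx h0

end Spectral

/-! ### The landmark matrix -/

section Landmark

variable {N : ℕ} (p : Fin N → E3) (k : Fin N → ℝ)

lemma landmarkMatrix_transpose : (landmarkMatrix p k)ᵀ = landmarkMatrix p k := by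
  simp [landmarkMatrix, Matrix.transpose_sum, Matrix.transpose_vecMulVec]

lemma barMatrix_isHermitian {M : Mat3} (hM : Mᵀ = M) : (barMatrix M).IsHermitian := by
  rw [Matrix.IsHermitian, Matrix.conjTranspose_eq_transpose_of_trivial]
  simp [barMatrix, Matrix.transpose_sub, Matrix.transpose_smul, hM]

lemma dotProduct_barMatrix_landmarkMatrix (v : Fin 3 → ℝ) :
    v ⬝ᵥ (barMatrix (landmarkMatrix p k) *ᵥ v) =
      ∑ i, k i / 2 * (‖p i - landmarkCenter p k‖ ^ 2 * (v ⬝ᵥ v)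
        - ((p i - landmarkCenter p k).ofLp ⬝ᵥ v) ^ 2) := by
  simp only [barMatrix, landmarkMatrix, Matrix.trace_sum, Matrix.smul_mulVec, Matrix.sub_mulVec,
    dotProduct_smul, dotProduct_sub, Matrix.sum_mulVec, Matrix.one_mulVec, Matrix.trace_smul,
    Matrix.trace_vecMulVec, dotProduct_sum, norm_sq_eq_dotProduct, smul_eq_mul,
    Matrix.vecMulVec_mulVec, Finset.sum_mul, ← Finset.sum_sub_distrib, Finset.mul_sum]
  refine Finset.sum_congr rfl fun i _ => ?_
  simp only [op_smul_eq_smul, smul_eq_mul]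
  rw [dotProduct_comm v (p i - landmarkCenter p k).ofLp]
  ring

/-- Each summand of the quadratic form is a Cauchy–Schwarz defect. If the form vanishes at v ≠ 0,
every p_i - p_c is a multiple of v, so all landmarks lie on the line through p_c directed by v. -/
lemma barMatrix_landmarkMatrix_posDef (hk : ∀ i, 0 < k i)
    (hp : ∃ i₁ i₂ i₃, ¬ Collinear ℝ {p i₁, p i₂, p i₃}) :
    (barMatrix (landmarkMatrix p k)).PosDef := by
  refine Matrix.PosDef.of_dotProduct_mulVec_pos
    (barMatrix_isHermitian (landmarkMatrix_transpose p k)) fun v hv => ?_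
  rw [star_trivial, dotProduct_barMatrix_landmarkMatrix]
  have hterm : ∀ i, 0 ≤ k i / 2 * (‖p i - landmarkCenter p k‖ ^ 2 * (v ⬝ᵥ v)
        - ((p i - landmarkCenter p k).ofLp ⬝ᵥ v) ^ 2) := fun i => by
    have := dotProduct_sq_le (p i - landmarkCenter p k).ofLp v
    rw [norm_sq_eq_dotProduct]
    have := (hk i).le
    apply mul_nonneg <;> linarith
  refine lt_of_le_of_ne (Finset.sum_nonneg fun i _ => hterm i) fun h0 => ?_
  have h1 := (Finset.sum_eq_zero_iff_of_nonneg fun i _ => hterm i).1 h0.symm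
  have hvv : 0 < v ⬝ᵥ v := lt_of_le_of_ne (dotProduct_self_nonneg_real v) fun h => hv (by
    simpa using h.symm)
  have h2 : ∀ i, ∃ r : ℝ, p i = r • (WithLp.toLp 2 v : E3) +ᵥ landmarkCenter p k := fun i => by
    set d := p i - landmarkCenter p k with hd
    have h3 := h1 i (Finset.mem_univ i)
    rw [norm_sq_eq_dotProduct] at h3
    have h4 : d.ofLp ⬝ᵥ d.ofLp * (v ⬝ᵥ v) - (d.ofLp ⬝ᵥ v) ^ 2 = 0 := by
      have := (hk i).ne'
      rcases mul_eq_zero.1 h3 with h | h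
      · exact absurd h (by positivity)
      · exact h
    refine ⟨(d.ofLp ⬝ᵥ v) / (v ⬝ᵥ v), ?_⟩
    have h5 : d - ((d.ofLp ⬝ᵥ v) / (v ⬝ᵥ v)) • (WithLp.toLp 2 v : E3) = 0 := by
      rw [← norm_eq_zero, ← sq_eq_zero_iff, norm_sq_eq_dotProduct]
      simp only [WithLp.ofLp_sub, WithLp.ofLp_smul, dotProduct_sub, sub_dotProduct, dotProduct_smul,
        smul_dotProduct, smul_eq_mul]
      rw [dotProduct_comm v d.ofLp]
      field_simp
      linarith
    rw [vadd_eq_add, ← sub_eq_iff_eq_add, ← hd]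
    exact sub_eq_zero.1 h5
  obtain ⟨i₁, i₂, i₃, hc⟩ := hp
  refine hc ((collinear_iff_exists_forall_eq_smul_vadd _).2
    ⟨landmarkCenter p k, WithLp.toLp 2 v, ?_⟩)
  rintro x (rfl | rfl | rfl)
  exacts [h2 _, h2 _, h2 _]

end Landmark

/-- Bounds for the attitude potential in terms of bounds `a, b` for the spectrum of `M̄`. -/
structure AttitudeBounds (M : Mat3) (a b : ℝ) : Prop where
  symm : Mᵀ = M
  pos : 0 < a
  le : a ≤ b
  lower : ∀ v, a * (v ⬝ᵥ v) ≤ v ⬝ᵥ (barMatrix M *ᵥ v)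
  upper : ∀ v, v ⬝ᵥ (barMatrix M *ᵥ v) ≤ b * (v ⬝ᵥ v)

lemma exists_attitudeBounds {N : ℕ} (p : Fin N → E3) (k : Fin N → ℝ) (hk : ∀ i, 0 < k i)
    (hp : ∃ i₁ i₂ i₃, ¬ Collinear ℝ {p i₁, p i₂, p i₃}) :
    ∃ a b, AttitudeBounds (landmarkMatrix p k) a b ∧ eigRatio (landmarkMatrix p k) = a / b := by
  have h := barMatrix_landmarkMatrix_posDef p k hk hp
  exact ⟨_, _, ⟨landmarkMatrix_transpose p k, sInf_spectrum_pos h, sInf_spectrum_le_sSup h.1,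
    sInf_spectrum_mul_le h.1, le_sSup_spectrum_mul h.1⟩, rfl⟩

namespace AttitudeBounds

variable {M R : Mat3} {a b : ℝ}

lemma mul_attNorm_le (h : AttitudeBounds M a b) (hR : R ∈ SO3) : 4 * a * attNorm R ^ 2 ≤ potential M R := by
  obtain ⟨s, q, hs, rfl⟩ := exists_quaternion hR
  rw [attNorm_quaternionRotation, potential_quaternionRotation h.symm, norm_sq_eq_dotProduct]
  linarith [h.lower q.ofLp]

lemma potential_le (h : AttitudeBounds M a b) (hR : R ∈ SO3) : potential M R ≤ 4 * b * attNorm R ^ 2 := by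
  obtain ⟨s, q, hs, rfl⟩ := exists_quaternion hR
  rw [attNorm_quaternionRotation, potential_quaternionRotation h.symm, norm_sq_eq_dotProduct]
  linarith [h.upper q.ofLp]

/-- The gradient inequality for the attitude potential. -/
lemma mul_potential_le (h : AttitudeBounds M a b) (hR : R ∈ SO3) :
    potential M R * (a - potential M R / 4) ≤ ‖psi (M * R)‖ ^ 2 := by
  obtain ⟨s, q, hs, rfl⟩ := exists_quaternion hR
  rw [norm_psi_quaternionRotation h.symm hs, potential_quaternionRotation h.symm]
  nlinarith [mul_dotProduct_mulVec_le h.pos.le (h.lower q.ofLp)]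

end AttitudeBounds

/-! ### Quadratic forms along the Riccati flow -/

/-- The value at `w` of the quadratic form of `S`. -/
def quad {n : Type*} [Fintype n] (S : Matrix n n ℝ) (w : n → ℝ) : ℝ := w ⬝ᵥ (S *ᵥ w)

section Quad

variable {m n : Type*} [Fintype m] [Fintype n]

lemma dotProduct_mulVec_eq (A : Matrix m n ℝ) (v : m → ℝ) (w : n → ℝ) :
    v ⬝ᵥ (A *ᵥ w) = (Aᵀ *ᵥ v) ⬝ᵥ w := by
  rw [Matrix.dotProduct_mulVec, Matrix.mulVec_transpose]

lemma quad_conj (A : Matrix m n ℝ) (S : Matrix n n ℝ) (w : m → ℝ) :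
    quad (A * S * Aᵀ) w = quad S (Aᵀ *ᵥ w) := by
  rw [quad, quad, ← Matrix.mulVec_mulVec, ← Matrix.mulVec_mulVec, dotProduct_mulVec_eq]

lemma quad_smul_vec (S : Matrix n n ℝ) (c : ℝ) (w : n → ℝ) : quad S (c • w) = c ^ 2 * quad S w := by
  simp [quad, Matrix.mulVec_smul]; ring

lemma mulVec_dotProduct_le (A : Matrix m n ℝ) (v : n → ℝ) :
    (A *ᵥ v) ⬝ᵥ (A *ᵥ v) ≤ ‖A‖ ^ 2 * (v ⬝ᵥ v) := by
  rw [frobenius_norm_sq, Finset.sum_mul]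
  refine Finset.sum_le_sum fun i _ => ?_
  have := dotProduct_sq_le (A i) v
  rw [← sq]
  refine this.trans (le_of_eq ?_)
  simp [dotProduct, sq]

lemma quad_le_norm (S : Matrix n n ℝ) (w : n → ℝ) : quad S w ≤ ‖S‖ * (w ⬝ᵥ w) := by
  have h1 := dotProduct_sq_le w (S *ᵥ w)
  have h2 := mulVec_dotProduct_le S w
  have h3 := dotProduct_self_nonneg_real w
  refine abs_le_of_sq_le_sq' (a := quad S w) ?_ (by positivity) |>.2
  calc quad S w ^ 2 ≤ (w ⬝ᵥ w) * ((S *ᵥ w) ⬝ᵥ (S *ᵥ w)) := h1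
    _ ≤ (w ⬝ᵥ w) * (‖S‖ ^ 2 * (w ⬝ᵥ w)) := by gcongr
    _ = (‖S‖ * (w ⬝ᵥ w)) ^ 2 := by ring

lemma quad_nonneg {S : Matrix n n ℝ} (hS : S.PosSemidef) (w : n → ℝ) : 0 ≤ quad S w := by
  simpa [quad] using hS.dotProduct_mulVec_nonneg w

lemma hasDerivWithinAt_quad {S : ℝ → Matrix n n ℝ} {S' : Matrix n n ℝ} {s : Set ℝ} {t : ℝ}
    (hS : HasDerivWithinAt S S' s t) (w : n → ℝ) :
    HasDerivWithinAt (fun t => quad (S t) w) (quad S' w) s t :=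
  hasDerivWithinAt_linear
    ({ toFun := fun S => quad S w
       map_add' := fun A B => by simp [quad, Matrix.add_mulVec]
       map_smul' := fun c A => by simp [quad, Matrix.smul_mulVec] } : Matrix n n ℝ →ₗ[ℝ] ℝ) hS

lemma hasDerivWithinAt_dotProduct {x : ℝ → EuclideanSpace ℝ n} {x' : EuclideanSpace ℝ n}
    {s : Set ℝ} {t : ℝ} (hx : HasDerivWithinAt x x' s t) (w : n → ℝ) :
    HasDerivWithinAt (fun t => w ⬝ᵥ (x t).ofLp) (w ⬝ᵥ x'.ofLp) s t :=
  hasDerivWithinAt_linear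
    ({ toFun := fun x => w ⬝ᵥ x.ofLp
       map_add' := fun A B => by simp
       map_smul' := fun c A => by simp } : EuclideanSpace ℝ n →ₗ[ℝ] ℝ) hx

end Quad

/-- The nilpotent part of `A_t`. -/
def nilMat : Mat6 := Matrix.fromBlocks 0 1 0 0

/-- The block diagonal matrix with two blocks `R`. -/
def blockRot (R : Mat3) : Mat6 := Matrix.fromBlocks R 0 0 R

/-- `1 + h N`, the transition matrix of the double integrator. -/
def shear (h : ℝ) : Mat6 := 1 + h • nilMat

/-- The transition matrix `Ψ_c(t)` of the flow from time `t` to time `c`, in the coordinates of the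
inertial frame at time `c`. -/
def transition (R : ℝ → Mat3) (c t : ℝ) : Mat6 := shear (c - t) * blockRot (R t)

lemma nilMat_mul_nilMat : nilMat * nilMat = 0 := by
  simp [nilMat, Matrix.fromBlocks_multiply]

lemma nilMat_mul_blockRot (R : Mat3) : nilMat * blockRot R = blockRot R * nilMat := by
  simp [nilMat, blockRot, Matrix.fromBlocks_multiply]

lemma shear_mul_shear_neg (h : ℝ) : shear h * shear (-h) = 1 := by
  simp [shear, Matrix.add_mul, Matrix.mul_add, nilMat_mul_nilMat]

lemma shear_zero : shear 0 = 1 := by simp [shear]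

lemma blockRot_mul_transpose {R : Mat3} (hR : R ∈ SO3) : blockRot R * (blockRot R)ᵀ = 1 := by
  simp [blockRot, Matrix.fromBlocks_transpose, Matrix.fromBlocks_multiply, hR.1]

lemma blockRot_transpose_mul {R : Mat3} (hR : R ∈ SO3) : (blockRot R)ᵀ * blockRot R = 1 := by
  simp [blockRot, Matrix.fromBlocks_transpose, Matrix.fromBlocks_multiply, hR.2.1]

lemma transition_self (R : ℝ → Mat3) (c : ℝ) : transition R c c = blockRot (R c) := by
  simp [transition, shear_zero]

lemma matA_eq (w : E3) : matA w = nilMat - blockRot (skew w) := by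
  simp [matA, nilMat, blockRot, sub_eq_add_neg, Matrix.fromBlocks_neg, Matrix.fromBlocks_add]

/-- As A = N - diag(ω^×, ω^×), the rotation by R cancels the ω^× blocks and leaves a double
integrator, whose transition matrix is the shear. -/
lemma hasDerivWithinAt_transition {R : ℝ → Mat3} {w : E3} {c t : ℝ} {s : Set ℝ}
    (hR : HasDerivWithinAt R (R t * skew w) s t) :
    HasDerivWithinAt (transition R c) (-(transition R c t * matA w)) s t := by
  have h1 : HasDerivWithinAt (fun t => blockRot (R t)) (blockRot (R t * skew w)) s t :=
    hasDerivWithinAt_linear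
      ({ toFun := blockRot
         map_add' := fun A B => by simp [blockRot, Matrix.fromBlocks_add]
         map_smul' := fun c A => by simp [blockRot, Matrix.fromBlocks_smul] } : Mat3 →ₗ[ℝ] Mat6) hR
  have h2 : HasDerivWithinAt (fun t => shear (c - t)) ((-1 : ℝ) • nilMat) s t :=
    (((hasDerivWithinAt_id t s).const_sub c).smul_const nilMat).const_add 1
  refine (hasDerivWithinAt_matrix_mul h2 h1).congr_deriv ?_
  have h3 : blockRot (R t * skew w) = blockRot (R t) * blockRot (skew w) := by
    simp [blockRot, Matrix.fromBlocks_multiply]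
  have h4 : shear (c - t) * nilMat = nilMat := by
    simp [shear, Matrix.add_mul, nilMat_mul_nilMat]
  rw [matA_eq, h3, transition, Matrix.mul_sub, Matrix.mul_assoc (shear (c - t)),
    ← nilMat_mul_blockRot, ← Matrix.mul_assoc (shear (c - t)) nilMat, h4]
  simp [Matrix.mul_assoc]
  abel

/-! ### Conjugation of the flow by its transition matrix -/

section Conj

variable {n : Type*} [Fintype n] {s : Set ℝ} {t : ℝ} {Ψ P : ℝ → Matrix n n ℝ}
  {A V : Matrix n n ℝ}

/-- The terms AP + PAᵀ cancel: in transported coordinates P only accumulates V. -/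
lemma hasDerivWithinAt_conj (hΨ : HasDerivWithinAt Ψ (-(Ψ t * A)) s t)
    (hP : HasDerivWithinAt P (A * P t + P t * Aᵀ + V) s t) :
    HasDerivWithinAt (fun t => Ψ t * P t * (Ψ t)ᵀ) (Ψ t * V * (Ψ t)ᵀ) s t := by
  refine (hasDerivWithinAt_matrix_mul (hasDerivWithinAt_matrix_mul hΨ hP)
    (hasDerivWithinAt_matrix_transpose hΨ)).congr_deriv ?_
  simp only [Matrix.transpose_neg, Matrix.transpose_mul]
  noncomm_ring

lemma hasDerivWithinAt_mulVec_flow {x : ℝ → EuclideanSpace ℝ n} {d : EuclideanSpace ℝ n}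
    (hΨ : HasDerivWithinAt Ψ (-(Ψ t * A)) s t)
    (hx : HasDerivWithinAt x (WithLp.toLp 2 (A *ᵥ (x t).ofLp) + d) s t) :
    HasDerivWithinAt (fun t => (WithLp.toLp 2 (Ψ t *ᵥ (x t).ofLp) : EuclideanSpace ℝ n))
      (WithLp.toLp 2 (Ψ t *ᵥ d.ofLp)) s t := by
  refine (hasDerivWithinAt_mulVec hΨ hx).congr_deriv ?_
  rw [← WithLp.toLp_add]
  congr 1
  simp [Matrix.mulVec_add, Matrix.neg_mulVec, Matrix.mulVec_mulVec]

end Conj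

lemma shear_transpose_mulVec (h : ℝ) (w : Fin 3 ⊕ Fin 3 → ℝ) :
    (shear h)ᵀ *ᵥ w =
      Sum.elim (fun i => w (Sum.inl i)) (fun i => w (Sum.inr i) + h * w (Sum.inl i)) := by
  ext (i | i) <;>
  simp [shear, nilMat, Matrix.transpose_add, Matrix.add_mulVec, Matrix.fromBlocks_transpose,
    Matrix.smul_mulVec, Matrix.fromBlocks_mulVec]
  
/-- The constant comes from (v + hu)² ≤ 2v² + 2h²u²; it becomes the growth factor 2 + 2 T_M² of all
later bounds. -/
lemma shear_transpose_dotProduct_le (h : ℝ) (w : Fin 3 ⊕ Fin 3 → ℝ) :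
    ((shear h)ᵀ *ᵥ w) ⬝ᵥ ((shear h)ᵀ *ᵥ w) ≤ (2 + 2 * h ^ 2) * (w ⬝ᵥ w) := by
  rw [shear_transpose_mulVec]
  simp only [dotProduct, Fintype.sum_sum_type, Sum.elim_inl, Sum.elim_inr,
    ← Finset.sum_add_distrib, Finset.mul_sum]
  refine Finset.sum_le_sum fun i _ => ?_
  nlinarith [sq_nonneg (w (Sum.inr i) - h * w (Sum.inl i)), sq_nonneg (w (Sum.inl i)),
    sq_nonneg (h * w (Sum.inr i))]

lemma dotProduct_le_shear_transpose (h : ℝ) (w : Fin 3 ⊕ Fin 3 → ℝ) :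
    w ⬝ᵥ w ≤ (2 + 2 * h ^ 2) * (((shear h)ᵀ *ᵥ w) ⬝ᵥ ((shear h)ᵀ *ᵥ w)) := by
  have := shear_transpose_dotProduct_le (-h) ((shear h)ᵀ *ᵥ w)
  rwa [Matrix.mulVec_mulVec, ← Matrix.transpose_mul, shear_mul_shear_neg, Matrix.transpose_one,
    Matrix.one_mulVec, neg_sq] at this

lemma blockRot_transpose_dotProduct {R : Mat3} (hR : R ∈ SO3) (w : Fin 3 ⊕ Fin 3 → ℝ) :
    ((blockRot R)ᵀ *ᵥ w) ⬝ᵥ ((blockRot R)ᵀ *ᵥ w) = w ⬝ᵥ w := by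
  rw [← dotProduct_mulVec_eq, Matrix.mulVec_mulVec, blockRot_mul_transpose hR, Matrix.one_mulVec]

lemma transition_transpose_mulVec (R : ℝ → Mat3) (c t : ℝ) (w : Fin 3 ⊕ Fin 3 → ℝ) :
    (transition R c t)ᵀ *ᵥ w = (blockRot (R t))ᵀ *ᵥ ((shear (c - t))ᵀ *ᵥ w) := by
  rw [transition, Matrix.transpose_mul, Matrix.mulVec_mulVec]

/-- `2 ζ·x - ζ·Pζ`, whose supremum over `ζ` is `x·P⁻¹x`. -/
def dualEnergy (P : Mat6) (x : E6) (ζ : Fin 3 ⊕ Fin 3 → ℝ) : ℝ := 2 * (ζ ⬝ᵥ x.ofLp) - quad P ζ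

/-- The attitude trajectory and the Riccati weights, with their bounds. -/
structure RiccatiData (ω : ℝ → E3) (R : ℝ → Mat3) (V : ℝ → Mat6) (Q : ℝ → Mat3)
    (vm vM qM : ℝ) : Prop where
  mem : ∀ t ≥ 0, R t ∈ SO3
  deriv : ∀ t ≥ 0, HasDerivWithinAt R (R t * skew (ω t)) (Ici 0) t
  vm_pos : 0 < vm
  V_symm : ∀ t ≥ 0, (V t)ᵀ = V t
  V_lower : ∀ t ≥ 0, ∀ w, vm * (w ⬝ᵥ w) ≤ quad (V t) w
  V_upper : ∀ t ≥ 0, ∀ w, quad (V t) w ≤ vM * (w ⬝ᵥ w)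
  Q_posDef : ∀ t ≥ 0, (Q t).PosDef
  Q_upper : ∀ t ≥ 0, ∀ w, quad (Q t) w ≤ qM * (w ⬝ᵥ w)

/-- `P` and `x` solve the flow equations with forcing `d` on `[a, b]`. -/
structure RiccatiFlow (ω : ℝ → E3) (V : ℝ → Mat6) (d : ℝ → E6) (a b : ℝ) (P : ℝ → Mat6)
    (x : ℝ → E6) : Prop where
  P_deriv : ∀ t ∈ Icc a b,
    HasDerivWithinAt P (matA (ω t) * P t + P t * (matA (ω t))ᵀ + V t) (Icc a b) t
  x_deriv : ∀ t ∈ Icc a b,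
    HasDerivWithinAt x (WithLp.toLp 2 (matA (ω t) *ᵥ (x t).ofLp) + d t) (Icc a b) t

lemma RiccatiFlow.mono {ω : ℝ → E3} {V : ℝ → Mat6} {d : ℝ → E6} {a b c : ℝ} {P : ℝ → Mat6}
    {x : ℝ → E6} (h : RiccatiFlow ω V d a b P x) (hc : c ≤ b) : RiccatiFlow ω V d a c P x :=
  ⟨fun t ht => (h.P_deriv t ⟨ht.1, ht.2.trans hc⟩).mono (Icc_subset_Icc_right hc),
    fun t ht => (h.x_deriv t ⟨ht.1, ht.2.trans hc⟩).mono (Icc_subset_Icc_right hc)⟩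

namespace RiccatiData

variable {ω : ℝ → E3} {R : ℝ → Mat3} {V : ℝ → Mat6} {Q : ℝ → Mat3} {vm vM qM TM : ℝ}
  {a b : ℝ} {P : ℝ → Mat6} {x d : ℝ → E6}

lemma transition_deriv (h : RiccatiData ω R V Q vm vM qM) (ha : 0 ≤ a) (c : ℝ) {t : ℝ}
    (ht : t ∈ Icc a b) :
    HasDerivWithinAt (transition R c) (-(transition R c t * matA (ω t))) (Icc a b) t :=
  hasDerivWithinAt_transition
    ((h.deriv t (ha.trans ht.1)).mono fun _ hs => ha.trans hs.1)

lemma transition_dotProduct_le (h : RiccatiData ω R V Q vm vM qM) (ha : 0 ≤ a)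
    (hab : b - a ≤ TM) {t : ℝ} (ht : t ∈ Icc a b) (w : Fin 3 ⊕ Fin 3 → ℝ) :
    ((transition R b t)ᵀ *ᵥ w) ⬝ᵥ ((transition R b t)ᵀ *ᵥ w) ≤ (2 + 2 * TM ^ 2) * (w ⬝ᵥ w) := by
  rw [transition_transpose_mulVec, blockRot_transpose_dotProduct (h.mem t (ha.trans ht.1))]
  refine (shear_transpose_dotProduct_le _ w).trans ?_
  have h1 : b - t ≤ TM := by linarith [ht.1]
  have h2 : 0 ≤ b - t := by linarith [ht.2]
  have := dotProduct_self_nonneg_real w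
  gcongr

lemma le_transition_dotProduct (h : RiccatiData ω R V Q vm vM qM) (ha : 0 ≤ a)
    (hab : b - a ≤ TM) {t : ℝ} (ht : t ∈ Icc a b) (w : Fin 3 ⊕ Fin 3 → ℝ) :
    w ⬝ᵥ w ≤ (2 + 2 * TM ^ 2) * (((transition R b t)ᵀ *ᵥ w) ⬝ᵥ ((transition R b t)ᵀ *ᵥ w)) := by
  rw [transition_transpose_mulVec, blockRot_transpose_dotProduct (h.mem t (ha.trans ht.1))]
  refine (dotProduct_le_shear_transpose (b - t) w).trans ?_
  have h1 : b - t ≤ TM := by linarith [ht.1]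
  have h2 : 0 ≤ b - t := by linarith [ht.2]
  have := dotProduct_self_nonneg_real ((shear (b - t))ᵀ *ᵥ w)
  gcongr

lemma quad_deriv (h : RiccatiData ω R V Q vm vM qM) (ha : 0 ≤ a)
    (hf : RiccatiFlow ω V d a b P x) (w : Fin 3 ⊕ Fin 3 → ℝ) {t : ℝ} (ht : t ∈ Icc a b) :
    HasDerivWithinAt (fun t => quad (P t) ((transition R b t)ᵀ *ᵥ w))
      (quad (V t) ((transition R b t)ᵀ *ᵥ w)) (Icc a b) t := by
  have := hasDerivWithinAt_quad
    (hasDerivWithinAt_conj (h.transition_deriv ha b ht) (hf.P_deriv t ht)) w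
  simpa only [quad_conj] using this

/-- Evaluated on a test vector transported backwards from time b, the form of P has derivative given
by V alone, so integration replaces a Grönwall argument. -/
lemma flow_quad_le (h : RiccatiData ω R V Q vm vM qM) (hvM : 0 ≤ vM) (ha : 0 ≤ a) (hab : a ≤ b)
    (hT : b - a ≤ TM) (hf : RiccatiFlow ω V d a b P x) (w : Fin 3 ⊕ Fin 3 → ℝ) :
    quad (P b) ((blockRot (R b))ᵀ *ᵥ w) ≤
      quad (P a) ((blockRot (R a))ᵀ *ᵥ ((shear (b - a))ᵀ *ᵥ w))
        + vM * (2 + 2 * TM ^ 2) * TM * (w ⬝ᵥ w) := by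
  have := sub_le_of_hasDerivWithinAt_le hab (fun t ht => h.quad_deriv ha hf w ht)
    (K := vM * ((2 + 2 * TM ^ 2) * (w ⬝ᵥ w))) fun t ht =>
      (h.V_upper t (ha.trans ht.1) _).trans
        (mul_le_mul_of_nonneg_left (h.transition_dotProduct_le ha hT ht w) hvM)
  rw [transition_self, transition_transpose_mulVec] at this
  have h2 := dotProduct_self_nonneg_real w
  have h3 : vM * ((2 + 2 * TM ^ 2) * (w ⬝ᵥ w)) * (b - a)
      ≤ vM * ((2 + 2 * TM ^ 2) * (w ⬝ᵥ w)) * TM := by gcongr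
  linarith

lemma le_flow_quad (h : RiccatiData ω R V Q vm vM qM) (ha : 0 ≤ a) (hab : a ≤ b)
    (hf : RiccatiFlow ω V d a b P x) (w : Fin 3 ⊕ Fin 3 → ℝ) :
    quad (P a) ((blockRot (R a))ᵀ *ᵥ ((shear (b - a))ᵀ *ᵥ w))
      ≤ quad (P b) ((blockRot (R b))ᵀ *ᵥ w) := by
  have := sub_le_of_hasDerivWithinAt_le hab (fun t ht => (h.quad_deriv ha hf w ht).neg)
    (K := 0) fun t ht => by
      have h1 := h.V_lower t (ha.trans ht.1) ((transition R b t)ᵀ *ᵥ w)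
      have h2 := mul_nonneg h.vm_pos.le
        (dotProduct_self_nonneg_real ((transition R b t)ᵀ *ᵥ w))
      linarith
  simp only [Pi.neg_apply, transition_self] at this
  rw [transition_transpose_mulVec] at this
  linarith

lemma quad_nonneg_of_flow (h : RiccatiData ω R V Q vm vM qM) (ha : 0 ≤ a) (hab : a ≤ b)
    (hf : RiccatiFlow ω V d a b P x) (hP : ∀ w, 0 ≤ quad (P a) w) (w : Fin 3 ⊕ Fin 3 → ℝ) :
    0 ≤ quad (P b) w := by
  have := h.le_flow_quad ha hab hf (blockRot (R b) *ᵥ w)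
  rw [Matrix.mulVec_mulVec w (blockRot (R b))ᵀ, blockRot_transpose_mul (h.mem b (ha.trans hab)),
    Matrix.one_mulVec] at this
  exact (hP _).trans this

/-- V is symmetric, so the antisymmetric part of the conjugated P is constant. -/
lemma symm_of_flow (h : RiccatiData ω R V Q vm vM qM) (ha : 0 ≤ a) (hab : a ≤ b)
    (hf : RiccatiFlow ω V d a b P x) (hP : (P a)ᵀ = P a) : (P b)ᵀ = P b := by
  have h1 : ∀ t ∈ Icc a b, HasDerivWithinAt (fun t => transition R b t * P t * (transition R b t)ᵀ
      - (transition R b t * P t * (transition R b t)ᵀ)ᵀ) 0 (Icc a b) t := fun t ht => by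
    have h2 := hasDerivWithinAt_conj (h.transition_deriv ha b ht) (hf.P_deriv t ht)
    refine (h2.sub (hasDerivWithinAt_matrix_transpose h2)).congr_deriv ?_
    simp [Matrix.transpose_mul, h.V_symm t (ha.trans ht.1), Matrix.mul_assoc]
  have h3 := eq_of_hasDerivWithinAt_zero h1 b (right_mem_Icc.2 hab)
  simp only [Matrix.transpose_mul, Matrix.transpose_transpose, hP, transition_self] at h3
  rw [← Matrix.mul_assoc (transition R b a), sub_self, ← Matrix.mul_assoc, ← Matrix.sub_mul,
    ← Matrix.mul_sub] at h3
  have hb := blockRot_transpose_mul (h.mem b (ha.trans hab))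
  have h4 : P b - (P b)ᵀ = ((blockRot (R b))ᵀ * blockRot (R b)) * (P b - (P b)ᵀ)
      * ((blockRot (R b))ᵀ * blockRot (R b)) := by
    rw [hb, Matrix.one_mul, Matrix.mul_one]
  have h5 : P b - (P b)ᵀ = 0 := by
    rw [h4, Matrix.mul_assoc (blockRot (R b))ᵀ, ← Matrix.mul_assoc _ (blockRot (R b))ᵀ,
      Matrix.mul_assoc (blockRot (R b))ᵀ, h3]
    simp
  exact (sub_eq_zero.1 h5).symm

/-- Along a transported ζ the dual energy has derivative 2ζ·d - ζ·Vζ. Half of the lower bound v_m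
absorbs the forcing d, and the other half remains as strict decrease. -/
lemma flow_dualEnergy_le (h : RiccatiData ω R V Q vm vM qM) (ha : 0 ≤ a) (hab : a ≤ b)
    (hT : b - a ≤ TM) (hf : RiccatiFlow ω V d a b P x) {D : ℝ} (hd : ∀ t ∈ Icc a b, ‖d t‖ ≤ D)
    (w : Fin 3 ⊕ Fin 3 → ℝ) :
    dualEnergy (P b) (x b) ((blockRot (R b))ᵀ *ᵥ w) ≤
      dualEnergy (P a) (x a) ((blockRot (R a))ᵀ *ᵥ ((shear (b - a))ᵀ *ᵥ w))
        - vm / (2 * (2 + 2 * TM ^ 2)) * (b - a) * (w ⬝ᵥ w) + 2 / vm * TM * D ^ 2 := by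
  have hvm := h.vm_pos
  have h1 : ∀ t ∈ Icc a b, HasDerivWithinAt
      (fun t => dualEnergy (P t) (x t) ((transition R b t)ᵀ *ᵥ w))
      (2 * (((transition R b t)ᵀ *ᵥ w) ⬝ᵥ (d t).ofLp) - quad (V t) ((transition R b t)ᵀ *ᵥ w))
      (Icc a b) t := fun t ht => by
    have h2 := hasDerivWithinAt_dotProduct (hasDerivWithinAt_mulVec_flow
      (h.transition_deriv ha b ht) (hf.x_deriv t ht)) w
    simp only [dotProduct_mulVec_eq] at h2
    exact (h2.const_mul 2).sub (h.quad_deriv ha hf w ht)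
  have h3 := sub_le_of_hasDerivWithinAt_le hab h1
    (K := - (vm / (2 * (2 + 2 * TM ^ 2)) * (w ⬝ᵥ w)) + 2 / vm * D ^ 2) fun t ht => by
      have h4 := h.V_lower t (ha.trans ht.1) ((transition R b t)ᵀ *ᵥ w)
      have h5 := h.le_transition_dotProduct ha hT ht w
      have h6 : (d t).ofLp ⬝ᵥ (d t).ofLp ≤ D ^ 2 := by
        rw [← norm_sq_eq_dotProduct]
        have := hd t ht
        gcongr
      set ζ := (transition R b t)ᵀ *ᵥ w
      have h7 : 2 * (ζ ⬝ᵥ (d t).ofLp) ≤ vm / 2 * (ζ ⬝ᵥ ζ) + 2 / vm * D ^ 2 := by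
        have h8 := dotProduct_self_nonneg_real (vm • ζ - (2 : ℝ) • (d t).ofLp)
        simp only [dotProduct_sub, sub_dotProduct, dotProduct_smul, smul_dotProduct,
          smul_eq_mul] at h8
        rw [dotProduct_comm (d t).ofLp ζ] at h8
        have h9 : 2 * (ζ ⬝ᵥ (d t).ofLp) ≤ (vm ^ 2 * (ζ ⬝ᵥ ζ) + 4 * D ^ 2) / (2 * vm) := by
          rw [le_div_iff₀ (by positivity)]
          nlinarith
        refine h9.trans (le_of_eq ?_)
        field_simp
        ring
      have h10 : vm / (2 * (2 + 2 * TM ^ 2)) * (w ⬝ᵥ w) ≤ vm / 2 * (ζ ⬝ᵥ ζ) := by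
        calc vm / (2 * (2 + 2 * TM ^ 2)) * (w ⬝ᵥ w)
            ≤ vm / (2 * (2 + 2 * TM ^ 2)) * ((2 + 2 * TM ^ 2) * (ζ ⬝ᵥ ζ)) := by gcongr
          _ = vm / 2 * (ζ ⬝ᵥ ζ) := by field_simp
      linarith
  simp only [transition_self] at h3
  rw [transition_transpose_mulVec] at h3
  have h4 : 2 / vm * D ^ 2 * (b - a) ≤ 2 / vm * D ^ 2 * TM := by gcongr
  linarith

end RiccatiData

/-! ### Quadratic forms at a jump -/

section Jump

variable {P : Mat6} {Q : Mat3}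

/-- The value of the Riccati matrix after a jump. -/
def riccatiJump (P : Mat6) (Q : Mat3) : Mat6 :=
  P - P * matCᵀ * (matC * P * matCᵀ + Q)⁻¹ * matC * P

/-- The value of the error after a jump. -/
def errorJump (P : Mat6) (Q : Mat3) (x : E6) : E6 :=
  WithLp.toLp 2 ((1 - gain P Q * matC) *ᵥ x.ofLp)

lemma innovation_posDef (hP : Pᵀ = P) (hP' : ∀ w, 0 ≤ quad P w) (hQ : Q.PosDef) :
    (matC * P * matCᵀ + Q).PosDef := by
  refine Matrix.PosDef.posSemidef_add (Matrix.PosSemidef.of_dotProduct_mulVec_nonneg ?_ fun v => ?_) hQ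
  · rw [Matrix.IsHermitian, Matrix.conjTranspose_eq_transpose_of_trivial]
    simp [Matrix.transpose_mul, hP, Matrix.mul_assoc]
  · have := hP' (matCᵀ *ᵥ v)
    rw [← quad_conj] at this
    simpa [quad] using this

lemma transpose_eq_of_isHermitian {n : Type*} {S : Matrix n n ℝ} (hS : S.IsHermitian) :
    Sᵀ = S := by
  rwa [Matrix.IsHermitian, Matrix.conjTranspose_eq_transpose_of_trivial] at hS

lemma riccatiJump_transpose (hP : Pᵀ = P) (hP' : ∀ w, 0 ≤ quad P w) (hQ : Q.PosDef) :
    (riccatiJump P Q)ᵀ = riccatiJump P Q := by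
  have hS : ((matC * P * matCᵀ + Q)⁻¹)ᵀ = (matC * P * matCᵀ + Q)⁻¹ := by
    rw [Matrix.transpose_nonsing_inv,
      transpose_eq_of_isHermitian (innovation_posDef hP hP' hQ).1]
  rw [riccatiJump]
  generalize (matC * P * matCᵀ + Q)⁻¹ = T at hS
  simp [Matrix.transpose_sub, Matrix.transpose_mul, hP, hS, Matrix.mul_assoc]

/-- The minimizer in the variational description of the jump. -/
def jumpMinimizer (P : Mat6) (Q : Mat3) (ζ : Fin 3 ⊕ Fin 3 → ℝ) : Fin 3 → ℝ :=
  (matC * P * matCᵀ + Q)⁻¹ *ᵥ (matC *ᵥ (P *ᵥ ζ))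

lemma innovation_mulVec_jumpMinimizer (hP : Pᵀ = P) (hP' : ∀ w, 0 ≤ quad P w) (hQ : Q.PosDef)
    (ζ : Fin 3 ⊕ Fin 3 → ℝ) :
    (matC * P * matCᵀ + Q) *ᵥ jumpMinimizer P Q ζ = matC *ᵥ (P *ᵥ ζ) := by
  have hS := innovation_posDef hP hP' hQ
  rw [jumpMinimizer, Matrix.mulVec_mulVec, Matrix.mul_nonsing_inv _ hS.det_pos.ne'.isUnit,
    Matrix.one_mulVec]

/-- Completing the square in l: the last term is what l loses against the minimizer, and dropping it
or annihilating it gives the two forms of the variational formula. -/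
lemma quad_riccatiJump (hP : Pᵀ = P) (hP' : ∀ w, 0 ≤ quad P w) (hQ : Q.PosDef)
    (ζ : Fin 3 ⊕ Fin 3 → ℝ) (l : Fin 3 → ℝ) :
    quad (riccatiJump P Q) ζ = quad P (ζ - matCᵀ *ᵥ l) + quad Q l
      - quad (matC * P * matCᵀ + Q) (l - jumpMinimizer P Q ζ) := by
  have h1 := innovation_mulVec_jumpMinimizer hP hP' hQ ζ
  have hS := transpose_eq_of_isHermitian (innovation_posDef hP hP' hQ).1
  have h2 : quad (riccatiJump P Q) ζ
      = quad P ζ - (matC *ᵥ (P *ᵥ ζ)) ⬝ᵥ jumpMinimizer P Q ζ := by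
    simp only [quad, riccatiJump, Matrix.sub_mulVec, dotProduct_sub, ← Matrix.mulVec_mulVec]
    rw [dotProduct_mulVec_eq P ζ (matCᵀ *ᵥ _), hP, dotProduct_mulVec_eq matCᵀ,
      Matrix.transpose_transpose]
    rfl
  have h3 : quad P (ζ - matCᵀ *ᵥ l) = quad P ζ - 2 * (l ⬝ᵥ (matC *ᵥ (P *ᵥ ζ)))
      + quad (matC * P * matCᵀ) l := by
    rw [quad_conj]
    simp only [quad, Matrix.mulVec_sub, dotProduct_sub, sub_dotProduct]
    rw [dotProduct_mulVec_eq P ζ (matCᵀ *ᵥ l), hP, dotProduct_mulVec_eq matC,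
      dotProduct_comm (P *ᵥ ζ)]
    ring
  have h4 : quad (matC * P * matCᵀ + Q) (l - jumpMinimizer P Q ζ)
      = quad (matC * P * matCᵀ + Q) l - 2 * (l ⬝ᵥ (matC *ᵥ (P *ᵥ ζ)))
        + (matC *ᵥ (P *ᵥ ζ)) ⬝ᵥ jumpMinimizer P Q ζ := by
    simp only [quad, Matrix.mulVec_sub, dotProduct_sub, sub_dotProduct, h1]
    rw [dotProduct_mulVec_eq _ (jumpMinimizer P Q ζ) l, hS, h1,
      dotProduct_comm (jumpMinimizer P Q ζ), dotProduct_comm (matC *ᵥ (P *ᵥ ζ)) l]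
    ring
  have h5 : quad (matC * P * matCᵀ + Q) l = quad (matC * P * matCᵀ) l + quad Q l := by
    simp [quad, Matrix.add_mulVec]
  rw [h2, h3, h4, h5]
  ring

lemma quad_riccatiJump_le (hP : Pᵀ = P) (hP' : ∀ w, 0 ≤ quad P w) (hQ : Q.PosDef)
    (ζ : Fin 3 ⊕ Fin 3 → ℝ) (l : Fin 3 → ℝ) :
    quad (riccatiJump P Q) ζ ≤ quad P (ζ - matCᵀ *ᵥ l) + quad Q l := by
  rw [quad_riccatiJump hP hP' hQ ζ l]
  have := quad_nonneg (innovation_posDef hP hP' hQ).posSemidef (l - jumpMinimizer P Q ζ)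
  linarith

lemma quad_riccatiJump_eq (hP : Pᵀ = P) (hP' : ∀ w, 0 ≤ quad P w) (hQ : Q.PosDef)
    (ζ : Fin 3 ⊕ Fin 3 → ℝ) :
    quad (riccatiJump P Q) ζ =
      quad P (ζ - matCᵀ *ᵥ jumpMinimizer P Q ζ) + quad Q (jumpMinimizer P Q ζ) := by
  rw [quad_riccatiJump hP hP' hQ ζ (jumpMinimizer P Q ζ)]
  simp [quad]

lemma quad_riccatiJump_nonneg (hP : Pᵀ = P) (hP' : ∀ w, 0 ≤ quad P w) (hQ : Q.PosDef)
    (ζ : Fin 3 ⊕ Fin 3 → ℝ) : 0 ≤ quad (riccatiJump P Q) ζ := by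
  rw [quad_riccatiJump_eq hP hP' hQ ζ]
  exact add_nonneg (hP' _) (quad_nonneg hQ.posSemidef _)

/-- (I - KC)ᵀζ = ζ - Cᵀl for the very l that minimizes the variational formula, so the linear and
quadratic terms are evaluated at the same vector; the discarded term is Q(l) ≥ 0. -/
lemma dualEnergy_jump_le (hP : Pᵀ = P) (hP' : ∀ w, 0 ≤ quad P w) (hQ : Q.PosDef) (x : E6)
    (ζ : Fin 3 ⊕ Fin 3 → ℝ) :
    dualEnergy (riccatiJump P Q) (errorJump P Q x) ζ
      ≤ dualEnergy P x (ζ - matCᵀ *ᵥ jumpMinimizer P Q ζ) := by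
  have hS : ((matC * P * matCᵀ + Q)⁻¹)ᵀ = (matC * P * matCᵀ + Q)⁻¹ := by
    rw [Matrix.transpose_nonsing_inv,
      transpose_eq_of_isHermitian (innovation_posDef hP hP' hQ).1]
  have h1 : ζ ⬝ᵥ (errorJump P Q x).ofLp
      = (ζ - matCᵀ *ᵥ jumpMinimizer P Q ζ) ⬝ᵥ x.ofLp := by
    simp only [errorJump, gain, Matrix.sub_mulVec, dotProduct_sub, sub_dotProduct,
      ← Matrix.mulVec_mulVec, Matrix.one_mulVec]
    rw [dotProduct_mulVec_eq P ζ, hP, dotProduct_mulVec_eq matCᵀ, Matrix.transpose_transpose,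
      dotProduct_mulVec_eq, hS, dotProduct_mulVec_eq]
    rfl
  rw [dualEnergy, dualEnergy, h1, quad_riccatiJump_eq hP hP' hQ]
  have := quad_nonneg hQ.posSemidef (jumpMinimizer P Q ζ)
  linarith

end Jump

/-! ### The Kalman filter along a hybrid run -/

/-- The first `n` jumps, at the times `s 1, …, s n`, of the Riccati matrix and of the error, and the
flow between them and up to the time `s (n + 1)`. -/
structure KalmanRun (ω : ℝ → E3) (V : ℝ → Mat6) (Q : ℝ → Mat3) (Tm TM : ℝ) (n : ℕ) (s : ℕ → ℝ)
    (d : ℕ → ℝ → E6) (P : ℕ → ℝ → Mat6) (x : ℕ → ℝ → E6) : Prop where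
  zero : s 0 = 0
  mono : Monotone s
  le : ∀ i ≤ n, s (i + 1) - s i ≤ TM
  -- The first interval is exempt because the initial timer may be arbitrarily small, the last one
  -- because it may be cut off at any time.
  ge : ∀ i, 1 ≤ i → i < n → Tm ≤ s (i + 1) - s i
  flow : ∀ i ≤ n, RiccatiFlow ω V (d i) (s i) (s (i + 1)) (P i) (x i)
  jump_P : ∀ i < n, P (i + 1) (s (i + 1)) = riccatiJump (P i (s (i + 1))) (Q (s (i + 1)))
  jump_x : ∀ i < n,
    x (i + 1) (s (i + 1)) = errorJump (P i (s (i + 1))) (Q (s (i + 1))) (x i (s (i + 1)))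

lemma blockRot_transpose_mulVec (R : Mat3) (a b : Fin 3 → ℝ) :
    (blockRot R)ᵀ *ᵥ Sum.elim a b = Sum.elim (Rᵀ *ᵥ a) (Rᵀ *ᵥ b) := by
  simp [blockRot, Matrix.fromBlocks_transpose, Matrix.fromBlocks_mulVec]

lemma matC_transpose_mulVec (l : Fin 3 → ℝ) : matCᵀ *ᵥ l = Sum.elim l 0 := by
  simp [matC, Matrix.transpose_fromCols, Matrix.fromRows_mulVec]

lemma dotProduct_sumElim (a b : Fin 3 → ℝ) :
    (Sum.elim a b : Fin 3 ⊕ Fin 3 → ℝ) ⬝ᵥ Sum.elim a b = a ⬝ᵥ a + b ⬝ᵥ b := by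
  simp [dotProduct, Fintype.sum_sum_type]

lemma rot_transpose_dotProduct {R : Mat3} (hR : R ∈ SO3) (a : Fin 3 → ℝ) :
    (Rᵀ *ᵥ a) ⬝ᵥ (Rᵀ *ᵥ a) = a ⬝ᵥ a := by
  rw [← dotProduct_mulVec_eq, Matrix.mulVec_mulVec, hR.1, Matrix.one_mulVec]

lemma blockRot_transpose_mulVec_blockRot {R : Mat3} (hR : R ∈ SO3) (ζ : Fin 3 ⊕ Fin 3 → ℝ) :
    (blockRot R)ᵀ *ᵥ (blockRot R *ᵥ ζ) = ζ := by
  rw [Matrix.mulVec_mulVec, blockRot_transpose_mul hR, Matrix.one_mulVec]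

lemma blockRot_dotProduct {R : Mat3} (hR : R ∈ SO3) (ζ : Fin 3 ⊕ Fin 3 → ℝ) :
    (blockRot R *ᵥ ζ) ⬝ᵥ (blockRot R *ᵥ ζ) = ζ ⬝ᵥ ζ := by
  rw [dotProduct_mulVec_eq, blockRot_transpose_mulVec_blockRot hR]

namespace RiccatiData

variable {ω : ℝ → E3} {R : ℝ → Mat3} {V : ℝ → Mat6} {Q : ℝ → Mat3} {vm vM qM Tm TM : ℝ}
  {a b : ℝ} {P : ℝ → Mat6} {x d : ℝ → E6}

/-- Two consecutive jumps bound the Riccati matrix, whatever its value before them. -/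
lemma quad_two_jumps_le (h : RiccatiData ω R V Q vm vM qM) (hvM : 0 ≤ vM) (hqM : 0 ≤ qM)
    (ha : 0 ≤ a) (hTm : 0 < Tm) (hTm' : Tm ≤ b - a) (hT : b - a ≤ TM)
    (hf : RiccatiFlow ω V d a b P x) {P₁ : Mat6} (hP₁ : P₁ᵀ = P₁) (hP₁' : ∀ w, 0 ≤ quad P₁ w)
    (hPa : P a = riccatiJump P₁ (Q a)) (ζ : Fin 3 ⊕ Fin 3 → ℝ) :
    quad (riccatiJump (P b) (Q b)) ζ ≤
      (vM * (2 + 2 * TM ^ 2) * TM * (1 + (Tm ^ 2)⁻¹) + qM * (2 + 3 * (Tm ^ 2)⁻¹)) * (ζ ⬝ᵥ ζ) := by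
  have hab : a ≤ b := by linarith
  have hb : 0 ≤ b := ha.trans hab
  have hQa := h.Q_posDef a ha
  have hsym := h.symm_of_flow ha hab hf (hPa ▸ riccatiJump_transpose hP₁ hP₁' hQa)
  have hnn := h.quad_nonneg_of_flow ha hab hf (hPa ▸ quad_riccatiJump_nonneg hP₁ hP₁' hQa)
  have hRb := h.mem b hb
  have hRa := h.mem a ha
  obtain ⟨w, rfl⟩ : ∃ w, ζ = (blockRot (R b))ᵀ *ᵥ w :=
    ⟨_, (blockRot_transpose_mulVec_blockRot hRb ζ).symm⟩
  rw [blockRot_transpose_dotProduct hRb]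
  set u : Fin 3 → ℝ := fun i => w (Sum.inl i) with hu
  set v : Fin 3 → ℝ := fun i => w (Sum.inr i) with hv
  have hw : w = Sum.elim u v := by ext (i | i) <;> rfl
  rw [hw, dotProduct_sumElim]
  -- With this k, the choice l = R_bᵀ(u + kv) at time b leaves the vector (-kv, v), whose second
  -- block the shear over b - a annihilates. What reaches time a lies in the range of Cᵀ.
  set k := (b - a)⁻¹ with hk
  have hba : b - a ≠ 0 := by linarith
  have hk2 : k ^ 2 ≤ (Tm ^ 2)⁻¹ := by
    rw [hk, inv_pow]
    gcongr
  have hdiff : (blockRot (R b))ᵀ *ᵥ Sum.elim u v - matCᵀ *ᵥ ((R b)ᵀ *ᵥ (u + k • v))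
      = (blockRot (R b))ᵀ *ᵥ Sum.elim (-(k • v)) v := by
    rw [blockRot_transpose_mulVec, blockRot_transpose_mulVec, matC_transpose_mulVec]
    ext (i | i) <;> simp [Matrix.mulVec_add, Matrix.mulVec_neg]
  have hsh : (shear (b - a))ᵀ *ᵥ Sum.elim (-(k • v)) v = Sum.elim (-(k • v)) 0 := by
    rw [shear_transpose_mulVec]
    ext (i | i)
    · simp
    · simp [hk]; field_simp; simp
  have hC : (blockRot (R a))ᵀ *ᵥ Sum.elim (-(k • v)) 0 = matCᵀ *ᵥ ((R a)ᵀ *ᵥ (-(k • v))) := by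
    rw [blockRot_transpose_mulVec, matC_transpose_mulVec, Matrix.mulVec_zero]
  have h1 := quad_riccatiJump_le hsym hnn (h.Q_posDef b hb)
    ((blockRot (R b))ᵀ *ᵥ Sum.elim u v) ((R b)ᵀ *ᵥ (u + k • v))
  rw [hdiff] at h1
  have h2 := h.flow_quad_le hvM ha hab hT hf (Sum.elim (-(k • v)) v)
  rw [hsh, hC, hPa, dotProduct_sumElim] at h2
  -- The choice of l at time a removes the remaining vector entirely, so P₁ is evaluated at 0 and
  -- drops out.
  have h3 := quad_riccatiJump_le hP₁ hP₁' hQa (matCᵀ *ᵥ ((R a)ᵀ *ᵥ (-(k • v))))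
    ((R a)ᵀ *ᵥ (-(k • v)))
  have h0 : quad P₁ 0 = 0 := by simp [quad]
  rw [sub_self, h0] at h3
  have h4 := h.Q_upper b hb ((R b)ᵀ *ᵥ (u + k • v))
  have h5 := h.Q_upper a ha ((R a)ᵀ *ᵥ (-(k • v)))
  rw [rot_transpose_dotProduct hRb] at h4
  rw [rot_transpose_dotProduct hRa] at h5
  have hkv : (-(k • v)) ⬝ᵥ (-(k • v)) = k ^ 2 * (v ⬝ᵥ v) := by simp; ring
  rw [hkv] at h2 h5
  have hu0 := dotProduct_self_nonneg_real u
  have hv0 := dotProduct_self_nonneg_real v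
  have hsum : (u + k • v) ⬝ᵥ (u + k • v) ≤ 2 * (u ⬝ᵥ u) + 2 * k ^ 2 * (v ⬝ᵥ v) := by
    have h6 := dotProduct_self_nonneg_real (u - k • v)
    simp only [dotProduct_sub, sub_dotProduct, dotProduct_add, add_dotProduct, dotProduct_smul,
      smul_dotProduct, smul_eq_mul] at h6 ⊢
    linarith
  set t := (Tm ^ 2)⁻¹ with ht
  have ht0 : 0 ≤ t := by positivity
  have hkt : k ^ 2 * (v ⬝ᵥ v) ≤ t * (v ⬝ᵥ v) := by gcongr
  have hTM0 : 0 ≤ TM := by linarith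
  have e1 : vM * (2 + 2 * TM ^ 2) * TM * (k ^ 2 * v ⬝ᵥ v + v ⬝ᵥ v)
      ≤ vM * (2 + 2 * TM ^ 2) * TM * ((1 + t) * (u ⬝ᵥ u + v ⬝ᵥ v)) := by
    gcongr
    nlinarith [mul_nonneg ht0 hu0]
  have e2 : qM * ((u + k • v) ⬝ᵥ (u + k • v)) + qM * (k ^ 2 * v ⬝ᵥ v)
      ≤ qM * ((2 + 3 * t) * (u ⬝ᵥ u + v ⬝ᵥ v)) := by
    rw [← mul_add]
    gcongr
    nlinarith [mul_nonneg ht0 hu0]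
  linarith

lemma quad_flow_upper (h : RiccatiData ω R V Q vm vM qM) (hvM : 0 ≤ vM) (ha : 0 ≤ a) (hab : a ≤ b)
    (hT : b - a ≤ TM) (hf : RiccatiFlow ω V d a b P x) {p : ℝ} (hp : 0 ≤ p)
    (hP : ∀ w, quad (P a) w ≤ p * (w ⬝ᵥ w)) (w : Fin 3 ⊕ Fin 3 → ℝ) :
    quad (P b) w ≤ (2 + 2 * TM ^ 2) * (p + vM * TM) * (w ⬝ᵥ w) := by
  have hRb := h.mem b (ha.trans hab)
  have h1 := h.flow_quad_le hvM ha hab hT hf (blockRot (R b) *ᵥ w)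
  have h2 := hP ((blockRot (R a))ᵀ *ᵥ ((shear (b - a))ᵀ *ᵥ (blockRot (R b) *ᵥ w)))
  rw [blockRot_transpose_dotProduct (h.mem a ha)] at h2
  have h3 := shear_transpose_dotProduct_le (b - a) (blockRot (R b) *ᵥ w)
  rw [blockRot_transpose_mulVec_blockRot hRb] at h1
  rw [blockRot_dotProduct hRb] at h1 h3
  have h4 : (2 + 2 * (b - a) ^ 2) * (w ⬝ᵥ w) ≤ (2 + 2 * TM ^ 2) * (w ⬝ᵥ w) := by
    have := dotProduct_self_nonneg_real w
    have : 0 ≤ b - a := by linarith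
    gcongr
  have h5 := mul_le_mul_of_nonneg_left (h3.trans h4) hp
  nlinarith

/-- Since P ≤ p, the decrease along the flow dominates θ ζ·Pζ. A bound for 2ζ·x - (1 - θ) ζ·Pζ over
all ζ is a contracted bound for the dual energy, by homogeneity. -/
lemma dualEnergy_flow_le (h : RiccatiData ω R V Q vm vM qM) (ha : 0 ≤ a) (hab : a ≤ b)
    (hT : b - a ≤ TM) (hf : RiccatiFlow ω V d a b P x) {D c p θ : ℝ}
    (hd : ∀ t ∈ Icc a b, ‖d t‖ ≤ D) (hp : ∀ w, quad (P b) w ≤ p * (w ⬝ᵥ w))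
    (hθ0 : 0 ≤ θ) (hθ : θ * p ≤ vm / (2 * (2 + 2 * TM ^ 2)) * (b - a)) (hθ1 : θ < 1)
    (hc : ∀ ζ, dualEnergy (P a) (x a) ζ ≤ c) (ζ : Fin 3 ⊕ Fin 3 → ℝ) :
    dualEnergy (P b) (x b) ζ ≤ (1 - θ) * (c + 2 / vm * TM * D ^ 2) := by
  have hRb := h.mem b (ha.trans hab)
  have key : ∀ ζ, 2 * (ζ ⬝ᵥ (x b).ofLp) - (1 - θ) * quad (P b) ζ ≤ c + 2 / vm * TM * D ^ 2 := by
    intro ζ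
    have h1 := h.flow_dualEnergy_le ha hab hT hf hd (blockRot (R b) *ᵥ ζ)
    rw [blockRot_transpose_mulVec_blockRot hRb, blockRot_dotProduct hRb] at h1
    have h2 := hc ((blockRot (R a))ᵀ *ᵥ ((shear (b - a))ᵀ *ᵥ (blockRot (R b) *ᵥ ζ)))
    have h3 := mul_le_mul_of_nonneg_left (hp ζ) hθ0
    have h4 := mul_le_mul_of_nonneg_right hθ (dotProduct_self_nonneg_real ζ)
    rw [dualEnergy] at h1
    linarith
  have hpos : 0 < 1 - θ := by linarith
  -- Rescaling ζ by (1 - θ)⁻¹ turns the weakened quadratic term back into the full one and yields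
  -- the factor 1 - θ.
  have h1 := mul_le_mul_of_nonneg_left (key ((1 - θ)⁻¹ • ζ)) hpos.le
  refine le_trans (le_of_eq ?_) h1
  rw [quad_smul_vec, dualEnergy, smul_dotProduct, smul_eq_mul]
  field_simp

end RiccatiData

/-- The test vector ζ = x/p suffices. -/
lemma norm_sq_le_of_dualEnergy_le {P : Mat6} {x : E6} {p c : ℝ} (hp : 0 < p)
    (hP : ∀ w, quad P w ≤ p * (w ⬝ᵥ w)) (hc : ∀ ζ, dualEnergy P x ζ ≤ c) : ‖x‖ ^ 2 ≤ p * c := by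
  have h1 := hc (p⁻¹ • x.ofLp)
  have h2 := hP x.ofLp
  rw [dualEnergy, quad_smul_vec, smul_dotProduct, smul_eq_mul, ← norm_sq_eq_dotProduct] at h1
  rw [← norm_sq_eq_dotProduct] at h2
  have h3 : p⁻¹ ^ 2 * quad P x.ofLp ≤ p⁻¹ ^ 2 * (p * ‖x‖ ^ 2) := by gcongr
  have h4 : p⁻¹ ^ 2 * (p * ‖x‖ ^ 2) = p⁻¹ * ‖x‖ ^ 2 := by field_simp
  have h5 : p⁻¹ * ‖x‖ ^ 2 ≤ c := by linarith
  rwa [inv_mul_le_iff₀ hp] at h5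

lemma dualEnergy_le_of_lower {P : Mat6} {x : E6} {p : ℝ} (hp : 0 < p)
    (hP : ∀ w, p * (w ⬝ᵥ w) ≤ quad P w) (ζ : Fin 3 ⊕ Fin 3 → ℝ) :
    dualEnergy P x ζ ≤ p⁻¹ * ‖x‖ ^ 2 := by
  have h1 := dotProduct_self_nonneg_real (p • ζ - x.ofLp)
  simp only [dotProduct_sub, sub_dotProduct, dotProduct_smul, smul_dotProduct, smul_eq_mul] at h1
  rw [dotProduct_comm x.ofLp ζ] at h1
  rw [dualEnergy, norm_sq_eq_dotProduct, inv_mul_eq_div, le_div_iff₀ hp]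
  nlinarith [hP ζ]

namespace KalmanRun

variable {ω : ℝ → E3} {R : ℝ → Mat3} {V : ℝ → Mat6} {Q : ℝ → Mat3} {vm vM qM Tm TM : ℝ}
  {n : ℕ} {s : ℕ → ℝ} {d : ℕ → ℝ → E6} {P : ℕ → ℝ → Mat6} {x : ℕ → ℝ → E6}

lemma nonneg (hr : KalmanRun ω V Q Tm TM n s d P x) (i : ℕ) : 0 ≤ s i :=
  hr.zero ▸ hr.mono (Nat.zero_le i)

lemma symm_and_nonneg (hr : KalmanRun ω V Q Tm TM n s d P x) (h : RiccatiData ω R V Q vm vM qM)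
    (h0 : (P 0 0)ᵀ = P 0 0) (h0' : ∀ w, 0 ≤ quad (P 0 0) w) :
    ∀ i ≤ n, (P i (s i))ᵀ = P i (s i) ∧ ∀ w, 0 ≤ quad (P i (s i)) w := by
  intro i
  induction i with
  | zero => intro _; rw [hr.zero]; exact ⟨h0, h0'⟩
  | succ i ih =>
    intro hi
    obtain ⟨h1, h2⟩ := ih (by omega)
    have hf := hr.flow i (by omega)
    have hm := hr.mono (Nat.le_succ i)
    have h3 := h.symm_of_flow (hr.nonneg i) hm hf h1
    have h4 := h.quad_nonneg_of_flow (hr.nonneg i) hm hf h2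
    have hQ := h.Q_posDef _ (hr.nonneg (i + 1))
    rw [hr.jump_P i (by omega)]
    exact ⟨riccatiJump_transpose h3 h4 hQ, quad_riccatiJump_nonneg h3 h4 hQ⟩

lemma symm_and_nonneg_end (hr : KalmanRun ω V Q Tm TM n s d P x)
    (h : RiccatiData ω R V Q vm vM qM) (h0 : (P 0 0)ᵀ = P 0 0)
    (h0' : ∀ w, 0 ≤ quad (P 0 0) w) (i : ℕ) (hi : i ≤ n) :
    (P i (s (i + 1)))ᵀ = P i (s (i + 1)) ∧ ∀ w, 0 ≤ quad (P i (s (i + 1))) w := by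
  obtain ⟨h1, h2⟩ := hr.symm_and_nonneg h h0 h0' i hi
  have hf := hr.flow i hi
  have hm := hr.mono (Nat.le_succ i)
  exact ⟨h.symm_of_flow (hr.nonneg i) hm hf h1, h.quad_nonneg_of_flow (hr.nonneg i) hm hf h2⟩

/-- A bound for the Riccati matrix after the jumps, valid for all runs. -/
lemma exists_quad_le (h : RiccatiData ω R V Q vm vM qM) (hvM : 0 ≤ vM) (hqM : 0 ≤ qM)
    (hTm : 0 < Tm) (hTM : Tm ≤ TM) {p₀ : ℝ} (hp₀ : 0 ≤ p₀) :
    ∃ p ≥ 0, ∀ (n : ℕ) (s : ℕ → ℝ) (d : ℕ → ℝ → E6) (P : ℕ → ℝ → Mat6) (x : ℕ → ℝ → E6),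
      KalmanRun ω V Q Tm TM n s d P x → (P 0 0)ᵀ = P 0 0 → (∀ w, 0 ≤ quad (P 0 0) w) →
      (∀ w, quad (P 0 0) w ≤ p₀ * (w ⬝ᵥ w)) →
      ∀ i ≤ n, ∀ t ∈ Icc (s i) (s (i + 1)), ∀ w, quad (P i t) w ≤ p * (w ⬝ᵥ w) := by
  have hTM0 : 0 < TM := hTm.trans_le hTM
  -- p₀ bounds P at the start, p₁ after the first jump, where a single jump cannot forget P₀, and p₂
  -- after every later jump.
  set p₁ := (2 + 2 * TM ^ 2) * (p₀ + vM * TM) with hp₁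
  set p₂ := vM * (2 + 2 * TM ^ 2) * TM * (1 + (Tm ^ 2)⁻¹) + qM * (2 + 3 * (Tm ^ 2)⁻¹) with hp₂
  have hp₁0 : 0 ≤ p₁ := by positivity
  have hp₂0 : 0 ≤ p₂ := by positivity
  refine ⟨(2 + 2 * TM ^ 2) * ((p₀ + p₁ + p₂) + vM * TM), by positivity, ?_⟩
  intro n s d P x hr h0 h0' hP0
  have hstart : ∀ i ≤ n, ∀ w, quad (P i (s i)) w ≤ (p₀ + p₁ + p₂) * (w ⬝ᵥ w) := by
    intro i hi w
    have hw := dotProduct_self_nonneg_real w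
    have e0 := mul_nonneg hp₀ hw
    have e1 := mul_nonneg hp₁0 hw
    have e2 := mul_nonneg hp₂0 hw
    rcases i with _ | _ | i
    · rw [hr.zero]
      linarith [hP0 w]
    · have hf := hr.flow 0 (by omega)
      obtain ⟨h1, h2⟩ := hr.symm_and_nonneg_end h h0 h0' 0 (by omega)
      have h3 := quad_riccatiJump_le h1 h2 (h.Q_posDef _ (hr.nonneg 1)) w 0
      rw [Matrix.mulVec_zero, sub_zero] at h3
      have h4 := h.quad_flow_upper hvM (hr.nonneg 0) (hr.mono zero_le_one)
        (hr.le 0 (by omega)) hf hp₀ (by rw [hr.zero]; exact hP0) w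
      have h5 : quad (Q (s (0 + 1))) 0 = 0 := by simp [quad]
      rw [hr.jump_P 0 (by omega)]
      simp only [zero_add] at h1 h2 h3 h4 h5 ⊢
      linarith
    · obtain ⟨h1, h2⟩ := hr.symm_and_nonneg_end h h0 h0' i (by omega)
      have h3 := h.quad_two_jumps_le hvM hqM (hr.nonneg (i + 1)) hTm
        (hr.ge (i + 1) (by omega) (by omega)) (hr.le (i + 1) (by omega))
        (hr.flow (i + 1) (by omega)) h1 h2 (hr.jump_P i (by omega)) w
      rw [hr.jump_P (i + 1) (by omega)]
      linarith
  intro i hi t ht w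
  exact h.quad_flow_upper hvM (hr.nonneg i) ht.1 (by linarith [hr.le i hi, ht.2])
    ((hr.flow i hi).mono ht.2) (by positivity) (hstart i hi) w

/-- Exponential convergence of the error of the Kalman filter, driven by a perturbation that decays
geometrically with the number of jumps. -/
lemma exists_error_le (h : RiccatiData ω R V Q vm vM qM) (hvM : 0 ≤ vM) (hqM : 0 ≤ qM)
    (hTm : 0 < Tm) (hTM : Tm ≤ TM) {P₀ : Mat6} (hP₀ : P₀.PosDef) {γ₁ : ℝ} (hγ₁ : 0 ≤ γ₁)
    (hγ₁' : γ₁ < 1) :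
    ∃ K ≥ 0, ∃ γ, γ₁ ≤ γ ∧ 0 < γ ∧ γ < 1 ∧
      ∀ (n : ℕ) (s : ℕ → ℝ) (d : ℕ → ℝ → E6) (P : ℕ → ℝ → Mat6) (x : ℕ → ℝ → E6) (ρ : ℝ),
      KalmanRun ω V Q Tm TM n s d P x → P 0 0 = P₀ →
      (∀ i ≤ n, ∀ t ∈ Icc (s i) (s (i + 1)), ‖d i t‖ ^ 2 ≤ γ₁ ^ i * ρ) →
      ∀ i ≤ n, ∀ t ∈ Icc (s i) (s (i + 1)), ‖x i t‖ ^ 2 ≤ K * γ ^ i * (‖x 0 0‖ ^ 2 + ρ) := by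
  have hTM0 : 0 < TM := hTm.trans_le hTM
  have hvm := h.vm_pos
  obtain ⟨p', hp'0, hp'⟩ := exists_quad_le h hvM hqM hTm hTM (norm_nonneg P₀)
  set α := vm / (2 * (2 + 2 * TM ^ 2)) with hα
  have hα0 : 0 < α := by positivity
  -- The bound is enlarged by 2αT_M so that θ = αT_m/p is at most 1/2.
  set p := p' + 2 * α * TM with hp
  have hp0 : 0 < p := by positivity
  set β := 2 / vm * TM with hβ
  have hβ0 : 0 < β := by positivity
  set θ := α * Tm / p with hθ
  have hθ0 : 0 < θ := by positivity
  have hθ2 : θ ≤ 1 / 2 := by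
    rw [hθ, div_le_iff₀ hp0]
    nlinarith
  obtain ⟨γ, hγ, hγ'⟩ := exists_between (max_lt hγ₁' (by linarith : 1 - θ < 1))
  obtain ⟨hγa, hγb⟩ := max_lt_iff.1 hγ
  have hγ0 : 0 < γ := hγ₁.trans_lt hγa
  set pl := sInf (spectrum ℝ P₀) with hpl
  have hpl0 : 0 < pl := sInf_spectrum_pos hP₀
  -- The first two summands cover the first jump, at which there may be no contraction; the third
  -- makes (1 - θ)(K₀ + β) ≤ γK₀, so that the induction closes.
  set K₀ := pl⁻¹ / γ + β / γ + β / (γ - (1 - θ)) with hK₀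
  have hg : 0 < γ - (1 - θ) := by linarith
  have hK₀0 : 0 < K₀ := by positivity
  have hK1 : pl⁻¹ + β ≤ γ * K₀ := by
    have e : γ * K₀ = pl⁻¹ + β + γ * (β / (γ - (1 - θ))) := by rw [hK₀]; field_simp
    have : 0 < γ * (β / (γ - (1 - θ))) := by positivity
    linarith
  have hK2 : (1 - θ) * (K₀ + β) ≤ γ * K₀ := by
    have e : β / (γ - (1 - θ)) ≤ K₀ := by
      rw [hK₀]
      have : 0 ≤ pl⁻¹ / γ + β / γ := by positivity
      linarith
    rw [div_le_iff₀ hg] at e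
    nlinarith
  have hK3 : pl⁻¹ ≤ K₀ := by
    have : pl⁻¹ ≤ pl⁻¹ / γ := by rw [le_div_iff₀ hγ0]; nlinarith [inv_pos.2 hpl0]
    have : 0 ≤ β / γ + β / (γ - (1 - θ)) := by positivity
    linarith
  refine ⟨p * (K₀ + β), by positivity, γ, hγa.le, hγ0, hγ', ?_⟩
  intro n s d P x ρ hr hP0 hd
  have hsym : (P 0 0)ᵀ = P 0 0 := hP0 ▸ transpose_eq_of_isHermitian hP₀.1
  have hnn : ∀ w, 0 ≤ quad (P 0 0) w := hP0 ▸ quad_nonneg hP₀.posSemidef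
  have hup : ∀ i ≤ n, ∀ t ∈ Icc (s i) (s (i + 1)), ∀ w, quad (P i t) w ≤ p * (w ⬝ᵥ w) := by
    intro i hi t ht w
    have := hp' n s d P x hr hsym hnn (hP0 ▸ quad_le_norm P₀) i hi t ht w
    have hw := dotProduct_self_nonneg_real w
    rw [hp, add_mul]
    have : 0 ≤ 2 * α * TM * (w ⬝ᵥ w) := by positivity
    linarith
  have hρ : 0 ≤ ρ := by
    have := (sq_nonneg _).trans
      (hd 0 (Nat.zero_le n) (s 0) (left_mem_Icc.2 (hr.mono zero_le_one)))
    simpa using this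
  set ρ' := ‖x 0 0‖ ^ 2 + ρ with hρ'
  have hρ'0 : 0 ≤ ρ' := by positivity
  have hpow : ∀ i, γ₁ ^ i * ρ ≤ γ ^ i * ρ' := fun i =>
    mul_le_mul (pow_le_pow_left₀ hγ₁ hγa.le i) (by rw [hρ']; nlinarith [sq_nonneg ‖x 0 0‖]) hρ
      (by positivity)
  have hstep : ∀ i ≤ n, ∀ t ∈ Icc (s i) (s (i + 1)), ∀ c θ' : ℝ, 0 ≤ θ' → θ' ≤ 1 / 2 →
      θ' * p ≤ α * (t - s i) →
      (∀ ζ, dualEnergy (P i (s i)) (x i (s i)) ζ ≤ c) →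
      ∀ ζ, dualEnergy (P i t) (x i t) ζ ≤ (1 - θ') * (c + β * (γ ^ i * ρ')) := by
    intro i hi t ht c θ' h1 h2 h3 h4 ζ
    have h5 := h.dualEnergy_flow_le (hr.nonneg i) ht.1 (by linarith [hr.le i hi, ht.2])
      ((hr.flow i hi).mono ht.2) (D := √(γ₁ ^ i * ρ))
      (fun r hr' => Real.le_sqrt_of_sq_le (hd i hi r ⟨hr'.1, hr'.2.trans ht.2⟩))
      (hup i hi t ht) h1 h3 (by linarith) h4 ζ
    refine h5.trans ?_
    rw [Real.sq_sqrt (by positivity)]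
    have := hpow i
    have : 0 ≤ 1 - θ' := by linarith
    gcongr
  have hmain : ∀ i ≤ n, ∀ ζ, dualEnergy (P i (s i)) (x i (s i)) ζ ≤ K₀ * γ ^ i * ρ' := by
    intro i
    induction i with
    | zero =>
      intro _ ζ
      rw [hr.zero]
      refine (dualEnergy_le_of_lower hpl0 (hP0 ▸ sInf_spectrum_mul_le hP₀.1) ζ).trans ?_
      rw [pow_zero, mul_one]
      have : ‖x 0 0‖ ^ 2 ≤ ρ' := by rw [hρ']; linarith
      gcongr
    | succ i ih =>
      intro hi ζ
      have hm := hr.mono (Nat.le_succ i)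
      obtain ⟨h1, h2⟩ := hr.symm_and_nonneg_end h hsym hnn i (by omega)
      rw [hr.jump_P i (by omega), hr.jump_x i (by omega)]
      refine (dualEnergy_jump_le h1 h2 (h.Q_posDef _ (hr.nonneg (i + 1))) _ ζ).trans ?_
      have hγi : 0 ≤ γ ^ i * ρ' := by positivity
      -- The first interval may be too short to contract, so θ' = 0 there. The sharper initial bound
      -- pl⁻¹ρ' replaces the one with K₀, from which the step would not close.
      rcases i with _ | i
      · have h3 : ∀ ζ, dualEnergy (P 0 (s 0)) (x 0 (s 0)) ζ ≤ pl⁻¹ * ρ' := fun ζ => by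
          rw [hr.zero]
          refine (dualEnergy_le_of_lower hpl0 (hP0 ▸ sInf_spectrum_mul_le hP₀.1) ζ).trans ?_
          have : ‖x 0 0‖ ^ 2 ≤ ρ' := by rw [hρ']; linarith
          gcongr
        refine (hstep 0 (by omega) _ (right_mem_Icc.2 hm) _ 0 le_rfl (by norm_num)
          (by rw [zero_mul]; exact mul_nonneg hα0.le (sub_nonneg.2 hm)) h3 _).trans ?_
        rw [zero_add, pow_one, pow_zero, sub_zero, one_mul, one_mul, ← add_mul, mul_comm K₀]
        gcongr
      · refine (hstep (i + 1) (by omega) _ (right_mem_Icc.2 hm) _ θ hθ0.le hθ2 ?_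
          (ih (by omega)) _).trans ?_
        · rw [hθ, div_mul_cancel₀ _ hp0.ne']
          have := hr.ge (i + 1) (by omega) (by omega)
          gcongr
        · calc (1 - θ) * (K₀ * γ ^ (i + 1) * ρ' + β * (γ ^ (i + 1) * ρ'))
                = (1 - θ) * (K₀ + β) * (γ ^ (i + 1) * ρ') := by ring
              _ ≤ γ * K₀ * (γ ^ (i + 1) * ρ') := by gcongr
              _ = K₀ * γ ^ (i + 1 + 1) * ρ' := by ring
  intro i hi t ht
  have h1 := hstep i hi t ht _ 0 le_rfl (by norm_num)
    (by rw [zero_mul]; exact mul_nonneg hα0.le (sub_nonneg.2 ht.1)) (hmain i hi)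
  refine (norm_sq_le_of_dualEnergy_le hp0 (hup i hi t ht) h1).trans (le_of_eq ?_)
  ring

end KalmanRun

/-! ### The attitude subsystem along a hybrid run -/

/-- The first `n` jumps of the attitude error and of its correction term, and the flow between them
and up to the time `s (n + 1)`. -/
structure AttitudeRun (M : Mat3) (kR Tm TM : ℝ) (n : ℕ) (s : ℕ → ℝ) (T : ℕ → ℝ → Mat3)
    (η : ℕ → ℝ → E3) : Prop where
  zero : s 0 = 0
  mono : Monotone s
  le : ∀ i ≤ n, s (i + 1) - s i ≤ TM
  ge : ∀ i, 1 ≤ i → i < n → Tm ≤ s (i + 1) - s i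
  mem : ∀ i ≤ n, ∀ t ∈ Icc (s i) (s (i + 1)), T i t ∈ SO3
  deriv : ∀ i ≤ n, ∀ t ∈ Icc (s i) (s (i + 1)),
    HasDerivWithinAt (T i) (T i t * skew (-η i t)) (Icc (s i) (s (i + 1))) t
  const : ∀ i ≤ n, ∀ t ∈ Icc (s i) (s (i + 1)), η i t = η i (s i)
  jump_T : ∀ i < n, T (i + 1) (s (i + 1)) = T i (s (i + 1))
  jump_η : ∀ i < n, η (i + 1) (s (i + 1)) = kR • psi (M * T i (s (i + 1)))

/-! ### The attitude error over one sampling interval -/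

section Interval

variable {M : Mat3} {a b lo hi ε kR TM : ℝ} {T : ℝ → Mat3} {η : E3}

/-- Rotations preserve the Frobenius norm, so the speed is that of η^×, at most 2‖η‖. -/
lemma norm_attitude_sub_le
    (hT : ∀ t ∈ Icc a b, T t ∈ SO3)
    (hd : ∀ t ∈ Icc a b, HasDerivWithinAt T (T t * skew (-η)) (Icc a b) t) (hab : a ≤ b) {t : ℝ}
    (ht : t ∈ Icc a b) : ‖T t - T a‖ ≤ 2 * ‖η‖ * (t - a) := by
  have := (convex_Icc a b).norm_image_sub_le_of_norm_hasDerivWithin_le (C := 2 * ‖η‖) hd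
    (fun r hr => by
      rw [norm_mul_of_mem_SO3 (hT r hr)]
      exact (norm_skew_le _).trans (by rw [norm_neg])) (left_mem_Icc.2 hab) ht
  rwa [Real.norm_of_nonneg (sub_nonneg.2 ht.1)] at this

lemma attNorm_nonneg (R : Mat3) : 0 ≤ attNorm R := Real.sqrt_nonneg _

lemma norm_one_sub {R : Mat3} (hR : R ∈ SO3) : ‖1 - R‖ = √8 * attNorm R := by
  rw [← Real.sqrt_sq (norm_nonneg (1 - R)), norm_one_sub_sq hR, Real.sqrt_mul (by norm_num),
    Real.sqrt_sq (attNorm_nonneg R)]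

lemma attNorm_le_add {R S : Mat3} (hR : R ∈ SO3) (hS : S ∈ SO3) {c : ℝ} (h : ‖R - S‖ ≤ 2 * c) :
    attNorm R ≤ attNorm S + c := by
  have h1 : ‖1 - R‖ ≤ ‖1 - S‖ + ‖R - S‖ := by
    have := norm_sub_le (1 - S) (R - S)
    rwa [sub_sub_sub_cancel_right] at this
  rw [norm_one_sub hR, norm_one_sub hS] at h1
  have h2 : (2 : ℝ) ≤ √8 := Real.le_sqrt_of_sq_le (by norm_num)
  have hc : 0 ≤ c := by linarith [norm_nonneg (R - S)]
  have h3 : √8 * attNorm R ≤ √8 * (attNorm S + c) := by nlinarith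
  exact le_of_mul_le_mul_left h3 (by linarith)

/-- ψ(M) = 0 for symmetric M, hence ψ(MR) = -ψ(M(1 - R)), and ‖1 - R‖ = √8 |R|_I. -/
lemma norm_psi_mul_le (hM : Mᵀ = M) {R : Mat3} (hR : R ∈ SO3) :
    ‖psi (M * R)‖ ^ 2 ≤ 8 * ‖M‖ ^ 2 * attNorm R ^ 2 := by
  have h0 : psi M = 0 := by
    have h := fun i j => congrFun (congrFun hM i) j
    simp only [Matrix.transpose_apply] at h
    ext i
    fin_cases i <;> simp [psi, h 0 1, h 0 2, h 1 2]
  have h1 : psi (M * R) = psi (M * R - M) := by rw [psi_sub, h0, sub_zero]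
  have h2 : M * R - M = -(M * (1 - R)) := by rw [Matrix.mul_sub, Matrix.mul_one]; abel
  have h3 : ‖psi (M * R)‖ ≤ ‖M‖ * ‖1 - R‖ := by
    rw [h1, h2]
    refine (norm_psi_le _).trans ?_
    rw [norm_neg]
    exact Matrix.frobenius_norm_mul _ _
  calc ‖psi (M * R)‖ ^ 2 ≤ (‖M‖ * ‖1 - R‖) ^ 2 := by gcongr
    _ = 8 * ‖M‖ ^ 2 * attNorm R ^ 2 := by rw [mul_pow, norm_one_sub_sq hR]; ring

lemma hasDerivWithinAt_potential (M : Mat3) {t : ℝ} {s : Set ℝ}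
    (hd : HasDerivWithinAt T (T t * skew (-η)) s t) :
    HasDerivWithinAt (fun t => potential M (T t)) (-2 * ((psi (M * T t)).ofLp ⬝ᵥ η.ofLp)) s t := by
  have h1 := hasDerivWithinAt_linear
    ({ toFun := fun A => (M * A).trace
       map_add' := fun A B => by rw [Matrix.mul_add, Matrix.trace_add]
       map_smul' := fun c A => by rw [Matrix.mul_smul, Matrix.trace_smul]; rfl } : Mat3 →ₗ[ℝ] ℝ) hd
  have h2 := h1.const_sub M.trace
  have h3 : (fun t => potential M (T t)) = fun t => M.trace - (M * T t).trace := by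
    funext t
    rw [potential, Matrix.mul_sub, Matrix.trace_sub, Matrix.mul_one]
  rw [h3]
  refine h2.congr_deriv ?_
  change -(M * (T t * skew (-η))).trace = _
  rw [skew_neg, Matrix.mul_neg, Matrix.mul_neg, Matrix.trace_neg, neg_neg, ← Matrix.mul_assoc,
    trace_mul_skew]

/-- Decrease of the potential over a sampling interval. -/
lemma potential_le_of_flow (h : AttitudeBounds M lo hi) (hab : a ≤ b) (hTM : b - a ≤ TM)
    (hkR : 0 ≤ kR) (hkR' : 4 * ‖M‖ * TM * kR ≤ 1)
    (hT : ∀ t ∈ Icc a b, T t ∈ SO3)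
    (hd : ∀ t ∈ Icc a b,
      HasDerivWithinAt T (T t * skew (-(kR • psi (M * T a)))) (Icc a b) t)
    (hε : potential M (T a) ≤ 4 * ε ^ 2 * lo) :
    potential M (T b) ≤ (1 - kR * (b - a) * (lo * (1 - ε ^ 2))) * potential M (T a) := by
  set ψ := psi (M * T a) with hψ
  have hTa := hT a (left_mem_Icc.2 hab)
  -- The derivative is -2k_R ψ(MT(t))·ψ. The gain bound keeps the drift of ψ(MT(t)) away from ψ at
  -- most ‖ψ‖/2, so half of the nominal decrease survives.
  have h1 := sub_le_of_hasDerivWithinAt_le hab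
    (fun t ht => hasDerivWithinAt_potential M (hd t ht)) (K := -kR * ‖ψ‖ ^ 2) fun t ht => by
      have e1 : (psi (M * T t)).ofLp ⬝ᵥ (kR • ψ).ofLp
          = kR * ‖ψ‖ ^ 2 + kR * ((psi (M * (T t - T a))).ofLp ⬝ᵥ ψ.ofLp) := by
        rw [Matrix.mul_sub, psi_sub, norm_sq_eq_dotProduct]
        simp only [WithLp.ofLp_sub, sub_dotProduct, WithLp.ofLp_smul, dotProduct_smul, smul_eq_mul]
        ring
      have e2 : ‖psi (M * (T t - T a))‖ ≤ ‖M‖ * (2 * (kR * ‖ψ‖) * TM) := by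
        refine (norm_psi_le _).trans ((Matrix.frobenius_norm_mul _ _).trans ?_)
        have := norm_attitude_sub_le hT hd hab ht
        rw [norm_smul, Real.norm_of_nonneg hkR] at this
        refine mul_le_mul_of_nonneg_left (this.trans ?_) (norm_nonneg M)
        have : t - a ≤ TM := by linarith [ht.2]
        gcongr
      have e3 : -((psi (M * (T t - T a))).ofLp ⬝ᵥ ψ.ofLp) ≤ ‖psi (M * (T t - T a))‖ * ‖ψ‖ := by
        have e4 := dotProduct_sq_le (psi (M * (T t - T a))).ofLp ψ.ofLp
        rw [← norm_sq_eq_dotProduct, ← norm_sq_eq_dotProduct, ← mul_pow] at e4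
        have := (abs_le_of_sq_le_sq' e4 (by positivity)).1
        linarith
      have e5 : ‖psi (M * (T t - T a))‖ * ‖ψ‖ ≤ ‖M‖ * (2 * (kR * ‖ψ‖) * TM) * ‖ψ‖ := by gcongr
      have e6 : ‖M‖ * (2 * (kR * ‖ψ‖) * TM) * ‖ψ‖ ≤ 1 / 2 * ‖ψ‖ ^ 2 := by
        have : ‖M‖ * (2 * (kR * ‖ψ‖) * TM) * ‖ψ‖ = 4 * ‖M‖ * TM * kR * (1 / 2 * ‖ψ‖ ^ 2) := by ring
        rw [this]
        exact mul_le_of_le_one_left (by positivity) hkR'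
      rw [e1]
      nlinarith [mul_le_mul_of_nonneg_left (e3.trans (e5.trans e6)) hkR]
  have h2 := h.mul_potential_le hTa
  have h3 : 0 ≤ potential M (T a) :=
    le_trans (by have := h.pos; positivity) (h.mul_attNorm_le hTa)
  have h4 : potential M (T a) * (lo * (1 - ε ^ 2)) ≤ ‖ψ‖ ^ 2 := by
    refine le_trans (mul_le_mul_of_nonneg_left ?_ h3) h2
    linarith
  have h5 : 0 ≤ kR * (b - a) := mul_nonneg hkR (by linarith)
  nlinarith [mul_le_mul_of_nonneg_left h4 h5]

end Interval

lemma AttitudeBounds.potential_nonneg {M R : Mat3} {lo hi : ℝ} (h : AttitudeBounds M lo hi)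
    (hR : R ∈ SO3) : 0 ≤ potential M R :=
  le_trans (by have := h.pos; positivity) (h.mul_attNorm_le hR)

set_option maxHeartbeats 1000000 in
/-- Local exponential stability of the attitude subsystem, uniformly over its runs. -/
lemma AttitudeBounds.exists_attitude_le {M : Mat3} {lo hi : ℝ} (h : AttitudeBounds M lo hi)
    {Tm TM : ℝ} (hTm : 0 < Tm) (hTM : Tm ≤ TM) {ε : ℝ} (hε : 0 < ε) (hε1 : ε < 1) :
    ∃ ηStar > 0, ∃ kRStar > 0, ∀ kR, 0 < kR → kR < kRStar →
      ∃ K ≥ 0, ∃ γ, 0 < γ ∧ γ < 1 ∧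
        ∀ (n : ℕ) (s : ℕ → ℝ) (T : ℕ → ℝ → Mat3) (η : ℕ → ℝ → E3),
        AttitudeRun M kR Tm TM n s T η → attNorm (T 0 0) ≤ ε * √(lo / hi) → ‖η 0 0‖ ≤ ηStar →
        ∀ i ≤ n, ∀ t ∈ Icc (s i) (s (i + 1)),
          attNorm (T i t) ^ 2 + ‖η i t‖ ^ 2 ≤ K * γ ^ i * (attNorm (T 0 0) ^ 2 + ‖η 0 0‖ ^ 2) := by
  have hTM0 : 0 < TM := hTm.trans_le hTM
  have hlo := h.pos
  have hhi : 0 < hi := hlo.trans_le h.le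
  -- A margin between ε and 1: ηStar is chosen so that the first interval, in which |R̃|_I grows by
  -- at most T_M ‖η‖, cannot leave the region of radius ε'√(lo/hi).
  set ε' := (1 + ε) / 2 with hε'
  have hε'1 : ε' < 1 := by rw [hε']; linarith
  have hε'0 : 0 < ε' := by positivity
  have hεε' : 0 < ε' - ε := by rw [hε']; linarith
  have hr0 : 0 < √(lo / hi) := Real.sqrt_pos.2 (by positivity)
  set ηStar := (ε' - ε) * √(lo / hi) / TM with hηStar
  -- The first bound on the gain gives 4‖M‖T_M k_R ≤ 1, the summand 1 keeping the denominator
  -- positive; the second gives k_R lo T_M < 1 and hence γ > 0.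
  refine ⟨ηStar, by positivity, min (1 / (4 * (‖M‖ + 1) * TM)) (1 / (lo * TM)), by positivity, ?_⟩
  intro kR hkR hkR'
  obtain ⟨hk1, hk2⟩ := lt_min_iff.1 hkR'
  rw [lt_div_iff₀ (by positivity)] at hk1 hk2
  have hk3 : 4 * ‖M‖ * TM * kR ≤ 1 := by
    have : 0 ≤ 4 * TM * kR := by positivity
    linarith
  have hε'2 : 0 < 1 - ε' ^ 2 := by nlinarith
  set σ := lo * (1 - ε' ^ 2) with hσ
  have hσ0 : 0 < σ := by positivity
  have hσlo : σ ≤ lo := by rw [hσ]; nlinarith [sq_nonneg ε']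
  set γ := 1 - kR * Tm * σ with hγ
  have hγ0 : 0 < γ := by
    have : kR * Tm * σ ≤ kR * TM * lo := by gcongr
    rw [hγ]; linarith
  have hγ1 : γ < 1 := by
    have : 0 < kR * Tm * σ := by positivity
    rw [hγ]; linarith
  set K₀ := 4 * hi * (2 + 2 * TM ^ 2) with hK₀
  have hK₀0 : 0 < K₀ := by positivity
  -- 3 + 2T_M² serves the first interval: 2 + 2T_M² for the attitude and 1 for η. The other summand
  -- serves later ones; contraction starts only after the first jump, whence the division by γ.
  refine ⟨(3 + 2 * TM ^ 2) + (1 + 8 * kR ^ 2 * ‖M‖ ^ 2) * (K₀ / (4 * lo)) / γ, by positivity, γ, hγ0,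
    hγ1, ?_⟩
  intro n s T η hr hT0 hη0 
  set ρ := attNorm (T 0 0) ^ 2 + ‖η 0 0‖ ^ 2 with hρ
  have hρ0 : 0 ≤ ρ := by positivity
  have hint : ∀ i ≤ n, s i ∈ Icc (s i) (s (i + 1)) := fun i _ =>
    left_mem_Icc.2 (hr.mono (Nat.le_succ i))
  have hint' : ∀ i ≤ n, s (i + 1) ∈ Icc (s i) (s (i + 1)) := fun i _ =>
    right_mem_Icc.2 (hr.mono (Nat.le_succ i))
  have hderiv : ∀ i ≤ n, ∀ t ∈ Icc (s i) (s (i + 1)),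
      HasDerivWithinAt (T i) (T i t * skew (-η i (s i))) (Icc (s i) (s (i + 1))) t := by
    intro i hi t ht
    have := hr.deriv i hi t ht
    rwa [hr.const i hi t ht] at this
  -- the first interval
  have hfirst : ∀ t ∈ Icc (s 0) (s 1), attNorm (T 0 t) ≤ attNorm (T 0 0) + TM * ‖η 0 0‖ := by
    intro t ht
    have h1 := norm_attitude_sub_le (hr.mem 0 (Nat.zero_le n)) (hderiv 0 (Nat.zero_le n))
      (hr.mono zero_le_one) ht
    have h2 := hr.le 0 (Nat.zero_le n)
    rw [hr.zero] at h1 h2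
    refine attNorm_le_add (hr.mem 0 (Nat.zero_le n) t ht)
      (by simpa [hr.zero] using hr.mem 0 (Nat.zero_le n) _ (hint 0 (Nat.zero_le n))) (h1.trans ?_)
    have : t - 0 ≤ TM := by linarith [ht.2]
    calc 2 * ‖η 0 0‖ * (t - 0) ≤ 2 * ‖η 0 0‖ * TM := by gcongr
      _ = 2 * (TM * ‖η 0 0‖) := by ring
  have hfirst_sq : ∀ t ∈ Icc (s 0) (s 1), attNorm (T 0 t) ^ 2 ≤ (2 + 2 * TM ^ 2) * ρ := by
    intro t ht
    have h1 := hfirst t ht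
    have h2 := attNorm_nonneg (T 0 t)
    calc attNorm (T 0 t) ^ 2 ≤ (attNorm (T 0 0) + TM * ‖η 0 0‖) ^ 2 := by gcongr
      _ ≤ (2 + 2 * TM ^ 2) * ρ := by
        rw [hρ]
        nlinarith [sq_nonneg (attNorm (T 0 0) - TM * ‖η 0 0‖), sq_nonneg (TM * attNorm (T 0 0)),
          sq_nonneg ‖η 0 0‖]
  have hfirst_region : ∀ t ∈ Icc (s 0) (s 1), potential M (T 0 t) ≤ 4 * ε' ^ 2 * lo := by
    intro t ht
    refine (h.potential_le (hr.mem 0 (Nat.zero_le n) t ht)).trans ?_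
    have h1 : attNorm (T 0 t) ≤ ε' * √(lo / hi) := by
      refine (hfirst t ht).trans ?_
      have : TM * ‖η 0 0‖ ≤ TM * ηStar := by gcongr
      have e : TM * ηStar = (ε' - ε) * √(lo / hi) := by rw [hηStar]; field_simp
      linarith
    have h2 := attNorm_nonneg (T 0 t)
    calc 4 * hi * attNorm (T 0 t) ^ 2 ≤ 4 * hi * (ε' * √(lo / hi)) ^ 2 := by gcongr
      _ = 4 * ε' ^ 2 * lo := by
        rw [mul_pow, Real.sq_sqrt (by positivity)]; field_simp
  -- the later intervals
  have hstep : ∀ i, i + 1 ≤ n → ∀ t ∈ Icc (s (i + 1)) (s (i + 1 + 1)),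
      potential M (T (i + 1) (s (i + 1))) ≤ 4 * ε' ^ 2 * lo →
      potential M (T (i + 1) t) ≤ (1 - kR * (t - s (i + 1)) * σ)
        * potential M (T (i + 1) (s (i + 1))) := by
    intro i hi t ht hreg
    refine potential_le_of_flow h ht.1 (by linarith [hr.le (i + 1) hi, ht.2]) hkR.le hk3
      (fun r hr' => hr.mem (i + 1) hi r ⟨hr'.1, hr'.2.trans ht.2⟩) (fun r hr' => ?_) hreg
    have := hderiv (i + 1) hi r ⟨hr'.1, hr'.2.trans ht.2⟩
    rw [hr.jump_η i (by omega), ← hr.jump_T i (by omega)] at this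
    exact this.mono (Icc_subset_Icc_right ht.2)
  have hstep' : ∀ i, i + 1 ≤ n → ∀ t ∈ Icc (s (i + 1)) (s (i + 1 + 1)),
      potential M (T (i + 1) (s (i + 1))) ≤ 4 * ε' ^ 2 * lo →
      potential M (T (i + 1) t) ≤ potential M (T (i + 1) (s (i + 1))) := by
    intro i hi t ht hreg
    refine (hstep i hi t ht hreg).trans ?_
    have h1 := h.potential_nonneg (hr.mem (i + 1) hi _ (hint _ hi))
    have h2 : 0 ≤ kR * (t - s (i + 1)) * σ := by
      have : 0 ≤ t - s (i + 1) := by linarith [ht.1]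
      positivity
    nlinarith
  have hmain : ∀ i, i + 1 ≤ n → potential M (T (i + 1) (s (i + 1))) ≤ 4 * ε' ^ 2 * lo ∧
      potential M (T (i + 1) (s (i + 1))) ≤ K₀ * ρ * γ ^ i := by
    intro i
    induction i with
    | zero =>
      intro hn
      have hm := hint' 0 (Nat.zero_le n)
      rw [hr.jump_T 0 (by omega)]
      refine ⟨hfirst_region _ hm, (h.potential_le (hr.mem 0 (Nat.zero_le n) _ hm)).trans ?_⟩
      rw [pow_zero, mul_one, hK₀, mul_assoc (4 * hi)]
      exact mul_le_mul_of_nonneg_left (hfirst_sq _ hm) (by positivity)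
    | succ i ih =>
      intro hn
      obtain ⟨h1, h2⟩ := ih (by omega)
      have hm := hint' (i + 1) (by omega)
      rw [hr.jump_T (i + 1) (by omega)]
      refine ⟨(hstep' i (by omega) _ hm h1).trans h1, (hstep i (by omega) _ hm h1).trans ?_⟩
      have h3 := hr.ge (i + 1) (by omega) (by omega)
      have h4 := h.potential_nonneg (hr.mem (i + 1) (by omega) _ (hint _ (by omega)))
      calc (1 - kR * (s (i + 1 + 1) - s (i + 1)) * σ) * potential M (T (i + 1) (s (i + 1)))
          ≤ γ * potential M (T (i + 1) (s (i + 1))) := by rw [hγ]; gcongr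
        _ ≤ γ * (K₀ * ρ * γ ^ i) := by gcongr
        _ = K₀ * ρ * γ ^ (i + 1) := by ring
  intro i hi t ht
  rcases i with _ | i
  · rw [pow_zero, mul_one, hr.const 0 hi t ht, hr.zero]
    have h1 := hfirst_sq t ht
    have h2 : ‖η 0 0‖ ^ 2 ≤ ρ := by rw [hρ]; nlinarith [sq_nonneg (attNorm (T 0 0))]
    have h3 : 0 ≤ (1 + 8 * kR ^ 2 * ‖M‖ ^ 2) * (K₀ / (4 * lo)) / γ * ρ := by positivity
    nlinarith
  · obtain ⟨h1, h2⟩ := hmain i hi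
    have hatt : ∀ t ∈ Icc (s (i + 1)) (s (i + 1 + 1)),
        attNorm (T (i + 1) t) ^ 2 ≤ K₀ / (4 * lo) * (γ ^ i * ρ) := by
      intro t ht
      have h3 := h.mul_attNorm_le (hr.mem (i + 1) hi t ht)
      have h4 := hstep' i hi t ht h1
      rw [div_mul_eq_mul_div, le_div_iff₀ (by positivity)]
      linarith
    have hη : ‖η (i + 1) t‖ ^ 2 ≤ 8 * kR ^ 2 * ‖M‖ ^ 2 * (K₀ / (4 * lo) * (γ ^ i * ρ)) := by
      rw [hr.const (i + 1) hi t ht, hr.jump_η i (by omega), ← hr.jump_T i (by omega), norm_smul,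
        mul_pow, Real.norm_of_nonneg hkR.le]
      have h3 := norm_psi_mul_le h.symm (hr.mem (i + 1) hi _ (hint _ hi))
      have h4 := hatt _ (hint _ hi)
      calc kR ^ 2 * ‖psi (M * T (i + 1) (s (i + 1)))‖ ^ 2
          ≤ kR ^ 2 * (8 * ‖M‖ ^ 2 * attNorm (T (i + 1) (s (i + 1))) ^ 2) := by gcongr
        _ ≤ kR ^ 2 * (8 * ‖M‖ ^ 2 * (K₀ / (4 * lo) * (γ ^ i * ρ))) := by gcongr
        _ = _ := by ring
    have h3 : (1 + 8 * kR ^ 2 * ‖M‖ ^ 2) * (K₀ / (4 * lo)) / γ * γ ^ (i + 1) * ρ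
        = (1 + 8 * kR ^ 2 * ‖M‖ ^ 2) * (K₀ / (4 * lo) * (γ ^ i * ρ)) := by
      have e : ∀ c : ℝ, c / γ * γ ^ (i + 1) * ρ = c * (γ ^ i * ρ) := fun c => by
        rw [pow_succ γ i]; field_simp
      rw [e, mul_assoc]
    have h4 : 0 ≤ (3 + 2 * TM ^ 2) * γ ^ (i + 1) * ρ := by positivity
    rw [add_mul, add_mul, h3]
    linarith [hatt t ht]

/-! ### Classical solutions of the flow equations -/

section Primitive

variable {E : Type*} [NormedAddCommGroup E] [NormedSpace ℝ E]

lemma exists_primitive [CompleteSpace E] {F : ℝ → E} {a b : ℝ} (hab : a ≤ b)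
    (hF : ContinuousOn F (Icc a b)) :
    ∃ G : ℝ → E, G a = 0 ∧ ∀ t ∈ Icc a b, HasDerivWithinAt G (F t) (Icc a b) t := by
  have hcont : Continuous (IccExtend hab ((Icc a b).domRestrict F)) :=
    (continuousOn_iff_continuous_domRestrict.1 hF).Icc_extend'
  refine ⟨fun t => ∫ s in a..t, IccExtend hab ((Icc a b).domRestrict F) s, by simp, ?_⟩
  intro t ht
  have h1 : IccExtend hab ((Icc a b).domRestrict F) t = F t := by
    rw [IccExtend_of_mem hab _ ht]; rfl
  have h2 := intervalIntegral.integral_hasDerivAt_right (hcont.intervalIntegrable a t)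
      (hcont.stronglyMeasurableAtFilter _ _) hcont.continuousAt
  rw [h1] at h2
  exact h2.hasDerivWithinAt

lemma hasDerivWithinAt_fst {F : Type*} [NormedAddCommGroup F] [NormedSpace ℝ F] {f : ℝ → E × F}
    {f' : E × F} {s : Set ℝ} {t : ℝ} (h : HasDerivWithinAt f f' s t) :
    HasDerivWithinAt (fun t => (f t).1) f'.1 s t :=
  (ContinuousLinearMap.fst ℝ E F).hasFDerivAt.comp_hasDerivWithinAt t h

lemma hasDerivWithinAt_snd {F : Type*} [NormedAddCommGroup F] [NormedSpace ℝ F] {f : ℝ → E × F}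
    {f' : E × F} {s : Set ℝ} {t : ℝ} (h : HasDerivWithinAt f f' s t) :
    HasDerivWithinAt (fun t => (f t).2) f'.2 s t :=
  (ContinuousLinearMap.snd ℝ E F).hasFDerivAt.comp_hasDerivWithinAt t h

lemma eq_zero_of_norm_deriv_le {f f' : ℝ → E} {a b K : ℝ}
    (hf : ∀ t ∈ Icc a b, HasDerivWithinAt f (f' t) (Icc a b) t)
    (hK : ∀ t ∈ Icc a b, ‖f' t‖ ≤ K * ‖f t‖) (ha : f a = 0) : ∀ t ∈ Icc a b, f t = 0 :=
  eq_zero_of_abs_deriv_le_mul_abs_self_of_eq_zero_right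
    (fun t ht => (hf t ht).continuousWithinAt)
    (fun t ht => ((hf t (Ico_subset_Icc_self ht)).mono_of_mem_nhdsWithin
      (Icc_mem_nhdsGE_of_mem ht))) ha fun t ht => hK t (Ico_subset_Icc_self ht)

end Primitive

/-- `ψ` is a classical solution of the flow equation of `H` on `[a, b]`. -/
def HybridSystem.SolvesFlow {X : Type*} [NormedAddCommGroup X] [NormedSpace ℝ X]
    (H : HybridSystem X) (a b : ℝ) (ψ : ℝ → X) : Prop :=
  ∀ t ∈ Icc a b, HasDerivWithinAt ψ (H.flowMap t (ψ t)) (Icc a b) t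

lemma HybridSystem.SolvesFlow.mono {X : Type*} [NormedAddCommGroup X] [NormedSpace ℝ X]
    {H : HybridSystem X} {a b c : ℝ} {ψ : ℝ → X} (h : H.SolvesFlow a b ψ) (hc : c ≤ b) :
    H.SolvesFlow a c ψ :=
  fun t ht => (h t ⟨ht.1, ht.2.trans hc⟩).mono (Icc_subset_Icc_right hc)

/-- The regularity of the coefficients of the flow equation. -/
structure FlowData (ω : ℝ → E3) (R : ℝ → Mat3) (V : ℝ → Mat6) : Prop where
  mem : ∀ t ≥ 0, R t ∈ SO3
  deriv : ∀ t ≥ 0, HasDerivWithinAt R (R t * skew (ω t)) (Ici 0) t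
  ω_cont : ContinuousOn ω (Ici 0)
  V_cont : ContinuousOn V (Ici 0)

lemma continuousOn_skew {u : ℝ → E3} {s : Set ℝ} (hu : ContinuousOn u s) :
    ContinuousOn (fun t => skew (u t)) s :=
  continuousOn_linear
    ({ toFun := skew
       map_add' := fun A B => by
        ext i j; fin_cases i <;> fin_cases j <;> simp [skew] <;> ring
       map_smul' := fun c A => by
        ext i j; fin_cases i <;> fin_cases j <;> simp [skew] } : E3 →ₗ[ℝ] Mat3) hu

lemma continuousOn_blockRot {u : ℝ → Mat3} {s : Set ℝ} (hu : ContinuousOn u s) :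
    ContinuousOn (fun t => blockRot (u t)) s :=
  continuousOn_linear
      ({ toFun := blockRot
         map_add' := fun A B => by simp [blockRot, Matrix.fromBlocks_add]
         map_smul' := fun c A => by simp [blockRot, Matrix.fromBlocks_smul] } : Mat3 →ₗ[ℝ] Mat6) hu

lemma continuousOn_matA {u : ℝ → E3} {s : Set ℝ} (hu : ContinuousOn u s) :
    ContinuousOn (fun t => matA (u t)) s := by
  simp only [matA_eq]
  exact continuousOn_const.sub (continuousOn_blockRot (continuousOn_skew hu))

lemma continuousOn_gravTerm (g : E3) {R T : ℝ → Mat3} {s : Set ℝ} (hR : ContinuousOn R s)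
    (hT : ContinuousOn T s) : ContinuousOn (fun t => gravTerm g (R t) (T t)) s :=
  continuousOn_linear
    ({ toFun := fun A => WithLp.toLp 2 (Sum.elim 0 (Aᵀ *ᵥ g.ofLp))
       map_add' := fun A B => by
        ext (i | i) <;> simp [Matrix.add_mulVec]
       map_smul' := fun c A => by
        ext (i | i) <;> simp [Matrix.smul_mulVec] } : Mat3 →ₗ[ℝ] E6)
    (hR.sub (continuousOn_matrix_mul (continuousOn_matrix_transpose hT) hR))

lemma norm_toLp_mulVec_le {m n : Type*} [Fintype m] [Fintype n] (A : Matrix m n ℝ)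
    (v : EuclideanSpace ℝ n) :
    ‖(WithLp.toLp 2 (A *ᵥ v.ofLp) : EuclideanSpace ℝ m)‖ ≤ ‖A‖ * ‖v‖ := by
  refine abs_le_of_sq_le_sq' ?_ (by positivity) |>.2
  rw [mul_pow, norm_sq_eq_dotProduct, norm_sq_eq_dotProduct]
  exact mulVec_dotProduct_le A v.ofLp

lemma SO3_transpose {R : Mat3} (hR : R ∈ SO3) : Rᵀ ∈ SO3 :=
  ⟨by simpa using hR.2.1, by simpa using hR.1, by simpa using hR.2.2⟩

/-- (R - R̃ᵀR)ᵀ = Rᵀ(1 - R̃), whose norm is √8 |R̃|_I. This is the coupling in the cascade. -/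
lemma norm_gravTerm_sq_le (g : E3) {R T : Mat3} (hR : R ∈ SO3) (hT : T ∈ SO3) :
    ‖gravTerm g R T‖ ^ 2 ≤ 8 * ‖g‖ ^ 2 * attNorm T ^ 2 := by
  have h1 : ‖gravTerm g R T‖ ^ 2 = ((R - Tᵀ * R)ᵀ *ᵥ g.ofLp) ⬝ᵥ ((R - Tᵀ * R)ᵀ *ᵥ g.ofLp) := by
    rw [norm_sq_eq_dotProduct, gravTerm]
    simp [dotProduct, Fintype.sum_sum_type]
  have h2 : (R - Tᵀ * R)ᵀ = Rᵀ * (1 - T) := by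
    rw [Matrix.transpose_sub, Matrix.transpose_mul, Matrix.transpose_transpose, Matrix.mul_sub,
      Matrix.mul_one]
  rw [h1]
  refine (mulVec_dotProduct_le _ _).trans (le_of_eq ?_)
  rw [h2, norm_mul_of_mem_SO3 (SO3_transpose hR), norm_one_sub_sq hT, ← norm_sq_eq_dotProduct]
  ring

/-! ### Flow of the closed loop: regularity, invariance, uniqueness -/

section ClosedLoop

variable {M : Mat3} {g : E3} {kR Tm TM : ℝ} {ω : ℝ → E3} {R : ℝ → Mat3} {V : ℝ → Mat6}
  {Q : ℝ → Mat3} {a b : ℝ} {ψ ψ' : ℝ → ExtState}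

lemma closedLoop_flowMap (t : ℝ) (ξ : ExtState) :
    (closedLoop M g kR Tm TM ω R V Q).flowMap t ξ = ((ξ.1.1 * skew (-ξ.1.2.1), 0,
      WithLp.toLp 2 (matA (ω t) *ᵥ ξ.1.2.2.1.ofLp) + gravTerm g (R t) ξ.1.1, -1),
      matA (ω t) * ξ.2 + ξ.2 * (matA (ω t))ᵀ + V t) := rfl

lemma FlowData.R_cont (hD : FlowData ω R V) : ContinuousOn R (Ici 0) :=
  fun t ht => (hD.deriv t ht).continuousWithinAt

lemma closedLoop_flowMap_continuousOn (hD : FlowData ω R V) (ha : 0 ≤ a)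
    (hψ : ContinuousOn ψ (Icc a b)) :
    ContinuousOn (fun t => (closedLoop M g kR Tm TM ω R V Q).flowMap t (ψ t)) (Icc a b) := by
  have hsub : Icc a b ⊆ Ici 0 := fun t ht => ha.trans ht.1
  have hT : ContinuousOn (fun t => (ψ t).1.1) (Icc a b) := hψ.fst.fst
  have hη : ContinuousOn (fun t => (ψ t).1.2.1) (Icc a b) := hψ.fst.snd.fst
  have hx : ContinuousOn (fun t => (ψ t).1.2.2.1) (Icc a b) := hψ.fst.snd.snd.fst
  have hP : ContinuousOn (fun t => (ψ t).2) (Icc a b) := hψ.snd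
  have hA := continuousOn_matA (hD.ω_cont.mono hsub)
  simp only [closedLoop_flowMap]
  refine ContinuousOn.prodMk (ContinuousOn.prodMk ?_ (ContinuousOn.prodMk continuousOn_const
    (ContinuousOn.prodMk ?_ continuousOn_const))) ?_
  · exact continuousOn_matrix_mul hT (continuousOn_skew hη.neg)
  · exact (continuousOn_mulVec hA hx).add (continuousOn_gravTerm g (hD.R_cont.mono hsub) hT)
  · exact ((continuousOn_matrix_mul hA hP).add
      (continuousOn_matrix_mul hP (continuousOn_matrix_transpose hA))).add (hD.V_cont.mono hsub)

namespace SolvesFlow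

lemma T_deriv (h : (closedLoop M g kR Tm TM ω R V Q).SolvesFlow a b ψ) {t : ℝ}
    (ht : t ∈ Icc a b) :
    HasDerivWithinAt (fun t => (ψ t).1.1) ((ψ t).1.1 * skew (-(ψ t).1.2.1)) (Icc a b) t :=
  hasDerivWithinAt_fst (hasDerivWithinAt_fst (h t ht))

lemma η_deriv (h : (closedLoop M g kR Tm TM ω R V Q).SolvesFlow a b ψ) {t : ℝ}
    (ht : t ∈ Icc a b) : HasDerivWithinAt (fun t => (ψ t).1.2.1) 0 (Icc a b) t :=
  hasDerivWithinAt_fst (hasDerivWithinAt_snd (hasDerivWithinAt_fst (h t ht)))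

lemma τ_deriv (h : (closedLoop M g kR Tm TM ω R V Q).SolvesFlow a b ψ) {t : ℝ}
    (ht : t ∈ Icc a b) : HasDerivWithinAt (fun t => (ψ t).1.2.2.2) (-1) (Icc a b) t :=
  hasDerivWithinAt_snd (hasDerivWithinAt_snd (hasDerivWithinAt_snd (hasDerivWithinAt_fst (h t ht))))

lemma riccatiFlow (h : (closedLoop M g kR Tm TM ω R V Q).SolvesFlow a b ψ) :
    RiccatiFlow ω V (fun t => gravTerm g (R t) (ψ t).1.1) a b (fun t => (ψ t).2)
      (fun t => (ψ t).1.2.2.1) :=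
  ⟨fun t ht => hasDerivWithinAt_snd (h t ht), fun t ht => hasDerivWithinAt_fst
    (hasDerivWithinAt_snd (hasDerivWithinAt_snd (hasDerivWithinAt_fst (h t ht))))⟩

lemma η_eq (h : (closedLoop M g kR Tm TM ω R V Q).SolvesFlow a b ψ) {t : ℝ} (ht : t ∈ Icc a b) :
    (ψ t).1.2.1 = (ψ a).1.2.1 :=
  eq_of_hasDerivWithinAt_zero (fun _ hr => η_deriv h hr) t ht

lemma τ_eq (h : (closedLoop M g kR Tm TM ω R V Q).SolvesFlow a b ψ) {t : ℝ} (ht : t ∈ Icc a b) :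
    (ψ t).1.2.2.2 = (ψ a).1.2.2.2 - (t - a) := by
  have := eq_of_hasDerivWithinAt_zero (f := fun t => (ψ t).1.2.2.2 + t) (fun r hr =>
    ((τ_deriv h hr).add (hasDerivWithinAt_id r _)).congr_deriv (by simp)) t ht
  linarith

/-- TTᵀ is constant because η^× is skew-symmetric; then det T is continuous with values ±1 on an
interval and starts at 1. -/
lemma T_mem (h : (closedLoop M g kR Tm TM ω R V Q).SolvesFlow a b ψ) (ha : (ψ a).1.1 ∈ SO3) {t : ℝ}
    (ht : t ∈ Icc a b) : (ψ t).1.1 ∈ SO3 := by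
  have h1 : ∀ r ∈ Icc a b, (ψ r).1.1 * ((ψ r).1.1)ᵀ = 1 := by
    intro r hr
    rw [← ha.1]
    refine eq_of_hasDerivWithinAt_zero (f := fun r => (ψ r).1.1 * ((ψ r).1.1)ᵀ)
      (fun r hr => ?_) r hr
    refine (hasDerivWithinAt_matrix_mul (T_deriv h hr)
      (hasDerivWithinAt_matrix_transpose (T_deriv h hr))).congr_deriv ?_
    rw [Matrix.transpose_mul, skew_transpose, Matrix.neg_mul, Matrix.mul_neg, Matrix.mul_assoc,
      add_neg_cancel]
  have h2 : ContinuousOn (fun r => ((ψ r).1.1).det) (Icc a b) := by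
    have h3 : Continuous fun A : Mat3 => A.det := by fun_prop
    exact h3.comp_continuousOn (fun r hr => (T_deriv h hr).continuousWithinAt)
  refine ⟨h1 t ht, mul_eq_one_comm.1 (h1 t ht), ?_⟩
  rcases isPreconnected_Icc.eq_one_or_eq_neg_one_of_sq_eq h2 (fun r hr => by
    have := congrArg Matrix.det (h1 r hr)
    rw [Matrix.det_mul, Matrix.det_transpose, Matrix.det_one] at this
    simpa [sq] using this) with h3 | h3
  · exact h3 ht
  · have h4 := h3 (left_mem_Icc.2 (ht.1.trans ht.2))
    simp only [ha.2.2, Pi.neg_apply, Pi.one_apply] at h4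
    norm_num at h4

/-- Uniqueness for the flow equations. -/
lemma unique (hD : FlowData ω R V) (ha : 0 ≤ a) (h : (closedLoop M g kR Tm TM ω R V Q).SolvesFlow a b ψ)
    (h' : (closedLoop M g kR Tm TM ω R V Q).SolvesFlow a b ψ') (h0 : ψ a = ψ' a) {t : ℝ} (ht : t ∈ Icc a b) :
    ψ t = ψ' t := by
  have hη : ∀ r ∈ Icc a b, (ψ r).1.2.1 = (ψ' r).1.2.1 := fun r hr => by
    rw [η_eq h hr, η_eq h' hr, h0]
  have hτ : (ψ t).1.2.2.2 = (ψ' t).1.2.2.2 := by rw [τ_eq h ht, τ_eq h' ht, h0]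
  -- The cascade is followed: η and τ are explicit, then R̃ solves a linear equation, then the
  -- differences of x and of P do. Each difference vanishes by Grönwall.
  obtain ⟨C, hC⟩ := isCompact_Icc.exists_bound_of_continuousOn
    (continuousOn_matA (hD.ω_cont.mono fun r (hr : r ∈ Icc a b) => ha.trans hr.1))
  have hT : ∀ r ∈ Icc a b, (ψ r).1.1 = (ψ' r).1.1 := fun r hr => by
    refine sub_eq_zero.1 (eq_zero_of_norm_deriv_le (f := fun r => (ψ r).1.1 - (ψ' r).1.1)
      (K := ‖skew (-(ψ a).1.2.1)‖) (fun r hr => (T_deriv h hr).sub (T_deriv h' hr))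
      (fun r hr => ?_) (by simp [h0]) r hr)
    rw [← hη r hr, η_eq h hr, ← Matrix.sub_mul, mul_comm]
    exact Matrix.frobenius_norm_mul _ _
  have hf := riccatiFlow h
  have hf' := riccatiFlow h'
  have hx : (ψ t).1.2.2.1 = (ψ' t).1.2.2.1 := by
    refine sub_eq_zero.1 (eq_zero_of_norm_deriv_le
      (f := fun r => (ψ r).1.2.2.1 - (ψ' r).1.2.2.1)
      (K := C) (fun r hr => (hf.x_deriv r hr).sub (hf'.x_deriv r hr))
      (fun r hr => ?_) (by simp [h0]) t ht)
    rw [hT r hr, add_sub_add_right_eq_sub, ← WithLp.toLp_sub, ← Matrix.mulVec_sub,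
      ← WithLp.ofLp_sub]
    exact (norm_toLp_mulVec_le _ _).trans (mul_le_mul_of_nonneg_right (hC r hr) (norm_nonneg _))
  have hP : (ψ t).2 = (ψ' t).2 := by
    refine sub_eq_zero.1 (eq_zero_of_norm_deriv_le
      (f := fun r => (ψ r).2 - (ψ' r).2)
      (K := C + C) (fun r hr => (hf.P_deriv r hr).sub (hf'.P_deriv r hr))
      (fun r hr => ?_) (by simp [h0]) t ht)
    have e : matA (ω r) * (ψ r).2 + (ψ r).2 * (matA (ω r))ᵀ + V r
        - (matA (ω r) * (ψ' r).2 + (ψ' r).2 * (matA (ω r))ᵀ + V r)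
        = matA (ω r) * ((ψ r).2 - (ψ' r).2) + ((ψ r).2 - (ψ' r).2) * (matA (ω r))ᵀ := by
      rw [Matrix.mul_sub, Matrix.sub_mul]; abel
    rw [e]
    have e1 := Matrix.frobenius_norm_mul (matA (ω r)) ((ψ r).2 - (ψ' r).2)
    have e2 := Matrix.frobenius_norm_mul ((ψ r).2 - (ψ' r).2) (matA (ω r))ᵀ
    rw [Matrix.frobenius_norm_transpose] at e2
    have e3 := mul_le_mul_of_nonneg_right (hC r hr) (norm_nonneg ((ψ r).2 - (ψ' r).2))
    refine (norm_add_le _ _).trans ?_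
    linarith
  exact Prod.ext (Prod.ext (hT t ht) (Prod.ext (hη t ht) (Prod.ext hx hτ))) hP

end SolvesFlow

end ClosedLoop

/-! ### Existence for the flow equations -/

lemma exists_linear_flow {A : Type*} [NormedRing A] [NormedAlgebra ℝ A] [CompleteSpace A]
    (T₀ S : A) (a : ℝ) : ∃ T : ℝ → A, T a = T₀ ∧ ∀ t, HasDerivAt T (T t * S) t := by
  refine ⟨fun t => T₀ * NormedSpace.exp ((t - a) • S), by simp, fun t => ?_⟩
  have h1 := (hasDerivAt_exp_smul_const (𝕂 := ℝ) S (t - a)).scomp t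
    ((hasDerivAt_id t).sub_const a)
  rw [one_smul] at h1
  rw [mul_assoc]
  exact h1.const_mul T₀

/-- The instances are explicit so that the norm of the algebra is the Frobenius norm. -/
lemma exists_rotation_flow (T₀ S : Mat3) (a : ℝ) :
    ∃ T : ℝ → Mat3, T a = T₀ ∧ ∀ t, HasDerivAt T (T t * S) t :=
  @exists_linear_flow Mat3 Matrix.frobeniusNormedRing Matrix.frobeniusNormedAlgebra _ T₀ S a

/-- The inverse of `transition R 0 t`. -/
def transitionInv (R : ℝ → Mat3) (t : ℝ) : Mat6 := (blockRot (R t))ᵀ * shear t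

lemma transitionInv_mul_transition {R : ℝ → Mat3} {t : ℝ} (hR : R t ∈ SO3) :
    transitionInv R t * transition R 0 t = 1 := by
  rw [transitionInv, transition, zero_sub, Matrix.mul_assoc, ← Matrix.mul_assoc (shear t),
    shear_mul_shear_neg, Matrix.one_mul, blockRot_transpose_mul hR]

lemma hasDerivWithinAt_transitionInv {R : ℝ → Mat3} {w : E3} {t : ℝ} {s : Set ℝ}
    (hR : HasDerivWithinAt R (R t * skew w) s t) :
    HasDerivWithinAt (transitionInv R) (matA w * transitionInv R t) s t := by
  have h1 : HasDerivWithinAt (fun t => (blockRot (R t))ᵀ) (blockRot (R t * skew w))ᵀ s t :=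
    hasDerivWithinAt_matrix_transpose (hasDerivWithinAt_linear
      ({ toFun := blockRot
         map_add' := fun A B => by simp [blockRot, Matrix.fromBlocks_add]
         map_smul' := fun c A => by simp [blockRot, Matrix.fromBlocks_smul] } : Mat3 →ₗ[ℝ] Mat6) hR)
  have h2 : HasDerivWithinAt (fun t => shear t) ((1 : ℝ) • nilMat) s t :=
    ((hasDerivWithinAt_id t s).smul_const nilMat).const_add 1
  refine (hasDerivWithinAt_matrix_mul h1 h2).congr_deriv ?_
  have h3 : (blockRot (R t * skew w))ᵀ = -(blockRot (skew w) * (blockRot (R t))ᵀ) := by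
    simp [blockRot, Matrix.fromBlocks_multiply, Matrix.fromBlocks_transpose, skew_transpose,
      Matrix.fromBlocks_neg]
  have h4 : nilMat * shear t = nilMat := by
    simp [shear, Matrix.mul_add, nilMat_mul_nilMat]
  have h5 : nilMat * (blockRot (R t))ᵀ = (blockRot (R t))ᵀ * nilMat := by
    simp [nilMat, blockRot, Matrix.fromBlocks_multiply, Matrix.fromBlocks_transpose]
  rw [matA_eq, h3, transitionInv, Matrix.sub_mul, ← Matrix.mul_assoc nilMat, h5, Matrix.mul_assoc _ nilMat,
    h4, one_smul, Matrix.neg_mul, Matrix.mul_assoc]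
  abel

/-! ### Solving the flow equations by variation of constants -/

section VariationOfConstants

variable {ω : ℝ → E3} {R : ℝ → Mat3} {V : ℝ → Mat6} {a b : ℝ}

namespace FlowData

lemma transitionInv_deriv (hD : FlowData ω R V) (ha : 0 ≤ a) {t : ℝ} (ht : t ∈ Icc a b) :
    HasDerivWithinAt (transitionInv R) (matA (ω t) * transitionInv R t) (Icc a b) t :=
  hasDerivWithinAt_transitionInv ((hD.deriv t (ha.trans ht.1)).mono fun _ hs => ha.trans hs.1)

lemma transition_continuousOn (hD : FlowData ω R V) (ha : 0 ≤ a) :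
    ContinuousOn (transition R 0) (Icc a b) := fun t ht =>
  (hasDerivWithinAt_transition ((hD.deriv t (ha.trans ht.1)).mono
    fun s (hs : s ∈ Icc a b) => ha.trans hs.1)).continuousWithinAt

lemma exists_error_flow (hD : FlowData ω R V) (ha : 0 ≤ a) (hab : a ≤ b) (x₀ : E6) {d : ℝ → E6}
    (hd : ContinuousOn d (Icc a b)) :
    ∃ x : ℝ → E6, x a = x₀ ∧ ∀ t ∈ Icc a b,
      HasDerivWithinAt x (WithLp.toLp 2 (matA (ω t) *ᵥ (x t).ofLp) + d t) (Icc a b) t := by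
  obtain ⟨G, hG0, hG⟩ := exists_primitive hab
    (continuousOn_mulVec (hD.transition_continuousOn ha) hd)
  refine ⟨fun t => WithLp.toLp 2 (transitionInv R t *ᵥ
    (WithLp.toLp 2 (transition R 0 a *ᵥ x₀.ofLp) + G t).ofLp), ?_, fun t ht => ?_⟩
  · simp only [hG0, add_zero]
    rw [Matrix.mulVec_mulVec, transitionInv_mul_transition (hD.mem a ha), Matrix.one_mulVec]
  · refine (hasDerivWithinAt_mulVec (hD.transitionInv_deriv ha ht)
      ((hG t ht).const_add (WithLp.toLp 2 (transition R 0 a *ᵥ x₀.ofLp)))).congr_deriv ?_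
    simp only [← Matrix.mulVec_mulVec]
    congr 1
    rw [Matrix.mulVec_mulVec, transitionInv_mul_transition (hD.mem t (ha.trans ht.1)),
      Matrix.one_mulVec]

/-- Between jumps the Riccati equation is linear: conjugated by the transition matrix, P is its
initial value plus a primitive of ΨVΨᵀ. -/
lemma exists_riccati_flow (hD : FlowData ω R V) (ha : 0 ≤ a) (hab : a ≤ b) (P₀ : Mat6) :
    ∃ P : ℝ → Mat6, P a = P₀ ∧ ∀ t ∈ Icc a b,
      HasDerivWithinAt P (matA (ω t) * P t + P t * (matA (ω t))ᵀ + V t) (Icc a b) t := by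
  have hΨ := hD.transition_continuousOn (b := b) ha
  obtain ⟨G, hG0, hG⟩ := exists_primitive hab
    (continuousOn_matrix_mul (continuousOn_matrix_mul hΨ (hD.V_cont.mono
      fun t (ht : t ∈ Icc a b) => ha.trans ht.1)) (continuousOn_matrix_transpose hΨ))
  refine ⟨fun t => transitionInv R t * (transition R 0 a * P₀ * (transition R 0 a)ᵀ + G t)
    * (transitionInv R t)ᵀ, ?_, fun t ht => ?_⟩
  · have h1 := transitionInv_mul_transition (hD.mem a ha)
    have h2 : (transition R 0 a)ᵀ * (transitionInv R a)ᵀ = 1 := by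
      rw [← Matrix.transpose_mul, h1, Matrix.transpose_one]
    simp only [hG0, add_zero]
    rw [Matrix.mul_assoc, Matrix.mul_assoc _ _ (transitionInv R a)ᵀ, h2, Matrix.mul_one,
      ← Matrix.mul_assoc, h1, Matrix.one_mul]
  · have hΦ := hD.transitionInv_deriv ha ht
    refine (hasDerivWithinAt_matrix_mul (hasDerivWithinAt_matrix_mul hΦ
      ((hG t ht).const_add (transition R 0 a * P₀ * (transition R 0 a)ᵀ)))
      (hasDerivWithinAt_matrix_transpose hΦ)).congr_deriv ?_
    have h1 := transitionInv_mul_transition (hD.mem t (ha.trans ht.1))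
    have h2 : (transition R 0 t)ᵀ * (transitionInv R t)ᵀ = 1 := by
      rw [← Matrix.transpose_mul, h1, Matrix.transpose_one]
    have h3 : transitionInv R t * (transition R 0 t * V t * (transition R 0 t)ᵀ)
        * (transitionInv R t)ᵀ = V t := by
      rw [Matrix.mul_assoc, Matrix.mul_assoc _ _ (transitionInv R t)ᵀ, h2, Matrix.mul_one,
        ← Matrix.mul_assoc, h1, Matrix.one_mul]
    rw [Matrix.add_mul, h3, Matrix.transpose_mul]
    simp only [Matrix.mul_assoc]
    abel

variable {M : Mat3} {g : E3} {kR Tm TM : ℝ} {Q : ℝ → Mat3}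

lemma exists_solvesFlow (hD : FlowData ω R V) (ha : 0 ≤ a) (hab : a ≤ b) (ξ₀ : ExtState) :
    ∃ ψ : ℝ → ExtState, ψ a = ξ₀ ∧ (closedLoop M g kR Tm TM ω R V Q).SolvesFlow a b ψ := by
  obtain ⟨⟨T₀, η₀, x₀, τ₀⟩, P₀⟩ := ξ₀
  obtain ⟨T, hT0, hT⟩ := exists_rotation_flow T₀ (skew (-η₀)) a
  have hTc : ContinuousOn T (Icc a b) := fun t _ => (hT t).continuousAt.continuousWithinAt
  obtain ⟨x, hx0, hx⟩ := hD.exists_error_flow ha hab x₀ (continuousOn_gravTerm g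
    (hD.R_cont.mono fun t (ht : t ∈ Icc a b) => ha.trans ht.1) hTc)
  obtain ⟨P, hP0, hP⟩ := hD.exists_riccati_flow ha hab P₀
  refine ⟨fun t => ((T t, η₀, x t, τ₀ - (t - a)), P t), by simp [hT0, hx0, hP0], fun t ht => ?_⟩
  have hτ : HasDerivWithinAt (fun t => τ₀ - (t - a)) (-1) (Icc a b) t :=
    (((hasDerivWithinAt_id t _).sub_const a).const_sub τ₀)
  exact (HasDerivWithinAt.prodMk (HasDerivWithinAt.prodMk (hT t).hasDerivWithinAt
    (HasDerivWithinAt.prodMk (hasDerivWithinAt_const _ _ _)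
      (HasDerivWithinAt.prodMk (hx t ht) hτ))) (hP t ht))

end FlowData

end VariationOfConstants

/-! ### Hybrid time domains -/

section Domain

variable {E : Set (ℝ × ℕ)}

/-- The jump times of a hybrid time domain before one of its points. -/
lemma IsHybridTimeDomain.exists_jump_times (hE : IsHybridTimeDomain E) {t : ℝ} {j : ℕ}
    (h : (t, j) ∈ E) :
    ∃ s : ℕ → ℝ, s 0 = 0 ∧ Monotone s ∧ s (j + 1) = t ∧
      E ∩ Icc ((0 : ℝ), 0) (t, j) = {q : ℝ × ℕ | q.2 < j + 1 ∧ q.1 ∈ Icc (s q.2) (s (q.2 + 1))} := by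
  obtain ⟨J, s, hs0, hs, hEq⟩ := hE.2.2 _ h
  have ht0 := hE.2.1 _ h
  have h1 : ((t, j) : ℝ × ℕ) ∈ {q : ℝ × ℕ | q.2 < J ∧ q.1 ∈ Icc (s q.2) (s (q.2 + 1))} := by
    rw [← hEq]
    exact ⟨h, ⟨ht0, Nat.zero_le _⟩, le_rfl⟩
  -- Each index i < J contributes a nonempty interval, whose right endpoint must lie in the box up
  -- to (t, j); this forces J = j + 1.
  have key : ∀ i, i < J → i ≤ j ∧ s (i + 1) ≤ t := fun i hi => by
    have h2 : ((s (i + 1), i) : ℝ × ℕ) ∈ E ∩ Icc ((0 : ℝ), 0) (t, j) := by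
      rw [hEq]
      exact ⟨hi, hs (Nat.le_succ i), le_rfl⟩
    exact ⟨h2.2.2.2, h2.2.2.1⟩
  obtain ⟨hj, hj1, hj2⟩ := h1
  simp only at hj hj1 hj2
  have hJ : J = j + 1 := by
    by_contra hne
    have := (key (j + 1) (by omega)).1
    omega
  subst hJ
  exact ⟨s, hs0, hs, le_antisymm (key j hj).2 hj2, hEq⟩

/-- Two points of a hybrid time domain with the same number of jumps belong to one interval. -/
lemma hybridTimeDomain_start_unique {t t' : ℝ} {j : ℕ}
    (htt' : t ≤ t') {s s' : ℕ → ℝ} (hs : Monotone s) (hs' : Monotone s')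
    (h : E ∩ Icc ((0 : ℝ), 0) (t, j) = {q : ℝ × ℕ | q.2 < j + 1 ∧ q.1 ∈ Icc (s q.2) (s (q.2 + 1))})
    (h' : E ∩ Icc ((0 : ℝ), 0) (t', j) =
      {q : ℝ × ℕ | q.2 < j + 1 ∧ q.1 ∈ Icc (s' q.2) (s' (q.2 + 1))}) : s j = s' j := by
  have h1 : ((s j, j) : ℝ × ℕ) ∈ E ∩ Icc ((0 : ℝ), 0) (t, j) := by
    rw [h]; exact ⟨Nat.lt_succ_self j, le_rfl, hs (Nat.le_succ j)⟩
  have h2 : ((s' j, j) : ℝ × ℕ) ∈ E ∩ Icc ((0 : ℝ), 0) (t', j) := by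
    rw [h']; exact ⟨Nat.lt_succ_self j, le_rfl, hs' (Nat.le_succ j)⟩
  have h3 : ((s j, j) : ℝ × ℕ) ∈ E ∩ Icc ((0 : ℝ), 0) (t', j) :=
    ⟨h1.1, h1.2.1, h1.2.2.1.trans htt', le_rfl⟩
  rw [h'] at h3
  have h4 : s' j ≤ s j := h3.2.1
  have h5 : ((s' j, j) : ℝ × ℕ) ∈ E ∩ Icc ((0 : ℝ), 0) (t, j) :=
    ⟨h2.1, h2.2.1, h4.trans (h1.2.2.1), le_rfl⟩
  rw [h] at h5
  exact le_antisymm h5.2.1 h4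

end Domain

/-! ### Solutions of the closed loop as runs -/

section Solutions

variable {M : Mat3} {g : E3} {kR Tm TM : ℝ} {ω : ℝ → E3} {R : ℝ → Mat3} {V : ℝ → Mat6}
  {Q : ℝ → Mat3} {a b : ℝ} {E : Set (ℝ × ℕ)} {φ : ℝ → ℕ → ExtState}

lemma mem_closedLoop_jumpMap {t : ℝ} {ξ ξ' : ExtState} :
    ξ' ∈ (closedLoop M g kR Tm TM ω R V Q).jumpMap t ξ ↔ ∃ ν ∈ Icc Tm TM,
      ξ' = ((ξ.1.1, kR • psi (M * ξ.1.1), errorJump ξ.2 (Q t) ξ.1.2.2.1, ν),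
        riccatiJump ξ.2 (Q t)) := Iff.rfl

lemma mem_closedLoop_jumpSet {ξ : ExtState} :
    ξ ∈ (closedLoop M g kR Tm TM ω R V Q).jumpSet ↔
      ξ ∈ (closedLoop M g kR Tm TM ω R V Q).flowSet ∧ ξ.1.2.2.2 = 0 := Iff.rfl

lemma isClosed_closedLoop_flowSet : IsClosed (closedLoop M g kR Tm TM ω R V Q).flowSet := by
  have h1 : Continuous fun ξ : ExtState => ξ.1.1 := continuous_fst.fst
  have h2 : Continuous fun ξ : ExtState => ξ.1.2.2.2 := continuous_fst.snd.snd.snd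
  exact (isClosed_SO3.preimage h1).inter (isClosed_Icc.preimage h2)

namespace IsSolution

lemma init_mem_flowSet (h : (closedLoop M g kR Tm TM ω R V Q).IsSolution E φ) :
    φ 0 0 ∈ (closedLoop M g kR Tm TM ω R V Q).flowSet := by
  have hc := (isClosed_closedLoop_flowSet (M := M) (g := g) (kR := kR) (Tm := Tm) (TM := TM)
    (ω := ω) (R := R) (V := V) (Q := Q)).closure_eq
  exact h.init_mem.elim (fun h1 => hc ▸ h1) fun h => h.1

/-- The flow map is continuous along the arc, so the almost-everywhere equation holds classically,
endpoints included. -/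
lemma solvesFlow (h : (closedLoop M g kR Tm TM ω R V Q).IsSolution E φ) (hD : FlowData ω R V)
    (ha : 0 ≤ a) (hab : a ≤ b) {j : ℕ} (hE : ∀ r ∈ Icc a b, (r, j) ∈ E) :
    (closedLoop M g kR Tm TM ω R V Q).SolvesFlow a b (fun t => φ t j) := by
  have hac := h.locally_abs_cont j a b hab (hE a (left_mem_Icc.2 hab)) (hE b (right_mem_Icc.2 hab))
  have hc := hac.continuousOn
  rw [uIcc_of_le hab] at hc
  refine hasDerivWithinAt_of_absolutelyContinuous hab hac
    (closedLoop_flowMap_continuousOn hD ha hc) ?_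
  filter_upwards [h.flow j] with t ht hIoo
  exact ht (interior_maximal (fun r hr => hE r (Ioo_subset_Icc_self hr)) isOpen_Ioo hIoo)

lemma length_le (h : (closedLoop M g kR Tm TM ω R V Q).IsSolution E φ) (hD : FlowData ω R V)
    (ha : 0 ≤ a) (hab : a ≤ b) {j : ℕ} (hE : ∀ r ∈ Icc a b, (r, j) ∈ E)
    (hmem : φ a j ∈ (closedLoop M g kR Tm TM ω R V Q).flowSet) :
    b - a ≤ (φ a j).1.2.2.2 := by
  have hf := solvesFlow h hD ha hab hE
  have h0 : 0 ≤ (φ a j).1.2.2.2 := hmem.2.1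
  by_contra! hlt
  -- The midpoint between the expiry of the timer and b: an interior time, as `flow_mem` requires,
  -- at which the timer would be negative.
  have hm : a + ((b - a) + (φ a j).1.2.2.2) / 2 ∈ Ioo a b := ⟨by linarith, by linarith⟩
  have h1 := h.flow_mem j _ (interior_maximal (fun r hr => hE r (Ioo_subset_Icc_self hr))
    isOpen_Ioo hm)
  have h2 := SolvesFlow.τ_eq hf (Ioo_subset_Icc_self hm)
  have h3 : 0 ≤ (φ (a + ((b - a) + (φ a j).1.2.2.2) / 2) j).1.2.2.2 := h1.2.1
  linarith

/-- The solution concept gives membership only at interior times; this extends it to endpoints and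
to levels of zero length. -/
lemma mem_flowSet_of_level (h : (closedLoop M g kR Tm TM ω R V Q).IsSolution E φ)
    (hD : FlowData ω R V) (ha : 0 ≤ a) (hab : a ≤ b) {j : ℕ} (hE : ∀ r ∈ Icc a b, (r, j) ∈ E)
    (hmem : φ a j ∈ (closedLoop M g kR Tm TM ω R V Q).flowSet) {t : ℝ} (ht : t ∈ Icc a b) :
    φ t j ∈ (closedLoop M g kR Tm TM ω R V Q).flowSet := by
  have hf := solvesFlow h hD ha hab hE
  have h1 := SolvesFlow.τ_eq hf ht
  have h2 := length_le h hD ha hab hE hmem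
  have h3 := hmem.2.2
  refine ⟨SolvesFlow.T_mem hf hmem.1 ht, ?_, ?_⟩
  · linarith [ht.2]
  · linarith [ht.1]

end IsSolution

/-- The jump times of `E` before its point `(t, j)`. -/
structure JumpTimes (E : Set (ℝ × ℕ)) (t : ℝ) (j : ℕ) (s : ℕ → ℝ) : Prop where
  zero : s 0 = 0
  mono : Monotone s
  last : s (j + 1) = t
  eq : E ∩ Icc ((0 : ℝ), 0) (t, j) = {q : ℝ × ℕ | q.2 < j + 1 ∧ q.1 ∈ Icc (s q.2) (s (q.2 + 1))}

namespace JumpTimes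

variable {t : ℝ} {j : ℕ} {s : ℕ → ℝ}

lemma nonneg (hs : JumpTimes E t j s) (i : ℕ) : 0 ≤ s i := hs.zero ▸ hs.mono (Nat.zero_le i)

lemma mem (hs : JumpTimes E t j s) {i : ℕ} (hi : i ≤ j) {r : ℝ} (hr : r ∈ Icc (s i) (s (i + 1))) :
    (r, i) ∈ E := by
  have : ((r, i) : ℝ × ℕ) ∈ E ∩ Icc ((0 : ℝ), 0) (t, j) := by
    rw [hs.eq]; exact ⟨Nat.lt_succ_of_le hi, hr⟩
  exact this.1

lemma mem_Icc (hs : JumpTimes E t j s) {i : ℕ} (hi : i ≤ j) {r : ℝ} (hr : (r, i) ∈ E) (h0 : 0 ≤ r)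
    (hrt : r ≤ t) : r ∈ Icc (s i) (s (i + 1)) := by
  have : ((r, i) : ℝ × ℕ) ∈ E ∩ Icc ((0 : ℝ), 0) (t, j) := ⟨hr, ⟨h0, Nat.zero_le _⟩, hrt, hi⟩
  rw [hs.eq] at this
  exact this.2

lemma start_mem (hs : JumpTimes E t j s) {i : ℕ} (hi : i ≤ j) : (s i, i) ∈ E :=
  hs.mem hi (left_mem_Icc.2 (hs.mono (Nat.le_succ i)))

lemma end_mem (hs : JumpTimes E t j s) {i : ℕ} (hi : i ≤ j) : (s (i + 1), i) ∈ E :=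
  hs.mem hi (right_mem_Icc.2 (hs.mono (Nat.le_succ i)))

lemma start_unique {t' : ℝ} {s' : ℕ → ℝ} (hs : JumpTimes E t j s) (hs' : JumpTimes E t' j s') :
    s j = s' j := by
  rcases le_total t t' with h | h
  · exact hybridTimeDomain_start_unique h hs.mono hs'.mono hs.eq hs'.eq
  · exact (hybridTimeDomain_start_unique h hs'.mono hs.mono hs'.eq hs.eq).symm

lemma start_mem_flowSet (hs : JumpTimes E t j s) (hTm : 0 < Tm)
    (h : (closedLoop M g kR Tm TM ω R V Q).IsSolution E φ) :
    ∀ i ≤ j, φ (s i) i ∈ (closedLoop M g kR Tm TM ω R V Q).flowSet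
  | 0, _ => by rw [hs.zero]; exact IsSolution.init_mem_flowSet h
  | i + 1, hi => by
    obtain ⟨h1, h2⟩ := h.jump (s (i + 1)) i (hs.end_mem (by omega)) (hs.start_mem hi)
    obtain ⟨ν, hν, h3⟩ := mem_closedLoop_jumpMap.1 h2
    rw [h3]
    exact ⟨h1.1.1, hTm.le.trans hν.1, hν.2⟩

lemma timer_start_ge (hs : JumpTimes E t j s)
    (h : (closedLoop M g kR Tm TM ω R V Q).IsSolution E φ) {i : ℕ} (hi0 : 1 ≤ i) (hi : i ≤ j) :
    Tm ≤ (φ (s i) i).1.2.2.2 := by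
  obtain ⟨i, rfl⟩ : ∃ k, i = k + 1 := ⟨i - 1, by omega⟩
  obtain ⟨h1, h2⟩ := h.jump (s (i + 1)) i (hs.end_mem (by omega)) (hs.start_mem hi)
  obtain ⟨ν, hν, h3⟩ := mem_closedLoop_jumpMap.1 h2
  rw [h3]
  exact hν.1

lemma solvesFlow (hs : JumpTimes E t j s)
    (h : (closedLoop M g kR Tm TM ω R V Q).IsSolution E φ) (hD : FlowData ω R V) {i : ℕ}
    (hi : i ≤ j) :
    (closedLoop M g kR Tm TM ω R V Q).SolvesFlow (s i) (s (i + 1)) (fun t => φ t i) :=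
  IsSolution.solvesFlow h hD (hs.nonneg i) (hs.mono (Nat.le_succ i)) fun _ hr => hs.mem hi hr

lemma length_le (hs : JumpTimes E t j s) (hTm : 0 < Tm)
    (h : (closedLoop M g kR Tm TM ω R V Q).IsSolution E φ) (hD : FlowData ω R V) {i : ℕ}
    (hi : i ≤ j) : s (i + 1) - s i ≤ (φ (s i) i).1.2.2.2 :=
  IsSolution.length_le h hD (hs.nonneg i) (hs.mono (Nat.le_succ i)) (fun _ hr => hs.mem hi hr)
    (hs.start_mem_flowSet hTm h i hi)

/-- An interval that ends in a jump exhausts its timer. -/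
lemma length_eq (hs : JumpTimes E t j s)
    (h : (closedLoop M g kR Tm TM ω R V Q).IsSolution E φ) (hD : FlowData ω R V) {i : ℕ}
    (hi : i < j) : s (i + 1) - s i = (φ (s i) i).1.2.2.2 := by
  obtain ⟨h1, h2⟩ := h.jump (s (i + 1)) i (hs.end_mem hi.le) (hs.start_mem hi)
  have h3 := SolvesFlow.τ_eq (hs.solvesFlow h hD hi.le)
    (right_mem_Icc.2 (hs.mono (Nat.le_succ i)))
  have h4 : (φ (s (i + 1)) i).1.2.2.2 = 0 := h1.2
  linarith

lemma length_le_TM (hs : JumpTimes E t j s) (hTm : 0 < Tm)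
    (h : (closedLoop M g kR Tm TM ω R V Q).IsSolution E φ) (hD : FlowData ω R V) {i : ℕ}
    (hi : i ≤ j) : s (i + 1) - s i ≤ TM :=
  (hs.length_le hTm h hD hi).trans (hs.start_mem_flowSet hTm h i hi).2.2

lemma length_ge (hs : JumpTimes E t j s)
    (h : (closedLoop M g kR Tm TM ω R V Q).IsSolution E φ) (hD : FlowData ω R V) {i : ℕ}
    (hi0 : 1 ≤ i) (hi : i < j) : Tm ≤ s (i + 1) - s i := by
  rw [hs.length_eq h hD hi]
  exact hs.timer_start_ge h hi0 hi.le

lemma mem_flowSet (hs : JumpTimes E t j s) (hTm : 0 < Tm)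
    (h : (closedLoop M g kR Tm TM ω R V Q).IsSolution E φ) (hD : FlowData ω R V) {i : ℕ}
    (hi : i ≤ j) {r : ℝ} (hr : r ∈ Icc (s i) (s (i + 1))) :
    φ r i ∈ (closedLoop M g kR Tm TM ω R V Q).flowSet :=
  IsSolution.mem_flowSet_of_level h hD (hs.nonneg i) (hs.mono (Nat.le_succ i))
    (fun _ hr => hs.mem hi hr) (hs.start_mem_flowSet hTm h i hi) hr

lemma time_le (hs : JumpTimes E t j s) (hTm : 0 < Tm)
    (h : (closedLoop M g kR Tm TM ω R V Q).IsSolution E φ) (hD : FlowData ω R V) :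
    t ≤ (j + 1) * TM := by
  have : ∀ i ≤ j + 1, s i ≤ i * TM := by
    intro i
    induction i with
    | zero => intro _; simp [hs.zero]
    | succ i ih =>
      intro hi
      have h1 := ih (by omega)
      have h2 := hs.length_le_TM hTm h hD (by omega : i ≤ j)
      push_cast
      linarith
  have h1 := this (j + 1) le_rfl
  rw [hs.last] at h1
  exact_mod_cast h1

lemma attitudeRun (hs : JumpTimes E t j s) (hTm : 0 < Tm)
    (h : (closedLoop M g kR Tm TM ω R V Q).IsSolution E φ) (hD : FlowData ω R V) :
    AttitudeRun M kR Tm TM j s (fun i t => (φ t i).1.1) (fun i t => (φ t i).1.2.1) where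
  zero := hs.zero
  mono := hs.mono
  le := fun _ hi => hs.length_le_TM hTm h hD hi
  ge := fun _ hi0 hi => hs.length_ge h hD hi0 hi
  mem := fun _ hi _ ht => (hs.mem_flowSet hTm h hD hi ht).1
  deriv := fun _ hi _ ht => SolvesFlow.T_deriv (hs.solvesFlow h hD hi) ht
  const := fun _ hi _ ht => SolvesFlow.η_eq (hs.solvesFlow h hD hi) ht
  jump_T := fun i hi => by
    obtain ⟨_, h2⟩ := h.jump (s (i + 1)) i (hs.end_mem hi.le) (hs.start_mem hi)
    obtain ⟨ν, hν, h3⟩ := mem_closedLoop_jumpMap.1 h2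
    simp only [h3]
  jump_η := fun i hi => by
    obtain ⟨_, h2⟩ := h.jump (s (i + 1)) i (hs.end_mem hi.le) (hs.start_mem hi)
    obtain ⟨ν, hν, h3⟩ := mem_closedLoop_jumpMap.1 h2
    simp only [h3]

lemma kalmanRun (hs : JumpTimes E t j s) (hTm : 0 < Tm)
    (h : (closedLoop M g kR Tm TM ω R V Q).IsSolution E φ) (hD : FlowData ω R V) :
    KalmanRun ω V Q Tm TM j s (fun i t => gravTerm g (R t) (φ t i).1.1) (fun i t => (φ t i).2)
      (fun i t => (φ t i).1.2.2.1) where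
  zero := hs.zero
  mono := hs.mono
  le := fun _ hi => hs.length_le_TM hTm h hD hi
  ge := fun _ hi0 hi => hs.length_ge h hD hi0 hi
  flow := fun _ hi => SolvesFlow.riccatiFlow (hs.solvesFlow h hD hi)
  jump_P := fun i hi => by
    obtain ⟨_, h2⟩ := h.jump (s (i + 1)) i (hs.end_mem hi.le) (hs.start_mem hi)
    obtain ⟨ν, hν, h3⟩ := mem_closedLoop_jumpMap.1 h2
    simp only [h3]
  jump_x := fun i hi => by
    obtain ⟨_, h2⟩ := h.jump (s (i + 1)) i (hs.end_mem hi.le) (hs.start_mem hi)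
    obtain ⟨ν, hν, h3⟩ := mem_closedLoop_jumpMap.1 h2
    simp only [h3]

end JumpTimes

lemma IsHybridTimeDomain.jumpTimes (hE : IsHybridTimeDomain E) {t : ℝ} {j : ℕ} (h : (t, j) ∈ E) :
    ∃ s, JumpTimes E t j s := by
  obtain ⟨s, h1, h2, h3, h4⟩ := hE.exists_jump_times h
  exact ⟨s, h1, h2, h3, h4⟩

end Solutions

/-! ### Completeness of maximal solutions -/

section Completeness

variable {M : Mat3} {g : E3} {kR Tm TM : ℝ} {ω : ℝ → E3} {R : ℝ → Mat3} {V : ℝ → Mat6}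
  {Q : ℝ → Mat3} {E : Set (ℝ × ℕ)} {φ : ℝ → ℕ → ExtState} {t : ℝ} {J : ℕ} {s : ℕ → ℝ}

namespace JumpTimes

lemma truncate (hs : JumpTimes E t J s) {i : ℕ} (hi : i ≤ J) : JumpTimes E (s (i + 1)) i s where
  zero := hs.zero
  mono := hs.mono
  last := rfl
  eq := by
    have hst : s (i + 1) ≤ t := hs.last ▸ hs.mono (by omega)
    ext ⟨r, l⟩
    constructor
    · rintro ⟨h1, h2, h3⟩
      exact ⟨Nat.lt_succ_of_le h3.2, hs.mem_Icc (le_trans h3.2 hi) h1 h2.1 (h3.1.trans hst)⟩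
    · rintro ⟨h1, h2⟩
      simp only at h1 h2
      refine ⟨hs.mem (by omega) h2, ⟨(hs.nonneg l).trans h2.1, Nat.zero_le _⟩, ?_, by
        simp only; omega⟩
      exact h2.2.trans (hs.mono (by omega))

lemma start_le (hs : JumpTimes E t J s) (hE : IsHybridTimeDomain E) {r : ℝ} (hr : (r, J) ∈ E) :
    s J ≤ r := by
  obtain ⟨s', hs'⟩ := hE.jumpTimes hr
  rw [hs.start_unique hs', ← hs'.last]
  exact hs'.mono (Nat.le_succ J)

lemma Icc_subset (hs : JumpTimes E t J s) (hE : IsHybridTimeDomain E) {r : ℝ} (hr : (r, J) ∈ E)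
    {u : ℝ} (hu : u ∈ Icc (s J) r) : (u, J) ∈ E := by
  obtain ⟨s', hs'⟩ := hE.jumpTimes hr
  exact hs'.mem le_rfl (by rwa [hs'.last, ← hs.start_unique hs'])

lemma level_le (hs : JumpTimes E t J s) (hTm : 0 < Tm)
    (h : (closedLoop M g kR Tm TM ω R V Q).IsSolution E φ) (hD : FlowData ω R V) {r : ℝ}
    (hr : (r, J) ∈ E) : r ≤ s J + (φ (s J) J).1.2.2.2 := by
  have := IsSolution.length_le h hD (hs.nonneg J) (hs.start_le h.domain hr)
    (fun u hu => hs.Icc_subset h.domain hr hu) (hs.start_mem_flowSet hTm h J le_rfl)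
  linarith

/-- The points of the domain below a jump lie before this jump. -/
lemma le_of_lt (hs : JumpTimes E t J s) (hTm : 0 < Tm)
    (h : (closedLoop M g kR Tm TM ω R V Q).IsSolution E φ) (hD : FlowData ω R V) {r : ℝ} {i : ℕ}
    (hi : i < J) (hr : (r, i) ∈ E) : r ≤ s (i + 1) := by
  have h1 := (hs.truncate hi.le).level_le hTm h hD hr
  have h2 := hs.length_eq h hD hi
  linarith

end JumpTimes

/-- A solution can flow on its last level until the timer expires. -/
lemma IsSolution.prolong_flow (h : (closedLoop M g kR Tm TM ω R V Q).IsSolution E φ)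
    (hD : FlowData ω R V) (hTm : 0 < Tm) (hs : JumpTimes E t J s) (hJ : ∀ q ∈ E, q.2 ≤ J)
    {ψ : ℝ → ExtState} (hψ0 : ψ (s J) = φ (s J) J)
    (hψ : (closedLoop M g kR Tm TM ω R V Q).SolvesFlow (s J) (s J + (φ (s J) J).1.2.2.2) ψ) :
    (closedLoop M g kR Tm TM ω R V Q).IsSolution
      (E ∪ {q | q.2 = J ∧ q.1 ∈ Icc (s J) (s J + (φ (s J) J).1.2.2.2)})
      (fun t j => if j = J then ψ t else φ t j) := by
  have h0 := hs.start_mem_flowSet hTm h J le_rfl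
  have hτ0 : 0 ≤ (φ (s J) J).1.2.2.2 := h0.2.1
  set b := s J + (φ (s J) J).1.2.2.2 with hb
  have hab : s J ≤ b := by linarith
  -- Level J cannot outlast its timer, so after the union it is exactly the interval up to the
  -- expiry.
  have hlev : ∀ r, ((r, J) ∈ E ∪ {q | q.2 = J ∧ q.1 ∈ Icc (s J) b}) ↔ r ∈ Icc (s J) b := fun r =>
    ⟨fun hr => hr.elim (fun hr => ⟨hs.start_le h.domain hr, hs.level_le hTm h hD hr⟩) fun hr => hr.2,
      fun hr => Or.inr ⟨rfl, hr⟩⟩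
  have hlev' : ∀ r j, j ≠ J → (((r, j) ∈ E ∪ {q | q.2 = J ∧ q.1 ∈ Icc (s J) b}) ↔ (r, j) ∈ E) :=
    fun r j hj => ⟨fun hr => hr.elim id fun hr => absurd hr.1 hj, Or.inl⟩
  refine ⟨⟨Or.inl h.domain.1, ?_, ?_⟩, ?_, ?_, ?_, ?_, ?_⟩
  · rintro q (hq | hq)
    · exact h.domain.2.1 q hq
    · exact (hs.nonneg J).trans hq.2.1
  · rintro ⟨r, j⟩ hq
    by_cases hj : j = J
    · subst hj
      rw [hlev] at hq
      -- Completed levels keep their jump times; the last one is cut off at r.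
      refine ⟨j + 1, fun i => if i ≤ j then s i else r, by simp [hs.zero], ?_, ?_⟩
      · refine monotone_nat_of_le_succ fun i => ?_
        rcases lt_trichotomy i j with hi | hi | hi
        · simp only [hi.le, if_true, Nat.succ_le_of_lt hi]
          exact hs.mono (Nat.le_succ i)
        · simp only [hi, le_refl, if_true, add_le_iff_nonpos_right]
          simpa using hq.1
        · rw [if_neg (by omega), if_neg (by omega)]
      · ext ⟨u, i⟩
        simp only [mem_inter_iff, mem_ofPred_eq]
        constructor
        · rintro ⟨h1, h2, h3⟩
          have hi : i ≤ j := h3.2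
          refine ⟨by omega, ?_⟩
          rw [if_pos hi]
          rcases hi.lt_or_eq with hi' | rfl
          · rw [if_pos (by omega)]
            rw [hlev' _ _ hi'.ne] at h1
            have h4 := hs.le_of_lt hTm h hD hi' h1
            exact hs.mem_Icc hi h1 h2.1 (h4.trans (hs.last ▸ hs.mono (by omega)))
          · rw [if_neg (by omega)]
            exact ⟨((hlev u).1 h1).1, h3.1⟩
        · rintro ⟨h1, h2⟩
          have hi : i ≤ j := by omega
          rw [if_pos hi] at h2
          rcases hi.lt_or_eq with hi' | rfl
          · rw [if_pos (by omega)] at h2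
            exact ⟨Or.inl (hs.mem hi h2), ⟨(hs.nonneg i).trans h2.1, Nat.zero_le _⟩,
              (h2.2.trans (hs.mono (by omega))).trans hq.1, hi⟩
          · rw [if_neg (by omega)] at h2
            exact ⟨(hlev u).2 ⟨h2.1, h2.2.trans hq.2⟩,
              ⟨(hs.nonneg i).trans h2.1, Nat.zero_le _⟩, h2.2, le_rfl⟩
    · rw [hlev' _ _ hj] at hq
      have hj' : j < J := lt_of_le_of_ne (hJ _ hq) hj
      have := h.domain.2.2 _ hq
      convert this using 1
      ext ⟨u, i⟩
      refine ⟨fun hu => ⟨(hlev' u i ?_).1 hu.1, hu.2⟩, fun hu => ⟨Or.inl hu.1, hu.2⟩⟩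
      exact (lt_of_le_of_lt hu.2.2.2 hj').ne
  · by_cases hj : 0 = J
    · subst hj
      simp only [if_true]
      have := hψ0
      rw [hs.zero] at this
      rw [this]
      exact h.init_mem
    · simp only [hj, if_false]
      exact h.init_mem
  · intro j u v huv hu hv
    by_cases hj : j = J
    · subst hj
      rw [hlev] at hu hv
      simp only [if_true]
      have hsub : Icc u v ⊆ Icc (s j) b := Icc_subset_Icc hu.1 hv.2
      have hψ' : ∀ r ∈ Icc u v, HasDerivWithinAt ψ _ (Icc u v) r :=
        fun r hr => (hψ r (hsub hr)).mono hsub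
      exact absolutelyContinuousOnInterval_of_hasDerivWithinAt huv hψ'
        (closedLoop_flowMap_continuousOn hD ((hs.nonneg j).trans hu.1)
          fun r hr => (hψ' r hr).continuousWithinAt)
    · simp only [hj, if_false]
      rw [hlev' _ _ hj] at hu hv
      exact h.locally_abs_cont j u v huv hu hv
  · intro j r hr
    by_cases hj : j = J
    · subst hj
      simp only [if_true]
      have hr' : r ∈ Icc (s j) b := by
        have := interior_subset hr
        exact (hlev r).1 this
      refine ⟨SolvesFlow.T_mem hψ (hψ0 ▸ h0.1) hr', ?_⟩
      have h1 := SolvesFlow.τ_eq hψ hr'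
      rw [hψ0] at h1
      have h2 := h0.2.2
      constructor <;> linarith [hr'.1, hr'.2]
    · simp only [hj, if_false, hlev' _ _ hj] at hr ⊢
      exact h.flow_mem j r hr
  · intro j
    by_cases hj : j = J
    · subst hj
      simp only [if_true]
      exact .of_forall fun r hr => by
        have hn : Icc (s j) b ∈ nhds r := by
            have := mem_interior_iff_mem_nhds.1 hr
            exact Filter.mem_of_superset this fun u hu => (hlev u).1 hu
        exact (hψ r (mem_of_mem_nhds hn)).hasDerivAt hn
    · simp only [hj, if_false, hlev' _ _ hj]
      exact h.flow j
  · intro r j hr hr'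
    by_cases hj1 : j + 1 = J
    · have hj : j ≠ J := by omega
      rw [hlev' _ _ hj] at hr
      rw [hj1, hlev] at hr'
      have h1 := hs.le_of_lt hTm h hD (by omega) hr
      rw [hj1] at h1
      have hrs : r = s J := le_antisymm h1 hr'.1
      subst hrs
      have h2 : (s J, j + 1) ∈ E := by rw [hj1]; exact hs.start_mem le_rfl
      have h3 := h.jump _ j hr h2
      simp only [hj, hj1, if_true, if_false, hψ0] at h3 ⊢
      exact h3
    · rw [hlev' _ _ hj1] at hr'
      have hj : j ≠ J := by
        have := hJ _ hr'
        simp only at this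
        omega
      rw [hlev' _ _ hj] at hr
      simp only [hj, hj1, if_false]
      exact h.jump r j hr hr'

/-- A solution which has reached the jump set on its last level can jump. -/
lemma IsSolution.prolong_jump (h : (closedLoop M g kR Tm TM ω R V Q).IsSolution E φ)
    (hs : JumpTimes E t J s) (ht : (t, J) ∈ E) (hJ : ∀ q ∈ E, q.2 ≤ J)
    (hjump : φ t J ∈ (closedLoop M g kR Tm TM ω R V Q).jumpSet) {ξ : ExtState}
    (hξ : ξ ∈ (closedLoop M g kR Tm TM ω R V Q).jumpMap t (φ t J)) :
    (closedLoop M g kR Tm TM ω R V Q).IsSolution (insert (t, J + 1) E)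
      (fun t j => if j = J + 1 then ξ else φ t j) := by
  have ht0 : 0 ≤ t := h.domain.2.1 _ ht
  have hlev : ∀ r, ((r, J + 1) ∈ insert (t, J + 1) E) ↔ r = t := fun r => by
    constructor
    · rintro (hr | hr)
      · exact congrArg Prod.fst hr
      · have := hJ _ hr
        simp only at this
        omega
    · rintro rfl
      exact Or.inl rfl
  have hlev' : ∀ r j, j ≠ J + 1 → ((r, j) ∈ insert (t, J + 1) E ↔ (r, j) ∈ E) := fun r j hj =>
    ⟨fun hr => hr.elim (fun hr => absurd (congrArg Prod.snd hr) hj) id, Or.inr⟩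
  refine ⟨⟨Or.inr h.domain.1, ?_, ?_⟩, ?_, ?_, ?_, ?_, ?_⟩
  · rintro q (rfl | hq)
    · exact ht0
    · exact h.domain.2.1 q hq
  · rintro ⟨r, j⟩ hq
    by_cases hj : j = J + 1
    · subst hj
      obtain rfl := (hlev r).1 hq
      refine ⟨J + 2, fun i => if i ≤ J + 1 then s i else r, by simp [hs.zero], ?_, ?_⟩
      · refine monotone_nat_of_le_succ fun i => ?_
        rcases lt_trichotomy i (J + 1) with hi | hi | hi
        · rw [if_pos (by omega), if_pos (by omega)]
          exact hs.mono (Nat.le_succ i)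
        · subst hi
          rw [if_pos (by omega), if_neg (by omega), hs.last]
        · rw [if_neg (by omega), if_neg (by omega)]
      · ext ⟨u, i⟩
        simp only [mem_inter_iff, mem_ofPred_eq]
        constructor
        · rintro ⟨h1, h2, h3⟩
          have hi : i ≤ J + 1 := h3.2
          refine ⟨by omega, ?_⟩
          rw [if_pos hi]
          rcases hi.lt_or_eq with hi' | rfl
          · rw [if_pos (by omega)]
            rw [hlev' _ _ hi'.ne] at h1
            exact hs.mem_Icc (by omega) h1 h2.1 h3.1
          · rw [if_neg (by omega), (hlev u).1 h1, hs.last]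
            exact ⟨le_rfl, le_rfl⟩
        · rintro ⟨h1, h2⟩
          have hi : i ≤ J + 1 := by omega
          rw [if_pos hi] at h2
          rcases hi.lt_or_eq with hi' | rfl
          · rw [if_pos (by omega)] at h2
            exact ⟨Or.inr (hs.mem (by omega) h2), ⟨(hs.nonneg i).trans h2.1, Nat.zero_le _⟩,
              (h2.2.trans (hs.mono (by omega))).trans hs.last.le, hi⟩
          · rw [if_neg (by omega), hs.last] at h2
            obtain rfl := le_antisymm h2.2 h2.1
            exact ⟨hq, ⟨ht0, Nat.zero_le _⟩, le_rfl⟩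
    · rw [hlev' _ _ hj] at hq
      have hj' : j < J + 1 := Nat.lt_succ_of_le (hJ _ hq)
      have := h.domain.2.2 _ hq
      convert this using 1
      ext ⟨u, i⟩
      refine ⟨fun hu => ⟨(hlev' u i ?_).1 hu.1, hu.2⟩, fun hu => ⟨Or.inr hu.1, hu.2⟩⟩
      exact (lt_of_le_of_lt hu.2.2.2 hj').ne
  · simp only [(Nat.succ_ne_zero J).symm, if_false]
    exact h.init_mem
  · intro j u v huv hu hv
    by_cases hj : j = J + 1
    · subst hj
      simp only [if_true]
      exact absolutelyContinuousOnInterval_of_hasDerivWithinAt (f' := fun _ => 0) huv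
        (fun r _ => hasDerivWithinAt_const _ _ _) continuousOn_const
    · simp only [hj, if_false]
      rw [hlev' _ _ hj] at hu hv
      exact h.locally_abs_cont j u v huv hu hv
  · intro j r hr
    by_cases hj : j = J + 1
    · subst hj
      -- The new level is a single point, with empty interior, so the flow conditions are vacuous.
      simp only [hlev, ofPred_eq_eq_singleton, interior_singleton] at hr
      exact hr.elim
    · simp only [hj, if_false, hlev' _ _ hj] at hr ⊢
      exact h.flow_mem j r hr
  · intro j
    by_cases hj : j = J + 1
    · subst hj
      simp only [hlev, ofPred_eq_eq_singleton, interior_singleton]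
      exact .of_forall fun r hr => hr.elim
    · simp only [hj, if_false, hlev' _ _ hj]
      exact h.flow j
  · intro r j hr hr'
    have hj : j ≠ J + 1 := by
      rintro rfl
      rw [hlev' _ _ (by omega)] at hr'
      have := hJ _ hr'
      simp only at this
      omega
    rw [hlev' _ _ hj] at hr
    by_cases hj1 : j = J
    · subst hj1
      obtain rfl := (hlev r).1 hr'
      simp only [hj, if_true, if_false]
      exact ⟨hjump, hξ⟩
    · have hj1' : j + 1 ≠ J + 1 := by omega
      rw [hlev' _ _ hj1'] at hr'
      simp only [hj, hj1', if_false]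
      exact h.jump r j hr hr'

/-- Maximal solutions are complete. -/
lemma isCompleteDomain_of_isMaximalSolution
    (h : (closedLoop M g kR Tm TM ω R V Q).IsMaximalSolution E φ) (hD : FlowData ω R V)
    (hTm : 0 < Tm) (hTM : Tm ≤ TM) : IsCompleteDomain E := by
  obtain ⟨h, hmax⟩ := h
  by_contra hc
  simp only [IsCompleteDomain, not_forall, not_exists, not_and, not_le] at hc
  obtain ⟨b, hb⟩ := hc
  obtain ⟨B, hB⟩ := exists_nat_ge b
  obtain ⟨J, ⟨⟨t, hJE⟩, hJ⟩⟩ : ∃ J, (∃ t, (t, J) ∈ E) ∧ ∀ q ∈ E, q.2 ≤ J := by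
    have hbdd : BddAbove {j : ℕ | ∃ t, (t, j) ∈ E} := by
      refine ⟨B, ?_⟩
      rintro j ⟨t, ht⟩
      have h1 := hb _ ht
      have h2 := h.domain.2.1 _ ht
      simp only at h1 h2
      exact_mod_cast (show (j : ℝ) ≤ B by linarith)
    exact ⟨_, Nat.sSup_mem (s := {j : ℕ | ∃ t, (t, j) ∈ E}) ⟨0, 0, h.domain.1⟩ hbdd, fun q hq => le_csSup hbdd ⟨q.1, hq⟩⟩
  obtain ⟨s, hs⟩ := h.domain.jumpTimes hJE
  have h0 := hs.start_mem_flowSet hTm h J le_rfl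
  have hτ0 : 0 ≤ (φ (s J) J).1.2.2.2 := h0.2.1
  obtain ⟨ψ, hψ0, hψ⟩ := hD.exists_solvesFlow (M := M) (g := g) (kR := kR) (Tm := Tm) (TM := TM)
    (Q := Q) (hs.nonneg J) (le_add_of_nonneg_right hτ0) (φ (s J) J)
  -- The classical flow agrees with φ where both exist, by uniqueness, so maximality puts the expiry
  -- time of level J into E.
  have hend := hmax _ _ (IsSolution.prolong_flow h hD hTm hs hJ hψ0 hψ) subset_union_left (by
    rintro ⟨r, j⟩ hq
    by_cases hj : j = J
    · subst hj
      simp only [if_true]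
      have h1 := hs.start_le h.domain hq
      have h2 := hs.level_le hTm h hD hq
      exact SolvesFlow.unique hD (hs.nonneg j) (hψ.mono h2)
        (IsSolution.solvesFlow h hD (hs.nonneg j) h1 fun u hu => hs.Icc_subset h.domain hq hu)
        hψ0 (right_mem_Icc.2 h1)
    · simp only [hj, if_false])
  have hT : (s J + (φ (s J) J).1.2.2.2, J) ∈ E := by
    rw [← hend]
    exact Or.inr ⟨rfl, right_mem_Icc.2 (le_add_of_nonneg_right hτ0)⟩
  obtain ⟨s', hs'⟩ := h.domain.jumpTimes hT
  have hmem : φ (s J + (φ (s J) J).1.2.2.2) J ∈ (closedLoop M g kR Tm TM ω R V Q).flowSet :=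
    hs'.mem_flowSet hTm h hD le_rfl ⟨hs'.last ▸ hs'.mono (Nat.le_succ J), hs'.last.ge⟩
  have hτ := SolvesFlow.τ_eq (IsSolution.solvesFlow h hD (hs.nonneg J)
    (le_add_of_nonneg_right hτ0) fun u hu => hs.Icc_subset h.domain hT hu)
    (right_mem_Icc.2 (le_add_of_nonneg_right hτ0))
  -- At expiry the state is in the jump set and the new timer T_m is admissible; maximality then
  -- gives a point on level J + 1, contradicting the choice of J.
  have hjump := hmax _ _ (IsSolution.prolong_jump h hs' hT hJ
    (mem_closedLoop_jumpSet.2 ⟨hmem, by linarith⟩)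
    (mem_closedLoop_jumpMap.2 ⟨Tm, left_mem_Icc.2 hTM, rfl⟩)) (subset_insert _ _) (by
    rintro ⟨r, j⟩ hq
    have : j ≠ J + 1 := by
      have := hJ _ hq
      simp only at this
      omega
    simp only [this, if_false])
  have hlast : (s J + (φ (s J) J).1.2.2.2, J + 1) ∈ E := by
    rw [← hjump]
    exact mem_insert _ _
  have := hJ _ hlast
  simp only at this
  omega

end Completeness

/-! ### The distance to the target set -/

/-- The nearest point of the target has the same timer as ξ, so the timer does not contribute. -/
lemma distTarget_eq {TM : ℝ} {ξ : ExtState} (hτ : ξ.1.2.2.2 ∈ Icc 0 TM) :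
    distTarget TM ξ = √(attNorm ξ.1.1 ^ 2 + ‖ξ.1.2.1‖ ^ 2 + ‖ξ.1.2.2.1‖ ^ 2) := by
  refine IsLeast.csInf_eq ⟨⟨(1, 0, 0, ξ.1.2.2.2), ⟨⟨by simp [SO3], hτ⟩, rfl, by simp, by simp⟩, ?_⟩,
    ?_⟩
  · simp [errDist]
  · rintro _ ⟨⟨T, η, x, τ⟩, ⟨-, h1, h2, h3⟩, rfl⟩
    simp only [norm_eq_zero] at h1 h2 h3
    subst h1 h2 h3
    refine Real.sqrt_le_sqrt ?_
    simp only [Matrix.transpose_one, Matrix.mul_one, sub_zero]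
    exact le_add_of_nonneg_right (sq_nonneg _)

lemma distTarget_sq {TM : ℝ} {ξ : ExtState} (hτ : ξ.1.2.2.2 ∈ Icc 0 TM) :
    distTarget TM ξ ^ 2 = attNorm ξ.1.1 ^ 2 + ‖ξ.1.2.1‖ ^ 2 + ‖ξ.1.2.2.1‖ ^ 2 := by
  rw [distTarget_eq hτ, Real.sq_sqrt (by positivity)]

lemma distTarget_nonneg {TM : ℝ} {ξ : ExtState} (hτ : ξ.1.2.2.2 ∈ Icc 0 TM) :
    0 ≤ distTarget TM ξ := by
  rw [distTarget_eq hτ]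
  exact Real.sqrt_nonneg _

/-! ### The coefficients of the Riccati equation -/

section Coefficients

variable {n : Type*} [DecidableEq n] {S : Matrix n n ℝ} {c : ℝ}

lemma posDef_of_sub_smul_one (hc : 0 < c) (h : (S - c • (1 : Matrix n n ℝ)).PosSemidef) :
    S.PosDef := by
  have h1 : (c • (1 : Matrix n n ℝ)).PosDef := Matrix.PosDef.one.smul hc
  have := Matrix.PosDef.posSemidef_add h h1
  rwa [sub_add_cancel] at this

lemma smul_le_quad_of_sub_smul_one [Fintype n] (h : (S - c • (1 : Matrix n n ℝ)).PosSemidef) (w : n → ℝ) :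
    c * (w ⬝ᵥ w) ≤ quad S w := by
  have := quad_nonneg h w
  rw [quad, Matrix.sub_mulVec, dotProduct_sub, Matrix.smul_mulVec, Matrix.one_mulVec,
    dotProduct_smul, smul_eq_mul] at this
  rw [quad]
  linarith

lemma exists_riccatiData {ω : ℝ → E3} {R : ℝ → Mat3} {V : ℝ → Mat6} {Q : ℝ → Mat3}
    (hV_bdd : BoundedOnNonneg V)
    (hV_pos : ∃ c : ℝ, 0 < c ∧ ∀ t ≥ 0, (V t - c • (1 : Mat6)).PosSemidef)
    (hQ_bdd : BoundedOnNonneg Q)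
    (hQ_pos : ∃ c : ℝ, 0 < c ∧ ∀ t ≥ 0, (Q t - c • (1 : Mat3)).PosSemidef) (hR : ∀ t ≥ 0, R t ∈ SO3)
    (hR' : ∀ t ≥ 0, HasDerivWithinAt R (R t * skew (ω t)) (Ici 0) t) :
    ∃ vm vM qM : ℝ, 0 ≤ vM ∧ 0 ≤ qM ∧ RiccatiData ω R V Q vm vM qM := by
  obtain ⟨vM, hvM⟩ := hV_bdd
  obtain ⟨qM, hqM⟩ := hQ_bdd
  obtain ⟨vm, hvm, hV⟩ := hV_pos
  obtain ⟨qm, hqm, hQ⟩ := hQ_pos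
  refine ⟨vm, vM, qM, (norm_nonneg _).trans (hvM 0 le_rfl), (norm_nonneg _).trans (hqM 0 le_rfl),
    hR, hR', hvm, fun t ht => transpose_eq_of_isHermitian (posDef_of_sub_smul_one hvm (hV t ht)).1,
    fun t ht w => smul_le_quad_of_sub_smul_one (hV t ht) w, fun t ht w => ?_,
    fun t ht => posDef_of_sub_smul_one hqm (hQ t ht), fun t ht w => ?_⟩
  · exact (quad_le_norm _ w).trans
      (mul_le_mul_of_nonneg_right (hvM t ht) (dotProduct_self_nonneg_real w))
  · exact (quad_le_norm _ w).trans
      (mul_le_mul_of_nonneg_right (hqM t ht) (dotProduct_self_nonneg_real w))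

end Coefficients

/-! ### Exponential stability -/

/-- A geometric bound in the number of jumps is an exponential bound in the hybrid time, if the
ordinary time grows at most linearly in the number of jumps. -/
lemma exists_exp_le_of_pow_le {C γ TM : ℝ} (hC : 0 ≤ C) (hγ0 : 0 < γ) (hγ1 : γ < 1)
    (hTM : 0 < TM) :
    ∃ κ > 0, ∃ lam > 0, ∀ (j : ℕ) (t D D₀ : ℝ), t ≤ (j + 1) * TM → 0 ≤ D₀ →
      D ^ 2 ≤ C * γ ^ j * D₀ ^ 2 → D ≤ κ * Real.exp (-lam * (t + j)) * D₀ := by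
  have hlog : Real.log γ < 0 := Real.log_neg hγ0 hγ1
  -- Chosen so that γ = exp(-2 lam (T_M + 1)), as t + j ≤ j(T_M + 1) + T_M. The excess T_M is paid
  -- by the factor exp(lam T_M) in κ, and √C + 1 keeps κ positive even if C = 0.
  set lam := -Real.log γ / (2 * (TM + 1)) with hlam
  have hlam0 : 0 < lam := div_pos (by linarith) (by positivity)
  have hl : 2 * lam * (TM + 1) = -Real.log γ := by
    rw [hlam]; field_simp
  refine ⟨(√C + 1) * Real.exp (lam * TM), by positivity, lam, hlam0, fun j t D D₀ ht hD₀ hD => ?_⟩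
  refine abs_le_of_sq_le_sq' (hD.trans ?_) (by positivity) |>.2
  rw [mul_pow _ D₀]
  refine mul_le_mul_of_nonneg_right ?_ (sq_nonneg _)
  have h1 : C ≤ (√C + 1) ^ 2 := by
    have := Real.sq_sqrt hC
    have := Real.sqrt_nonneg C
    nlinarith
  have h2 : γ ^ j ≤ (Real.exp (lam * TM) * Real.exp (-lam * (t + j))) ^ 2 := by
    rw [← Real.exp_add, ← Real.exp_nat_mul, ← Real.exp_log hγ0, ← Real.exp_nat_mul]
    refine Real.exp_le_exp.2 ?_
    have h3 : Real.log γ = -(2 * lam * (TM + 1)) := by linarith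
    rw [h3]
    have h4 := mul_le_mul_of_nonneg_left ht hlam0.le
    push_cast
    linarith
  calc C * γ ^ j ≤ (√C + 1) ^ 2 * (Real.exp (lam * TM) * Real.exp (-lam * (t + j))) ^ 2 :=
        mul_le_mul h1 h2 (by positivity) (by positivity)
    _ = _ := by ring

/-- The cascade is assembled here: attitude decay bounds the gravity term geometrically, which is
the input required by `KalmanRun.exists_error_le`. -/
lemma closedLoop_expStable {M : Mat3} {g : E3} {kR Tm TM : ℝ} {ω : ℝ → E3} {R : ℝ → Mat3}
    {V : ℝ → Mat6} {Q : ℝ → Mat3} {vm vM qM K γ δ ηStar : ℝ} {P₀ : Mat6}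
    (hD : FlowData ω R V) (hR : RiccatiData ω R V Q vm vM qM) (hvM : 0 ≤ vM) (hqM : 0 ≤ qM)
    (hTm : 0 < Tm) (hTM : Tm ≤ TM) (hP₀ : P₀.PosDef) (hK : 0 ≤ K) (hγ0 : 0 < γ) (hγ1 : γ < 1)
    (hδ : 0 < δ) (hη : 0 < ηStar)
    (hatt : ∀ (n : ℕ) (s : ℕ → ℝ) (T : ℕ → ℝ → Mat3) (η : ℕ → ℝ → E3),
      AttitudeRun M kR Tm TM n s T η → attNorm (T 0 0) ≤ δ → ‖η 0 0‖ ≤ ηStar →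
      ∀ i ≤ n, ∀ t ∈ Icc (s i) (s (i + 1)),
        attNorm (T i t) ^ 2 + ‖η i t‖ ^ 2 ≤ K * γ ^ i * (attNorm (T 0 0) ^ 2 + ‖η 0 0‖ ^ 2)) :
    (closedLoop M g kR Tm TM ω R V Q).ExpStable (distTarget TM) {ξ | ξ.2 = P₀}
      {ξ | attNorm ξ.1.1 ≤ δ ∧ ‖ξ.1.2.1‖ ≤ ηStar} := by
  have hTM0 : 0 < TM := hTm.trans_le hTM
  obtain ⟨K', hK', γ', hγγ', hγ'0, hγ'1, hkal⟩ :=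
    KalmanRun.exists_error_le hR hvM hqM hTm hTM hP₀ hγ0.le hγ1
  set G := 8 * ‖g‖ ^ 2 * K with hG
  have hG0 : 0 ≤ G := by positivity
  obtain ⟨κ, hκ, lam, hlam, hexp⟩ := exists_exp_le_of_pow_le (C := K + K' * (1 + G)) (by positivity)
    hγ'0 hγ'1 hTM0
  -- With μ = min δ ηStar, closeness to the target already implies the restrictions on R̃ and η.
  refine ⟨κ, hκ, lam, hlam, min δ ηStar, lt_min hδ hη, fun E φ hmax hS hreg => ?_⟩
  have h := hmax.1
  refine ⟨isCompleteDomain_of_isMaximalSolution hmax hD hTm hTM, ?_⟩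
  have h0 := IsSolution.init_mem_flowSet h
  have hd0 := distTarget_sq h0.2
  have hd0' := distTarget_nonneg h0.2
  have hreg' : attNorm (φ 0 0).1.1 ≤ δ ∧ ‖(φ 0 0).1.2.1‖ ≤ ηStar := by
    rcases hreg with hlt | hreg
    · have h1 : attNorm (φ 0 0).1.1 ≤ distTarget TM (φ 0 0) :=
        abs_le_of_sq_le_sq' (by rw [hd0, add_assoc]; exact le_add_of_nonneg_right (by positivity))
          hd0' |>.2
      have h2 : ‖(φ 0 0).1.2.1‖ ≤ distTarget TM (φ 0 0) :=
        abs_le_of_sq_le_sq' (by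
          rw [hd0]
          linarith [sq_nonneg (attNorm (φ 0 0).1.1), sq_nonneg ‖(φ 0 0).1.2.2.1‖]) hd0' |>.2
      exact ⟨h1.trans (hlt.le.trans (min_le_left _ _)), h2.trans (hlt.le.trans (min_le_right _ _))⟩
    · exact hreg
  rintro ⟨t, j⟩ hq
  obtain ⟨s, hs⟩ := h.domain.jumpTimes hq
  have hatt' := hatt j s _ _ (hs.attitudeRun hTm h hD) hreg'.1 hreg'.2
  set ρ := attNorm (φ 0 0).1.1 ^ 2 + ‖(φ 0 0).1.2.1‖ ^ 2 with hρ
  have hρ0 : 0 ≤ ρ := by positivity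
  have hgrav : ∀ i ≤ j, ∀ r ∈ Icc (s i) (s (i + 1)),
      ‖gravTerm g (R r) (φ r i).1.1‖ ^ 2 ≤ γ ^ i * (G * ρ) := fun i hi r hr => by
    refine (norm_gravTerm_sq_le g (hD.mem r ((hs.nonneg i).trans hr.1))
      (hs.mem_flowSet hTm h hD hi hr).1).trans ?_
    have h1 : attNorm (φ r i).1.1 ^ 2 ≤ K * γ ^ i * ρ :=
      (le_add_of_nonneg_right (sq_nonneg _)).trans (hatt' i hi r hr)
    refine (mul_le_mul_of_nonneg_left h1 (by positivity)).trans (le_of_eq ?_)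
    rw [hG]; ring
  have ht : t ∈ Icc (s j) (s (j + 1)) := ⟨hs.last ▸ hs.mono (Nat.le_succ j), hs.last.ge⟩
  have h1 := hatt' j le_rfl t ht
  have h2 := hkal j s _ _ _ _ (hs.kalmanRun hTm h hD) hS hgrav j le_rfl t ht
  have hmem := hs.mem_flowSet hTm h hD le_rfl ht
  refine hexp j t _ _ (hs.time_le hTm h hD) hd0' ?_
  rw [distTarget_sq hmem.2, hd0]
  have h3 : K * γ ^ j * ρ ≤ K * γ' ^ j * ρ :=
    mul_le_mul_of_nonneg_right (mul_le_mul_of_nonneg_left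
      (pow_le_pow_left₀ hγ0.le hγγ' j) hK) hρ0
  have hx0 := sq_nonneg ‖(φ 0 0).1.2.2.1‖
  have hp : 0 ≤ γ' ^ j := by positivity
  have h4 : K * ρ + K' * (‖(φ 0 0).1.2.2.1‖ ^ 2 + G * ρ)
      ≤ (K + K' * (1 + G)) * (ρ + ‖(φ 0 0).1.2.2.1‖ ^ 2) := by
    have e1 := mul_nonneg hK hx0
    have e2 := mul_nonneg hK' hρ0
    have e3 := mul_nonneg hK' (mul_nonneg hG0 hx0)
    linarith
  have h5 := mul_le_mul_of_nonneg_left h4 hp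
  linarith

/-- Exponential stability of the closed loop, the lower bounds of `V` and `Q` being arbitrary positive
real numbers. -/
theorem exists_closedLoop_expStable {N : ℕ} (p : Fin N → E3) (k : Fin N → ℝ) (hk : ∀ i, 0 < k i)
    (hp : ∃ i₁ i₂ i₃, ¬ Collinear ℝ {p i₁, p i₂, p i₃}) (g : E3) {Tm TM : ℝ} (hTm : 0 < Tm)
    (hTM : Tm ≤ TM) {ω : ℝ → E3} (hω : ContinuousOn ω (Ici 0)) {V : ℝ → Mat6}
    (hV : ContinuousOn V (Ici 0)) (hV_bdd : BoundedOnNonneg V)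
    (hV_pos : ∃ c : ℝ, 0 < c ∧ ∀ t ≥ 0, (V t - c • (1 : Mat6)).PosSemidef)
    {Q : ℝ → Mat3} (hQ_bdd : BoundedOnNonneg Q)
    (hQ_pos : ∃ c : ℝ, 0 < c ∧ ∀ t ≥ 0, (Q t - c • (1 : Mat3)).PosSemidef)
    {ε : ℝ} (hε : 0 < ε) (hε_one : ε < 1) :
    ∃ ηStar > 0, ∃ kRStar > 0, ∀ kR : ℝ, 0 < kR → kR < kRStar →
      ∀ R : ℝ → Mat3, (∀ t ≥ 0, R t ∈ SO3) →
        (∀ t ≥ 0, HasDerivWithinAt R (R t * skew (ω t)) (Ici 0) t) →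
      ∀ P₀ : Mat6, P₀.PosDef →
        (closedLoop (landmarkMatrix p k) g kR Tm TM ω R V Q).ExpStable (distTarget TM)
          {ξ | ξ.2 = P₀}
          {ξ | attNorm ξ.1.1 ≤ ε * Real.sqrt (eigRatio (landmarkMatrix p k)) ∧
            ‖ξ.1.2.1‖ ≤ ηStar} := by
  obtain ⟨a, b, hM, hab⟩ := exists_attitudeBounds p k hk hp
  obtain ⟨ηStar, hηStar, kRStar, hkRStar, hkey⟩ := hM.exists_attitude_le hTm hTM hε hε_one
  refine ⟨ηStar, hηStar, kRStar, hkRStar, fun kR hkR hkR' R hR hR' P₀ hP₀ => ?_⟩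
  obtain ⟨K, hK, γ, hγ0, hγ1, hatt⟩ := hkey kR hkR hkR'
  obtain ⟨vm, vM, qM, hvM, hqM, hRic⟩ := exists_riccatiData hV_bdd hV_pos hQ_bdd hQ_pos hR hR'
  rw [hab]
  exact closedLoop_expStable ⟨hR, hR', hω, hV⟩ hRic hvM hqM hTm hTM hP₀ hK hγ0 hγ1
    (mul_pos hε (Real.sqrt_pos.2 (div_pos hM.pos (hM.pos.trans_le hM.le)))) hηStar hatt

/-- The constant in `UniformlyPosDef`, a natural number, as a real number. -/
lemma UniformlyPosDef.exists_real {n : Type*} [Fintype n] [DecidableEq n] {S : ℝ → Matrix n n ℝ}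
    (h : UniformlyPosDef S) :
    ∃ c : ℝ, 0 < c ∧ ∀ t ≥ 0, (S t - c • (1 : Matrix n n ℝ)).PosSemidef := by
  obtain ⟨c, hc, h⟩ := h
  exact ⟨c, by exact_mod_cast hc, fun t ht => by simpa only [Nat.cast_smul_eq_nsmul] using h t ht⟩

end HybridObserver

end

open HybridObserver
theorem theorem3
    {N : ℕ} (p : Fin N → E3) (k : Fin N → ℝ)
    (hk : ∀ i, 0 < k i) (hk_sum : ∑ i, k i = 1)
    (hp : ∃ i₁ i₂ i₃, ¬ Collinear ℝ {p i₁, p i₂, p i₃})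
    (g : E3) (Tm TM : ℝ) (hTm : 0 < Tm) (hTM : Tm ≤ TM)
    (ω : ℝ → E3) (hω : ContinuousOn ω (Ici 0)) (hω_bdd : BoundedOnNonneg ω)
    (V : ℝ → Mat6) (hV : ContinuousOn V (Ici 0)) (hV_bdd : BoundedOnNonneg V)
    (hV_pos : UniformlyPosDef V)
    (Q : ℝ → Mat3) (hQ_bdd : BoundedOnNonneg Q) (hQ_pos : UniformlyPosDef Q)
    (ε : ℝ) (hε : 0 < ε) (hε_one : ε < 1) :
    ∃ ηStar > 0, ∃ kRStar > 0, ∀ kR : ℝ, 0 < kR → kR < kRStar →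
      ∀ R : ℝ → Mat3, (∀ t ≥ 0, R t ∈ SO3) →
        (∀ t ≥ 0, HasDerivWithinAt R (R t * skew (ω t)) (Ici 0) t) →
      ∀ P₀ : Mat6, P₀.PosDef →
        (closedLoop (landmarkMatrix p k) g kR Tm TM ω R V Q).ExpStable (distTarget TM)
          {ξ | ξ.2 = P₀}
          {ξ | attNorm ξ.1.1 ≤ ε * Real.sqrt (eigRatio (landmarkMatrix p k)) ∧
            ‖ξ.1.2.1‖ ≤ ηStar} := by
  -- In `UniformlyPosDef` the constant c elaborates, by numeral default, as a natural number, so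
  -- that hypothesis means S ≥ I at least; the theorem applied here covers every real c > 0.
  exact exists_closedLoop_expStable p k hk hp g hTm hTM hω hV hV_bdd hV_pos.exists_real hQ_bdd
    hQ_pos.exists_real hε hε_one
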